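/- \textbf{Conventions.} All alphabets are standard Borel spaces. $D(\cdot\|\cdot)$ is relative entropy, $I(A;B)=D(P_{AB}\|P_A\times P_B)$ and $I(A;B|C)=D(P_{CAB}\|P_CP_{A|C}P_{B|C})$. Every supremum of a ratio below is taken over those choices for which all informations and divergences that occur in the ratio are finite and the denominator is nonzero, and is set to $0$ if there is no such choice. For a law $P_{XYZ}$ define $$s^*_Z(X;Y):=\sup_{U,V}\frac{I(V;Y|U)-I(V;Z|U)}{I(V;X|U)-I(V;Z|U)+I(U;X)-I(U;Y)},$$ where the supremum is over all $(U,V)$ such that $(U,V)-X-(Y,Z)$ is a Markov chain. For a law $P_{XY}$ define $$s^*(X;Y):=\sup_{Q_X\ne P_X}\frac{D(Q_Y\|P_Y)}{D(Q_X\|P_X)},$$ where $Q_Y$ is the output distribution of $P_{Y|X}$ for the input distribution $Q_X$. The source $P_{XYZ}$ is stochastically degraded if there is a joint law $\tilde P_{XYZ}$ with $\tilde P_{XY}=P_{XY}$ and $\tilde P_{XZ}=P_{XZ}$ under which $X-Y-Z$ is a Markov chain. \textbf{Theorem.} \begin{enumerate} \item For any $P_{XYZ}$, $0\le s^*_Z(X;Y)\le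 1$. \item Let $L\ge1$. If $P_{X^LY^L}=\prod_{i=1}^LP_{X_iY_i}$ and $P_{X^LZ^L}=\prod_{i=1}^LP_{X_iZ_i}$, then $$s^*_{Z^L}(X^L;Y^L)=\max_{1\le i\le L}s^*_{Z_i}(X_i;Y_i).$$ \item For any $P_{XYZ}=P_XP_{YZ|X}$, $$s^*_Z(X;Y)=\sup_{Q_{VX}}\frac{I(\bar V;\bar Y)-I(\bar V;\bar Z)}{I(\bar V;\bar X)-I(\bar V;\bar Z)+D(Q_X\|P_X)-D(Q_Y\|P_Y)},$$ where $(\bar V,\bar X,\bar Y,\bar Z)$ has the joint law $Q_{VX}P_{YZ|X}$ and $Q_X$, $Q_Y$ are the laws of $\bar X$, $\bar Y$. \item If $P_{XYZ}$ is stochastically degraded, then $$s^*_Z(X;Y)=\sup_{U}\frac{I(U;Y|Z)}{I(U;X|Z)}=\sup_{Q_X}\frac{D(Q_Y\|P_Y)-D(Q_Z\|P_Z)}{D(Q_X\|P_X)-D(Q_Z\|P_Z)},$$ where $Q_{XYZ}=Q_XP_{YZ|X}$, the first supremum is over all $U$ such that $U-X-(Y,Z)$ is a Markov chain, and the conditional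 informations in it are computed with $(X,Y,Z)$ distributed according to any law $\tilde P_{XYZ}$ as in the definition of stochastic degradedness (in particular, according to $P_{XYZ}$ itself if $X-Y-Z$ is a Markov chain under it). \item If $X=(X',Z)$ and $Y=(Y',Z)$, then $$s^*_Z(X;Y)=\operatorname*{ess\,sup}_{z}\,s^*(X';Y'|Z=z),$$ where $s^*(X';Y'|Z=z)$ is $s^*$ of the conditional law $P_{X'Y'|Z=z}$ and the essential supremum is with respect to $P_Z$. \item If $Z$ is almost surely constant, then $$s^*_Z(X;Y)=s^*(X;Y)=\sup_{U}\frac{I(U;Y)}{I(U;X)},$$ where the last supremum is over all $U$ such that $U-X-Y$ is a Markov chain. \end{enumerate} -/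

import Mathlib

open MeasureTheory ProbabilityTheory InformationTheory
open scoped ENNReal

universe u

noncomputable section

namespace KeyCapacity

/-- Supremum of a set of real numbers, in the extended reals, with the convention that the supremum
of the empty set is `0`. -/
def supOrZero (S : Set ℝ) : EReal :=
  open Classical in if S.Nonempty then ⨆ r ∈ S, (r : EReal) else 0

section Information

variable {Ω α β γ : Type*} [MeasurableSpace Ω] [MeasurableSpace α] [MeasurableSpace β]
  [MeasurableSpace γ]

/-- Mutual information `I(A;B) = D(P_{AB} ‖ P_A × P_B)` of two random variables under `μ`. -/
def mutualInfo (μ : Measure Ω) (A : Ω → α) (B : Ω → β) : ℝ≥0∞ :=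
  klDiv (μ.map fun ω => (A ω, B ω)) ((μ.map A).prod (μ.map B))

/-- Conditional mutual information `I(A;B|C) = D(P_{CAB} ‖ P_C P_{A|C} P_{B|C})` under `μ`. -/
def condMutualInfo [StandardBorelSpace α] [Nonempty α] [StandardBorelSpace β] [Nonempty β]
    (μ : Measure Ω) [IsFiniteMeasure μ] (A : Ω → α) (B : Ω → β) (C : Ω → γ) : ℝ≥0∞ :=
  klDiv (μ.map fun ω => (C ω, (A ω, B ω)))
    ((μ.map C) ⊗ₘ ((condDistrib A C μ) ×ₖ (condDistrib B C μ)))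

end Information

section TwoTerminals

variable {𝒳 𝒴 : Type u}
  [MeasurableSpace 𝒳] [StandardBorelSpace 𝒳] [Nonempty 𝒳]
  [MeasurableSpace 𝒴] [StandardBorelSpace 𝒴] [Nonempty 𝒴]

/-- The ratios `D(Q_Y ‖ P_Y) / D(Q_X ‖ P_X)` over `Q_X ≠ P_X` with finite divergences, where `Q_Y` is
the output of the channel `P_{Y|X}` for the input `Q_X`. -/
def sdpiRatios (P : Measure (𝒳 × 𝒴)) [IsFiniteMeasure P] : Set ℝ :=
  {r | ∃ (Q : Measure 𝒳) (_ : IsProbabilityMeasure Q),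
    Q ≠ P.fst ∧
    klDiv Q P.fst ≠ ∞ ∧
    klDiv (Q ⊗ₘ P.condKernel).snd P.snd ≠ ∞ ∧
    r = (klDiv (Q ⊗ₘ P.condKernel).snd P.snd).toReal / (klDiv Q P.fst).toReal}

/-- The strong data processing constant `s^*(X;Y)` of the law `P = P_{XY}`. -/
def sStar (P : Measure (𝒳 × 𝒴)) [IsFiniteMeasure P] : EReal :=
  supOrZero (sdpiRatios P)

/-- The ratios `I(U;Y) / I(U;X)` over Markov chains `U - X - Y` (i.e. over conditional laws
`κ = P_{U|X}`, with joint law `P_{XY} P_{U|X}`) with finite informations and `I(U;X) ≠ 0`. -/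
def sdpiInfoRatios (P : Measure (𝒳 × 𝒴)) [IsFiniteMeasure P] : Set ℝ :=
  {r | ∃ (𝒰 : Type u) (_ : MeasurableSpace 𝒰) (_ : StandardBorelSpace 𝒰) (_ : Nonempty 𝒰)
      (κ : Kernel 𝒳 𝒰) (_ : IsMarkovKernel κ),
    let μ : Measure ((𝒳 × 𝒴) × 𝒰) := P ⊗ₘ (κ.comap Prod.fst measurable_fst)
    let X : (𝒳 × 𝒴) × 𝒰 → 𝒳 := fun ω => ω.1.1
    let Y : (𝒳 × 𝒴) × 𝒰 → 𝒴 := fun ω => ω.1.2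
    let U : (𝒳 × 𝒴) × 𝒰 → 𝒰 := fun ω => ω.2
    mutualInfo μ U X ≠ ∞ ∧ mutualInfo μ U Y ≠ ∞ ∧
    mutualInfo μ U X ≠ 0 ∧
    r = (mutualInfo μ U Y).toReal / (mutualInfo μ U X).toReal}

end TwoTerminals

section ThreeTerminals

variable {𝒳 𝒴 𝒵 : Type u}
  [MeasurableSpace 𝒳] [StandardBorelSpace 𝒳] [Nonempty 𝒳]
  [MeasurableSpace 𝒴] [StandardBorelSpace 𝒴] [Nonempty 𝒴]
  [MeasurableSpace 𝒵] [StandardBorelSpace 𝒵] [Nonempty 𝒵]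

/-- The law of `(X, Y)` when `(X, Y, Z)` has law `P`. -/
def lawXY (P : Measure (𝒳 × 𝒴 × 𝒵)) : Measure (𝒳 × 𝒴) := P.map fun ω => (ω.1, ω.2.1)

/-- The law of `(X, Z)` when `(X, Y, Z)` has law `P`. -/
def lawXZ (P : Measure (𝒳 × 𝒴 × 𝒵)) : Measure (𝒳 × 𝒵) := P.map fun ω => (ω.1, ω.2.2)

/-- The law of `X` when `(X, Y, Z)` has law `P`. -/
def lawX (P : Measure (𝒳 × 𝒴 × 𝒵)) : Measure 𝒳 := P.map fun ω => ω.1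

/-- The law of `Y` when `(X, Y, Z)` has law `P`. -/
def lawY (P : Measure (𝒳 × 𝒴 × 𝒵)) : Measure 𝒴 := P.map fun ω => ω.2.1

/-- The law of `Z` when `(X, Y, Z)` has law `P`. -/
def lawZ (P : Measure (𝒳 × 𝒴 × 𝒵)) : Measure 𝒵 := P.map fun ω => ω.2.2

instance (P : Measure (𝒳 × 𝒴 × 𝒵)) [IsFiniteMeasure P] : IsFiniteMeasure (lawXY P) := by
  unfold lawXY; infer_instance

/-- The ratios whose supremum is `s^*_Z(X;Y)`. The pair `(U,V)` ranges over the Markov chains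
`(U,V) - X - (Y,Z)`, i.e. over the conditional laws `κ = P_{UV|X}`, the joint law being
`P_{XYZ} P_{UV|X}`; all informations that occur are finite and the denominator is nonzero. -/
def keyRatios (P : Measure (𝒳 × 𝒴 × 𝒵)) [IsFiniteMeasure P] : Set ℝ :=
  {r | ∃ (𝒰 𝒱 : Type u)
      (_ : MeasurableSpace 𝒰) (_ : StandardBorelSpace 𝒰) (_ : Nonempty 𝒰)
      (_ : MeasurableSpace 𝒱) (_ : StandardBorelSpace 𝒱) (_ : Nonempty 𝒱)
      (κ : Kernel 𝒳 (𝒰 × 𝒱)) (_ : IsMarkovKernel κ),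
    let Ω := (𝒳 × 𝒴 × 𝒵) × (𝒰 × 𝒱)
    let μ : Measure Ω := P ⊗ₘ (κ.comap Prod.fst measurable_fst)
    let X : Ω → 𝒳 := fun ω => ω.1.1
    let Y : Ω → 𝒴 := fun ω => ω.1.2.1
    let Z : Ω → 𝒵 := fun ω => ω.1.2.2
    let U : Ω → 𝒰 := fun ω => ω.2.1
    let V : Ω → 𝒱 := fun ω => ω.2.2
    let num : ℝ := (condMutualInfo μ V Y U).toReal - (condMutualInfo μ V Z U).toReal
    let den : ℝ := (condMutualInfo μ V X U).toReal - (condMutualInfo μ V Z U).toReal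
      + (mutualInfo μ U X).toReal - (mutualInfo μ U Y).toReal
    condMutualInfo μ V X U ≠ ∞ ∧ condMutualInfo μ V Y U ≠ ∞ ∧ condMutualInfo μ V Z U ≠ ∞ ∧
    mutualInfo μ U X ≠ ∞ ∧ mutualInfo μ U Y ≠ ∞ ∧
    den ≠ 0 ∧ r = num / den}

/-- The quantity `s^*_Z(X;Y)` of the law `P = P_{XYZ}`. -/
def sStarZ (P : Measure (𝒳 × 𝒴 × 𝒵)) [IsFiniteMeasure P] : EReal :=
  supOrZero (keyRatios P)

/-- The ratios `(I(V;Y) - I(V;Z)) / (I(V;X) - I(V;Z) + D(Q_X ‖ P_X) - D(Q_Y ‖ P_Y))`, where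
`(V,X,Y,Z)` has law `Q_{VX} P_{YZ|X}`, over all `Q_{VX}` for which all terms are finite and the
denominator is nonzero. -/
def variationalRatios (P : Measure (𝒳 × 𝒴 × 𝒵)) [IsFiniteMeasure P] : Set ℝ :=
  {r | ∃ (𝒱 : Type u) (_ : MeasurableSpace 𝒱) (_ : StandardBorelSpace 𝒱) (_ : Nonempty 𝒱)
      (Q : Measure (𝒱 × 𝒳)) (_ : IsProbabilityMeasure Q),
    let Ω := (𝒱 × 𝒳) × (𝒴 × 𝒵)
    let μ : Measure Ω := Q ⊗ₘ (P.condKernel.comap Prod.snd measurable_snd)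
    let V : Ω → 𝒱 := fun ω => ω.1.1
    let X : Ω → 𝒳 := fun ω => ω.1.2
    let Y : Ω → 𝒴 := fun ω => ω.2.1
    let Z : Ω → 𝒵 := fun ω => ω.2.2
    let DX : ℝ≥0∞ := klDiv (μ.map X) (lawX P)
    let DY : ℝ≥0∞ := klDiv (μ.map Y) (lawY P)
    let num : ℝ := (mutualInfo μ V Y).toReal - (mutualInfo μ V Z).toReal
    let den : ℝ := (mutualInfo μ V X).toReal - (mutualInfo μ V Z).toReal + DX.toReal - DY.toReal
    mutualInfo μ V X ≠ ∞ ∧ mutualInfo μ V Y ≠ ∞ ∧ mutualInfo μ V Z ≠ ∞ ∧ DX ≠ ∞ ∧ DY ≠ ∞ ∧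
    den ≠ 0 ∧ r = num / den}

/-- `P'` is a joint law with the same `(X,Y)` and `(X,Z)` marginals as `P`, under which `X - Y - Z`
is a Markov chain. -/
def IsDegradedVersion (P P' : Measure (𝒳 × 𝒴 × 𝒵)) [IsFiniteMeasure P'] : Prop :=
  lawXY P' = lawXY P ∧ lawXZ P' = lawXZ P ∧
  CondIndepFun
    (MeasurableSpace.comap (fun ω : 𝒳 × 𝒴 × 𝒵 => ω.2.1) inferInstance)
    (Measurable.comap_le (measurable_fst.comp measurable_snd))
    (fun ω : 𝒳 × 𝒴 × 𝒵 => ω.1) (fun ω : 𝒳 × 𝒴 × 𝒵 => ω.2.2) P'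

/-- The ratios `I(U;Y|Z) / I(U;X|Z)` over Markov chains `U - X - (Y,Z)` (i.e. over conditional laws
`κ = P_{U|X}`) with finite conditional informations and `I(U;X|Z) ≠ 0`. -/
def condInfoRatios (P : Measure (𝒳 × 𝒴 × 𝒵)) [IsFiniteMeasure P] : Set ℝ :=
  {r | ∃ (𝒰 : Type u) (_ : MeasurableSpace 𝒰) (_ : StandardBorelSpace 𝒰) (_ : Nonempty 𝒰)
      (κ : Kernel 𝒳 𝒰) (_ : IsMarkovKernel κ),
    let Ω := (𝒳 × 𝒴 × 𝒵) × 𝒰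
    let μ : Measure Ω := P ⊗ₘ (κ.comap Prod.fst measurable_fst)
    let X : Ω → 𝒳 := fun ω => ω.1.1
    let Y : Ω → 𝒴 := fun ω => ω.1.2.1
    let Z : Ω → 𝒵 := fun ω => ω.1.2.2
    let U : Ω → 𝒰 := fun ω => ω.2
    condMutualInfo μ U X Z ≠ ∞ ∧ condMutualInfo μ U Y Z ≠ ∞ ∧
    condMutualInfo μ U X Z ≠ 0 ∧
    r = (condMutualInfo μ U Y Z).toReal / (condMutualInfo μ U X Z).toReal}

/-- The ratios `(D(Q_Y ‖ P_Y) - D(Q_Z ‖ P_Z)) / (D(Q_X ‖ P_X) - D(Q_Z ‖ P_Z))`, where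
`Q_{XYZ} = Q_X P_{YZ|X}`, over all `Q_X` for which the divergences are finite and the denominator is
nonzero. -/
def divergenceRatios (P : Measure (𝒳 × 𝒴 × 𝒵)) [IsFiniteMeasure P] : Set ℝ :=
  {r | ∃ (Q : Measure 𝒳) (_ : IsProbabilityMeasure Q),
    let R : Measure (𝒳 × 𝒴 × 𝒵) := Q ⊗ₘ P.condKernel
    let DX : ℝ≥0∞ := klDiv Q (lawX P)
    let DY : ℝ≥0∞ := klDiv (lawY R) (lawY P)
    let DZ : ℝ≥0∞ := klDiv (lawZ R) (lawZ P)
    DX ≠ ∞ ∧ DY ≠ ∞ ∧ DZ ≠ ∞ ∧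
    DX.toReal - DZ.toReal ≠ 0 ∧
    r = (DY.toReal - DZ.toReal) / (DX.toReal - DZ.toReal)}

/-- The conditional law of `(X,Y)` given `Z = z`, when `(X, Y, Z)` has law `P`. -/
def condLawXY (P : Measure (𝒳 × 𝒴 × 𝒵)) [IsFiniteMeasure P] (z : 𝒵) : Measure (𝒳 × 𝒴) :=
  condDistrib (fun ω : 𝒳 × 𝒴 × 𝒵 => (ω.1, ω.2.1)) (fun ω => ω.2.2) P z

instance (P : Measure (𝒳 × 𝒴 × 𝒵)) [IsFiniteMeasure P] (z : 𝒵) :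
    IsProbabilityMeasure (condLawXY P z) := by
  unfold condLawXY; infer_instance

/-- The law of `((X,Z), (Y,Z), Z)`, when `(X, Y, Z)` has law `P`. -/
def withSideInfo (P : Measure (𝒳 × 𝒴 × 𝒵)) : Measure ((𝒳 × 𝒵) × (𝒴 × 𝒵) × 𝒵) :=
  P.map fun ω => ((ω.1, ω.2.2), (ω.2.1, ω.2.2), ω.2.2)

instance (P : Measure (𝒳 × 𝒴 × 𝒵)) [IsFiniteMeasure P] : IsFiniteMeasure (withSideInfo P) := by
  unfold withSideInfo; infer_instance

end ThreeTerminals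

section Product

variable {L : ℕ} {𝒳 𝒴 𝒵 : Fin L → Type u} [∀ i, MeasurableSpace (𝒳 i)]
  [∀ i, MeasurableSpace (𝒴 i)] [∀ i, MeasurableSpace (𝒵 i)]

/-- The law of `(X_i, Y_i, Z_i)`, when `(X^L, Y^L, Z^L)` has law `P`. -/
def component (P : Measure ((∀ i, 𝒳 i) × (∀ i, 𝒴 i) × (∀ i, 𝒵 i))) (i : Fin L) :
    Measure (𝒳 i × 𝒴 i × 𝒵 i) :=
  P.map fun ω => (ω.1 i, ω.2.1 i, ω.2.2 i)

instance (P : Measure ((∀ i, 𝒳 i) × (∀ i, 𝒴 i) × (∀ i, 𝒵 i))) [IsFiniteMeasure P] (i : Fin L) :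
    IsFiniteMeasure (component P i) := by
  unfold component; infer_instance

/-- Product sources: `P_{X^L Y^L} = ∏ P_{X_i Y_i}` and `P_{X^L Z^L} = ∏ P_{X_i Z_i}`. -/
def IsProductSource (P : Measure ((∀ i, 𝒳 i) × (∀ i, 𝒴 i) × (∀ i, 𝒵 i))) : Prop :=
  P.map (fun ω (i : Fin L) => (ω.1 i, ω.2.1 i)) = Measure.pi (fun i => lawXY (component P i)) ∧
  P.map (fun ω (i : Fin L) => (ω.1 i, ω.2.2 i)) = Measure.pi (fun i => lawXZ (component P i))

end Product

end KeyCapacity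

end

open KeyCapacity

set_option linter.unusedSectionVars false

namespace KeyCapacity

/-! ### Divergence under injective maps and fiberwise. -/

section Divergence

variable {α β γ : Type*} {mα : MeasurableSpace α} {mβ : MeasurableSpace β} {mγ : MeasurableSpace γ}

/-! Fix π = P_X, K = P_{Y|X} and L = P_{Z|X}. For a law M of (W, X), `relInfo M π` equals I(W;X) +
D(M_X ‖ π); `info` is this quantity at the output of a channel, and `excess π K L` is the difference
of the `info` of K and of L. Write E for `excess π K L` and F for `excess π Kernel.id L`. By the
chain rule the numerator of the ratio is E(UV) - E(U) and the denominator is F(UV) - E(U). Data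
processing gives numerator ≤ denominator, and `relInfo_through_add_le` gives denominator ≥ 0. So for
t ≥ 0 the bound s^*_Z ≤ t is the linear inequality numerator ≤ t * denominator, and by
`eq_of_forall_real_le_iff` every identity between suprema becomes an equivalence of such
inequalities.

The core is the equivalence of `SourceKeyBound` (X has law π), `VariationalBound` (U constant, any
input law) and `KeyBound` (no restriction). From variational to key one averages over the values of
U (`VariationalBound.keyBound`). From source to variational one perturbs: a law M whose X-marginal
has bounded density is made the conditional law given an event of probability ε of a source with
X-law π, the complementary input law ξ satisfying D(ξ ‖ π) = O(ε²). The terms in ξ cancel in the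
numerator and are of second order in the denominator, so dividing by ε and letting ε → 0 gives the
variational inequality. General laws are reached by truncating densities (`exists_source_mixture`,
`exists_truncation`, `SourceKeyBound.variationalBound`). This gives the variational formula.

Tensorization rests on Csiszár's sum identity `excess_parallel`: numerators of a product source add
up exactly, denominators are superadditive (`le_excess_id_parallel`), and the converse adjoins an
independent second source. Induction on the number of factors uses that `KeyBound` depends only on
the laws of (X, Y) and (X, Z), up to relabelling (`KeyBound.transport`).

If Y preserves divergences at least as well as Z, as in the degraded case, then E ≥ 0, and U can be
dropped for t ≤ 1: E(UV) ≤ t * F(UV) already implies the key inequality. Disintegration and the same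
perturbation identify this with the inequality between output divergences. For a Markov chain X - Y
- Z, E is I(U;Y|Z) and F is I(U;X|Z) when I(U;X) is finite; quantizing U removes that restriction.
For constant Z all terms in Z vanish. With side information the divergence of Z cancels and leaves
averages over z of fiber divergences; a countable family of test inputs turns the averaged
inequality into one for almost every z (`divergenceBound_side_iff`). -/

lemma klDiv_map_of_leftInverse (μ ν : Measure α) [IsFiniteMeasure μ] [IsFiniteMeasure ν]
    {g : α → β} {h : β → α} (hg : Measurable g) (hh : Measurable h)
    (hgh : Function.LeftInverse h g) : klDiv (μ.map g) (ν.map g) = klDiv μ ν := by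
  refine le_antisymm (klDiv_map_le μ ν hg) ?_
  have key := klDiv_map_le (μ.map g) (ν.map g) hh
  rwa [Measure.map_map hh hg, Measure.map_map hh hg, hgh.comp_eq_id, Measure.map_id,
    Measure.map_id] at key

section Fiber

variable [MeasurableSpace.CountableOrCountablyGenerated α β]

/-- The jointly measurable kernel derivative, used as a density on the product, reproduces the first
measure; uniqueness of densities then identifies it. -/
lemma rnDeriv_compProd_same (μ : Measure α) [IsFiniteMeasure μ] (κ η : Kernel α β)
    [IsFiniteKernel κ] [IsFiniteKernel η] (h : ∀ᵐ a ∂μ, κ a ≪ η a) :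
    (μ ⊗ₘ κ).rnDeriv (μ ⊗ₘ η) =ᵐ[μ ⊗ₘ η] fun p => Kernel.rnDeriv κ η p.1 p.2 := by
  have hm : Measurable (fun p : α × β => Kernel.rnDeriv κ η p.1 p.2) := Kernel.measurable_rnDeriv κ η
  have h1 : μ ⊗ₘ κ = (μ ⊗ₘ η).withDensity (fun p => Kernel.rnDeriv κ η p.1 p.2) := by
    have h2 : κ =ᵐ[μ] η.withDensity (Kernel.rnDeriv κ η) := by
      filter_upwards [h] with a ha
      exact (Kernel.withDensity_rnDeriv_eq ha).symm
    rw [Measure.compProd_congr h2]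
    exact Measure.compProd_withDensity hm
  rw [h1]
  exact Measure.rnDeriv_withDensity _ hm

/-- The set where absolute continuity holds is measurable, and on it the divergence is an integral
of a jointly measurable function. -/
lemma measurable_klDiv_kernel (κ η : Kernel α β) [IsFiniteKernel κ] [IsFiniteKernel η] :
    Measurable fun a => klDiv (κ a) (η a) := by
  classical
  have h : (fun a => klDiv (κ a) (η a)) = fun a => if κ a ≪ η a then
      ∫⁻ b, ENNReal.ofReal (klFun (Kernel.rnDeriv κ η a b).toReal) ∂η a else ∞ := by
    funext a
    rw [klDiv_eq_lintegral_klFun]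
    split_ifs
    · refine lintegral_congr_ae ?_
      filter_upwards [Kernel.rnDeriv_eq_rnDeriv_measure (κ := κ) (η := η) (a := a)] with b hb
      rw [hb]
    · rfl
  rw [h]
  refine Measurable.ite (Kernel.measurableSet_absolutelyContinuous κ η) ?_ measurable_const
  refine Measurable.lintegral_kernel_prod_right
    (f := fun a b => ENNReal.ofReal (klFun (Kernel.rnDeriv κ η a b).toReal)) ?_
  have hm : Measurable (fun p : α × β => Kernel.rnDeriv κ η p.1 p.2) := Kernel.measurable_rnDeriv κ η
  exact (measurable_klFun.comp hm.ennreal_toReal).ennreal_ofReal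

/-- The divergence of two composition products with the same first marginal is the average of the
divergences of the fibers. -/
lemma klDiv_compProd_eq_lintegral (μ : Measure α) [IsFiniteMeasure μ] (κ η : Kernel α β)
    [IsFiniteKernel κ] [IsFiniteKernel η] :
    klDiv (μ ⊗ₘ κ) (μ ⊗ₘ η) = ∫⁻ a, klDiv (κ a) (η a) ∂μ := by
  by_cases h : ∀ᵐ a ∂μ, κ a ≪ η a
  · have hm : Measurable (fun p : α × β => Kernel.rnDeriv κ η p.1 p.2) :=
      Kernel.measurable_rnDeriv κ η
    rw [klDiv_eq_lintegral_klFun_of_ac (Measure.absolutelyContinuous_compProd_right_iff.mpr h)]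
    have h1 : ∫⁻ p, ENNReal.ofReal (klFun ((μ ⊗ₘ κ).rnDeriv (μ ⊗ₘ η) p).toReal) ∂(μ ⊗ₘ η)
        = ∫⁻ p, ENNReal.ofReal (klFun (Kernel.rnDeriv κ η p.1 p.2).toReal) ∂(μ ⊗ₘ η) := by
      refine lintegral_congr_ae ?_
      filter_upwards [rnDeriv_compProd_same μ κ η h] with p hp
      rw [hp]
    rw [h1, Measure.lintegral_compProd (by fun_prop)]
    refine lintegral_congr_ae ?_
    filter_upwards [h] with a ha
    rw [klDiv_eq_lintegral_klFun_of_ac ha]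
    refine lintegral_congr_ae ?_
    filter_upwards [Kernel.rnDeriv_eq_rnDeriv_measure (κ := κ) (η := η) (a := a)] with b hb
    rw [hb]
  · rw [klDiv_of_not_ac (fun h' => h (Measure.absolutelyContinuous_compProd_right_iff.mp h'))]
    -- A finite average would make almost every fiber divergence finite, hence almost every fiber
    -- absolutely continuous.
    symm
    by_contra hne
    refine h ?_
    filter_upwards [ae_lt_top (measurable_klDiv_kernel κ η) hne] with a ha
    by_contra hac
    simp [klDiv_of_not_ac hac] at ha

end Fiber

end Divergence

open Filter Topology

/-! ### Continuity and lower semicontinuity of the divergence. -/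

section Limits

variable {α β : Type*} {mα : MeasurableSpace α} {mβ : MeasurableSpace β}

/-- Monotonicity of s log s for s ≥ 1 reduces this to (x + 1) log (x + 1) ≤ x log x + 1 + x. It
supplies a dominating function that is integrable when the density x is integrable and has finite
divergence. -/
lemma klFun_le_of_le_mul {C x y : ℝ} (hC : 1 ≤ C) (hx : 0 ≤ x) (hy : 0 ≤ y)
    (hyx : y ≤ C * (x + 1)) :
    klFun y ≤ C * klFun x + (C * Real.log C * (x + 1) + 2 * C * x + 1) := by
  have hC0 : 0 < C := by linarith
  have hx1 : 0 < x + 1 := by linarith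
  have h1 : 1 ≤ C * (x + 1) := by nlinarith
  have hylog : y * Real.log y ≤ C * (x + 1) * Real.log (C * (x + 1)) := by
    rcases le_total y 1 with h | h
    · exact (Real.mul_log_nonpos hy h).trans
        (mul_nonneg (by positivity) (Real.log_nonneg h1))
    · exact mul_le_mul hyx (Real.log_le_log (by linarith) hyx) (Real.log_nonneg h) (by positivity)
  have hxlog : (x + 1) * Real.log (x + 1) ≤ x * Real.log x + 1 + x := by
    have h2 : Real.log (x + 1) ≤ x := by
      have := Real.log_le_sub_one_of_pos hx1
      linarith
    rcases hx.eq_or_lt with rfl | hx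
    · simp
    have h3 : x * Real.log (x + 1) ≤ x * Real.log x + 1 := by
      have h4 : Real.log ((x + 1) / x) ≤ (x + 1) / x - 1 :=
        Real.log_le_sub_one_of_pos (by positivity)
      rw [Real.log_div hx1.ne' hx.ne'] at h4
      have h5 : x * ((x + 1) / x - 1) = 1 := by field_simp; ring
      nlinarith
    linarith
  rw [Real.log_mul hC0.ne' hx1.ne'] at hylog
  simp only [klFun_apply]
  nlinarith

lemma klDiv_withDensity (ρ : Measure α) [IsFiniteMeasure ρ] {g : α → ℝ≥0∞} (hg : Measurable g)
    (hgi : ∫⁻ a, g a ∂ρ ≠ ∞) :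
    klDiv (ρ.withDensity g) ρ = ∫⁻ a, ENNReal.ofReal (klFun (g a).toReal) ∂ρ := by
  have := isFiniteMeasure_withDensity hgi
  rw [klDiv_eq_lintegral_klFun_of_ac (withDensity_absolutelyContinuous ρ g)]
  refine lintegral_congr_ae ?_
  filter_upwards [Measure.rnDeriv_withDensity ρ hg] with a ha
  rw [ha]

/-- Dominated convergence with the majorant of `klFun_le_of_le_mul`, which is integrable because g
is integrable and its divergence is finite. -/
lemma tendsto_klDiv_withDensity (ρ : Measure α) [IsFiniteMeasure ρ] {g : α → ℝ≥0∞}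
    {f : ℕ → α → ℝ≥0∞} (hg : Measurable g) (hf : ∀ n, Measurable (f n))
    (hgi : ∫⁻ a, g a ∂ρ ≠ ∞) {C : ℝ} (hC : 1 ≤ C)
    (hle : ∀ n, ∀ᵐ a ∂ρ, f n a ≤ ENNReal.ofReal C * (g a + 1))
    (hlim : ∀ᵐ a ∂ρ, Tendsto (fun n => f n a) atTop (𝓝 (g a)))
    (hfin : klDiv (ρ.withDensity g) ρ ≠ ∞) :
    Tendsto (fun n => klDiv (ρ.withDensity (f n)) ρ) atTop (𝓝 (klDiv (ρ.withDensity g) ρ)) := by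
  have hgtop : ∀ᵐ a ∂ρ, g a < ∞ := ae_lt_top hg hgi
  have hC0 : 0 ≤ C := by linarith
  have hfi : ∀ n, ∫⁻ a, f n a ∂ρ ≠ ∞ := by
    intro n
    refine ((lintegral_mono_ae (hle n)).trans_lt ?_).ne
    rw [lintegral_const_mul _ (by fun_prop), lintegral_add_right _ measurable_const]
    refine ENNReal.mul_lt_top ENNReal.ofReal_lt_top (ENNReal.add_lt_top.mpr ⟨hgi.lt_top, ?_⟩)
    simp
  simp_rw [fun n => klDiv_withDensity ρ (hf n) (hfi n)]
  rw [klDiv_withDensity ρ hg hgi] at hfin ⊢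
  refine tendsto_lintegral_of_dominated_convergence
    (bound := fun a => ENNReal.ofReal C * ENNReal.ofReal (klFun (g a).toReal)
      + (ENNReal.ofReal (C * Real.log C) * (g a + 1) + ENNReal.ofReal (2 * C) * g a + 1))
    (fun n => by fun_prop) ?_ ?_ ?_
  · intro n
    filter_upwards [hle n, hgtop] with a ha hga
    have hle' : (f n a).toReal ≤ C * ((g a).toReal + 1) := by
      have h := ENNReal.toReal_mono (ENNReal.mul_ne_top ENNReal.ofReal_ne_top (by simp [hga.ne])) ha
      rwa [ENNReal.toReal_mul, ENNReal.toReal_ofReal hC0, ENNReal.toReal_add hga.ne (by simp),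
        ENNReal.toReal_one] at h
    have hlog : 0 ≤ Real.log C := Real.log_nonneg hC
    have hkl : 0 ≤ klFun (g a).toReal := klFun_nonneg ENNReal.toReal_nonneg
    calc ENNReal.ofReal (klFun (f n a).toReal)
        ≤ ENNReal.ofReal (C * klFun (g a).toReal
          + (C * Real.log C * ((g a).toReal + 1) + 2 * C * (g a).toReal + 1)) :=
          ENNReal.ofReal_le_ofReal
            (klFun_le_of_le_mul hC ENNReal.toReal_nonneg ENNReal.toReal_nonneg hle')
      _ = _ := by
          have h0 : 0 ≤ (g a).toReal := ENNReal.toReal_nonneg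
          rw [ENNReal.ofReal_add (by positivity) (by positivity), ENNReal.ofReal_mul hC0,
            ENNReal.ofReal_add (by positivity) (by positivity),
            ENNReal.ofReal_add (by positivity) (by positivity),
            ENNReal.ofReal_mul (p := C * Real.log C) (by positivity),
            ENNReal.ofReal_mul (p := 2 * C) (by positivity),
            ENNReal.ofReal_add h0 zero_le_one, ENNReal.ofReal_one, ENNReal.ofReal_toReal hga.ne]
  · rw [lintegral_add_left (by fun_prop), lintegral_const_mul _ (by fun_prop),
      lintegral_add_right _ (by fun_prop), lintegral_add_left (by fun_prop),
      lintegral_const_mul _ (by fun_prop), lintegral_const_mul _ (by fun_prop),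
      lintegral_add_right _ (by fun_prop)]
    simp [ENNReal.add_eq_top, ENNReal.mul_eq_top, hfin, hgi]
  · filter_upwards [hlim, hgtop] with a ha hga
    refine ENNReal.tendsto_ofReal ((continuous_klFun.tendsto _).comp ?_)
    exact (ENNReal.tendsto_toReal hga.ne).comp ha

/-- Bayes' rule: the density of the output at b is the posterior mean of the density of the input.
Both sides are integrals over one joint law, disintegrated in its two directions. -/
lemma comp_withDensity_eq_withDensity_posterior [StandardBorelSpace α] [Nonempty α]
    (π : Measure α) [IsFiniteMeasure π] (κ : Kernel α β) [IsMarkovKernel κ] {f : α → ℝ≥0∞}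
    (hf : Measurable f) :
    κ ∘ₘ (π.withDensity f) = (κ ∘ₘ π).withDensity fun b => ∫⁻ a, f a ∂(κ†π) b := by
  refine Measure.ext fun s hs => ?_
  have hint : Measurable fun b => ∫⁻ a, f a ∂(κ†π) b := hf.lintegral_kernel
  rw [withDensity_apply _ hs, ← lintegral_indicator hs, Measure.bind_apply hs (by fun_prop),
    lintegral_withDensity_eq_lintegral_mul _ hf (κ.measurable_coe hs)]
  have hF : Measurable fun p : β × α => s.indicator (fun _ => f p.2) p.1 := by
    have : (fun p : β × α => s.indicator (fun _ => f p.2) p.1)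
        = (Prod.fst ⁻¹' s).indicator fun p => f p.2 := by
      ext p; simp only [Set.indicator, Set.mem_preimage]; congr
    rw [this]
    exact (hf.comp measurable_snd).indicator (measurable_fst hs)
  have h1 := congrArg (fun m => ∫⁻ p, s.indicator (fun _ => f p.2) p.1 ∂m)
    (compProd_posterior_eq_map_swap (κ := κ) (μ := π))
  rw [Measure.lintegral_compProd hF, lintegral_map hF measurable_swap,
    Measure.lintegral_compProd (f := fun p : α × β => s.indicator (fun _ => f p.swap.2) p.swap.1)
      (hF.comp measurable_swap)] at h1
  have h2 : ∀ b, ∫⁻ a, s.indicator (fun _ => f a) b ∂(κ†π) b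
      = s.indicator (fun b => ∫⁻ a, f a ∂(κ†π) b) b := by
    intro b
    by_cases hb : b ∈ s <;> simp [hb]
  simp only [h2] at h1
  rw [h1]
  refine lintegral_congr fun a => ?_
  have h3 : (fun b => s.indicator (fun _ => f a) b) = s.indicator fun _ => f a := rfl
  simp only [Prod.swap_prod_mk, Pi.mul_apply]
  rw [lintegral_indicator hs, lintegral_const, Measure.restrict_apply_univ]

/-- Continuity of the divergence of channel outputs along dominated a.e. convergent densities of the
channel inputs. -/
lemma tendsto_klDiv_comp_withDensity [StandardBorelSpace α] [Nonempty α]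
    (π : Measure α) [IsFiniteMeasure π] (κ : Kernel α β) [IsMarkovKernel κ] {g : α → ℝ≥0∞}
    {f : ℕ → α → ℝ≥0∞} (hg : Measurable g) (hf : ∀ n, Measurable (f n))
    (hgi : ∫⁻ a, g a ∂π ≠ ∞) {C : ℝ} (hC : 1 ≤ C)
    (hle : ∀ n, ∀ᵐ a ∂π, f n a ≤ ENNReal.ofReal C * (g a + 1))
    (hlim : ∀ᵐ a ∂π, Tendsto (fun n => f n a) atTop (𝓝 (g a)))
    (hfin : klDiv (π.withDensity g) π ≠ ∞) :
    Tendsto (fun n => klDiv (κ ∘ₘ (π.withDensity (f n))) (κ ∘ₘ π)) atTop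
      (𝓝 (klDiv (κ ∘ₘ (π.withDensity g)) (κ ∘ₘ π))) := by
  have := isFiniteMeasure_withDensity hgi
  have hfin' := ((klDiv_comp_right_le (π.withDensity g) π κ).trans_lt hfin.lt_top).ne
  have hpost : (κ†π) ∘ₘ (κ ∘ₘ π) = π := posterior_comp_self
  have hG : ∫⁻ b, ∫⁻ a, g a ∂(κ†π) b ∂(κ ∘ₘ π) ≠ ∞ := by
    rw [← Measure.lintegral_bind (by fun_prop) hg.aemeasurable, hpost]
    exact hgi
  have hGtop := ae_lt_top (hg.lintegral_kernel (κ := κ†π)) hG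
  simp_rw [fun n => comp_withDensity_eq_withDensity_posterior π κ (hf n)]
  rw [comp_withDensity_eq_withDensity_posterior π κ hg] at hfin' ⊢
  -- The posterior averages back to π, so null sets of π are posterior-null for almost every output;
  -- domination and convergence therefore survive the posterior mean.
  have tr : ∀ {p : α → Prop}, (∀ᵐ a ∂π, p a) → ∀ᵐ b ∂(κ ∘ₘ π), ∀ᵐ a ∂(κ†π) b, p a := by
    intro p hp
    refine Measure.ae_ae_of_ae_comp ?_
    rwa [hpost]
  have hbd : ∀ b, ∫⁻ a, ENNReal.ofReal C * (g a + 1) ∂(κ†π) b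
      = ENNReal.ofReal C * (∫⁻ a, g a ∂(κ†π) b + 1) := by
    intro b
    rw [lintegral_const_mul _ (by fun_prop), lintegral_add_right _ measurable_const]
    simp
  refine tendsto_klDiv_withDensity _ hg.lintegral_kernel (fun n => (hf n).lintegral_kernel) hG hC
    ?_ ?_ hfin'
  · intro n
    filter_upwards [tr (hle n)] with b hb
    rw [← hbd]
    exact lintegral_mono_ae hb
  · filter_upwards [tr hlim, tr (ae_all_iff.mpr hle), hGtop] with b hb1 hb2 hb3
    refine tendsto_lintegral_of_dominated_convergence (fun a => ENNReal.ofReal C * (g a + 1))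
      hf (fun n => hb2.mono fun a ha => ha n) ?_ hb1
    rw [hbd]
    exact ENNReal.mul_ne_top ENNReal.ofReal_ne_top (by simp [hb3.ne])

/-- The divergence is the limit of the divergences of the images under maps that generate the
`σ`-algebra. -/
lemma klDiv_le_of_forall_map_le {ν ρ : Measure α} [IsFiniteMeasure ν] [IsFiniteMeasure ρ]
    (hνρ : ν ≪ ρ) {β : ℕ → Type*} [mβ : ∀ n, MeasurableSpace (β n)] {g : ∀ n, α → β n}
    (hg : ∀ n, Measurable (g n)) (hmono : Monotone fun n => (mβ n).comap (g n))
    (hgen : ⨆ n, (mβ n).comap (g n) = mα) {c : ℝ≥0∞}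
    (hc : ∀ n, klDiv (ν.map (g n)) (ρ.map (g n)) ≤ c) : klDiv ν ρ ≤ c := by
  -- The density of the n-th images, pulled back, is the conditional expectation of the original
  -- density. The martingale converges almost everywhere because the maps generate, and Fatou's
  -- lemma gives the inequality.
  let ℱ : Filtration ℕ mα := ⟨fun n => (mβ n).comap (g n), hmono, fun n => (hg n).comap_le⟩
  have hint : Integrable (fun a => (ν.rnDeriv ρ a).toReal) ρ := Measure.integrable_toReal_rnDeriv
  have hsm : StronglyMeasurable[⨆ n, ℱ n] fun a => (ν.rnDeriv ρ a).toReal := by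
    have : ⨆ n, ℱ n = mα := hgen
    rw [this]
    exact (Measure.measurable_rnDeriv ν ρ).ennreal_toReal.stronglyMeasurable
  have hconv := hint.tendsto_ae_condExp hsm
  rw [klDiv_eq_lintegral_klFun_of_ac hνρ]
  have hn : ∀ n, klDiv (ν.map (g n)) (ρ.map (g n))
      = ∫⁻ a, ENNReal.ofReal (klFun ((ρ[fun a => (ν.rnDeriv ρ a).toReal | ℱ n]) a)) ∂ρ := by
    intro n
    rw [klDiv_eq_lintegral_klFun_of_ac (hνρ.map (hg n)), lintegral_map (by fun_prop) (hg n)]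
    refine lintegral_congr_ae ?_
    filter_upwards [toReal_rnDeriv_map hνρ (hg n)] with a ha
    rw [ha]
  calc ∫⁻ a, ENNReal.ofReal (klFun (ν.rnDeriv ρ a).toReal) ∂ρ
      = ∫⁻ a, liminf (fun n => ENNReal.ofReal
          (klFun ((ρ[fun a => (ν.rnDeriv ρ a).toReal | ℱ n]) a))) atTop ∂ρ := by
        refine lintegral_congr_ae ?_
        filter_upwards [hconv] with a ha
        refine (Tendsto.liminf_eq ?_).symm
        exact ENNReal.tendsto_ofReal ((continuous_klFun.tendsto _).comp ha)
    _ ≤ liminf (fun n => ∫⁻ a, ENNReal.ofReal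
          (klFun ((ρ[fun a => (ν.rnDeriv ρ a).toReal | ℱ n]) a)) ∂ρ) atTop := by
        refine lintegral_liminf_le fun n => ?_
        exact (measurable_klFun.comp (stronglyMeasurable_condExp.measurable.mono
          (ℱ.le n) le_rfl)).ennreal_ofReal
    _ ≤ c := by
        refine liminf_le_of_le (by isBoundedDefault) fun b hb => ?_
        obtain ⟨n, hn'⟩ := hb.exists
        exact hn'.trans ((hn n).symm.trans_le (hc n))

end Limits

/-! ### Passing a joint law through a channel, and divergence from independence. -/

section Through

variable {𝒲 𝒲' 𝒳 𝒴 𝒵 : Type*} [MeasurableSpace 𝒲] [MeasurableSpace 𝒲'] [MeasurableSpace 𝒳]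
  [MeasurableSpace 𝒴] [MeasurableSpace 𝒵]

@[fun_prop]
lemma measurable_lintegral_kernel_comp (K : Kernel 𝒳 𝒴) [IsSFiniteKernel K] {g : 𝒲 → 𝒳}
    {f : 𝒲 → 𝒴 → ℝ≥0∞} (hf : Measurable (Function.uncurry f)) (hg : Measurable g) :
    Measurable fun a => ∫⁻ y, f a y ∂K (g a) :=
  Measurable.lintegral_kernel_prod_right (κ := K.comap g hg) hf

/-- The law of `(W, Y)` when `(W, X)` has law `M` and `Y` is the output of the channel `K` for the
input `X`. -/
noncomputable def through (K : Kernel 𝒳 𝒴) (M : Measure (𝒲 × 𝒳)) : Measure (𝒲 × 𝒴) :=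
  (Kernel.id ∥ₖ K) ∘ₘ M

instance (K : Kernel 𝒳 𝒴) [IsMarkovKernel K] (M : Measure (𝒲 × 𝒳)) [IsProbabilityMeasure M] :
    IsProbabilityMeasure (through K M) := by
  unfold through; infer_instance

lemma lintegral_through (K : Kernel 𝒳 𝒴) [IsSFiniteKernel K] (M : Measure (𝒲 × 𝒳))
    {f : 𝒲 × 𝒴 → ℝ≥0∞} (hf : Measurable f) :
    ∫⁻ p, f p ∂(through K M) = ∫⁻ p, ∫⁻ y, f (p.1, y) ∂K p.2 ∂M := by
  rw [through, Measure.lintegral_bind (by fun_prop) hf.aemeasurable]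
  refine lintegral_congr fun p => ?_
  rw [Kernel.lintegral_parallelComp, Kernel.id_apply, lintegral_dirac']
  · fun_prop
  · exact hf

/-- Channels such as P_{Y|X} are determined only up to P_X-null sets; this makes the choice of
version harmless. -/
lemma through_congr {K K' : Kernel 𝒳 𝒴} [IsSFiniteKernel K] [IsSFiniteKernel K']
    {π : Measure 𝒳} (h : K =ᵐ[π] K') {M : Measure (𝒲 × 𝒳)} (hM : M.snd ≪ π) :
    through K M = through K' M := by
  refine Measure.ext_of_lintegral _ fun f hf => ?_
  rw [lintegral_through K M hf, lintegral_through K' M hf]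
  refine lintegral_congr_ae ?_
  filter_upwards [ae_of_ae_map (by fun_prop) (hM.ae_le h)] with p hp
  rw [hp]

@[simp]
lemma fst_through (K : Kernel 𝒳 𝒴) [IsMarkovKernel K] (M : Measure (𝒲 × 𝒳)) :
    (through K M).fst = M.fst := by
  refine Measure.ext_of_lintegral _ fun f hf => ?_
  rw [Measure.fst, lintegral_map hf measurable_fst, lintegral_through K M (by fun_prop),
    Measure.fst, lintegral_map hf measurable_fst]
  simp

@[simp]
lemma snd_through (K : Kernel 𝒳 𝒴) [IsSFiniteKernel K] (M : Measure (𝒲 × 𝒳)) :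
    (through K M).snd = K ∘ₘ M.snd := by
  refine Measure.ext_of_lintegral _ fun f hf => ?_
  rw [Measure.snd, lintegral_map hf measurable_snd, lintegral_through K M (by fun_prop),
    Measure.lintegral_bind (by fun_prop) hf.aemeasurable, Measure.snd,
    lintegral_map (by fun_prop) measurable_snd]

@[simp]
lemma through_id (M : Measure (𝒲 × 𝒳)) : through Kernel.id M = M := by
  rw [through, Kernel.id_parallelComp_id, Measure.id_comp]

lemma through_map_left (K : Kernel 𝒳 𝒴) [IsSFiniteKernel K] (M : Measure (𝒲 × 𝒳)) {f : 𝒲 → 𝒲'}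
    (hf : Measurable f) :
    through K (M.map (Prod.map f id)) = (through K M).map (Prod.map f id) := by
  refine Measure.ext_of_lintegral _ fun g hg => ?_
  rw [lintegral_through _ _ hg, lintegral_map (by fun_prop) (by fun_prop),
    lintegral_map hg (by fun_prop), lintegral_through _ _ (by fun_prop)]
  rfl

lemma through_prod (K : Kernel 𝒳 𝒴) [IsSFiniteKernel K] (ν : Measure 𝒲) [SFinite ν]
    (π : Measure 𝒳) [SFinite π] : through K (ν.prod π) = ν.prod (K ∘ₘ π) :=
  (Measure.prod_comp_right).symm

lemma through_compProd (K : Kernel 𝒳 𝒴) [IsSFiniteKernel K] (ν : Measure 𝒲) [SFinite ν]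
    (ζ : Kernel 𝒲 𝒳) [IsSFiniteKernel ζ] : through K (ν ⊗ₘ ζ) = ν ⊗ₘ (K ∘ₖ ζ) :=
  Measure.parallelComp_comp_compProd

lemma lintegral_comp_left (T : Kernel 𝒲 𝒲') [IsMarkovKernel T] (M : Measure (𝒲 × 𝒳))
    {f : 𝒲' × 𝒳 → ℝ≥0∞} (hf : Measurable f) :
    ∫⁻ p, f p ∂((T ∥ₖ (Kernel.id : Kernel 𝒳 𝒳)) ∘ₘ M) = ∫⁻ p, ∫⁻ w, f (w, p.2) ∂T p.1 ∂M := by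
  rw [Measure.lintegral_bind (by fun_prop) hf.aemeasurable]
  refine lintegral_congr fun p => ?_
  rw [Kernel.lintegral_parallelComp_symm _ hf, Kernel.id_apply, lintegral_dirac']
  fun_prop

lemma fst_comp_left (M : Measure (𝒲 × 𝒳)) (T : Kernel 𝒲 𝒲') [IsMarkovKernel T] :
    ((T ∥ₖ (Kernel.id : Kernel 𝒳 𝒳)) ∘ₘ M).fst = T ∘ₘ M.fst := by
  refine Measure.ext_of_lintegral _ fun f hf => ?_
  rw [Measure.fst, lintegral_map hf measurable_fst, lintegral_comp_left _ _ (by fun_prop),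
    Measure.lintegral_bind (by fun_prop) hf.aemeasurable, Measure.fst,
    lintegral_map (by fun_prop) measurable_fst]

/-- The divergence of the law `M` of `(W, X)` from the law under which `X` is independent of `W` and
has law `π`. -/
noncomputable def relInfo (M : Measure (𝒲 × 𝒳)) (π : Measure 𝒳) : ℝ≥0∞ :=
  klDiv M (M.fst.prod π)

variable (M : Measure (𝒲 × 𝒳)) [IsProbabilityMeasure M] (π : Measure 𝒳) [IsProbabilityMeasure π]

/-- The channel keeps the W-marginal and sends the product reference law to the product reference
law of the output, so this is data processing. -/
lemma relInfo_through_le (K : Kernel 𝒳 𝒴) [IsMarkovKernel K] :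
    relInfo (through K M) (K ∘ₘ π) ≤ relInfo M π := by
  rw [relInfo, fst_through, ← through_prod]
  exact klDiv_comp_right_le _ _ _

lemma klDiv_snd_le_relInfo : klDiv M.snd π ≤ relInfo M π := by
  have h := klDiv_map_le M (M.fst.prod π) measurable_snd
  rwa [← Measure.snd, ← Measure.snd, Measure.snd_prod] at h

variable {M π} in
lemma snd_absolutelyContinuous_of_relInfo_ne_top (h : relInfo M π ≠ ∞) : M.snd ≪ π :=
  (klDiv_ne_top_iff.mp ((klDiv_snd_le_relInfo M π).trans_lt h.lt_top).ne).1

lemma map_left_fst_prod {f : 𝒲 → 𝒲'} (hf : Measurable f) :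
    (M.fst.prod π).map (Prod.map f id) = (M.map (Prod.map f id)).fst.prod π := by
  rw [← Measure.map_prod_map _ _ hf measurable_id, Measure.map_id, Measure.fst, Measure.fst,
    Measure.map_map (by fun_prop) (by fun_prop), Measure.map_map (by fun_prop) (by fun_prop)]
  rfl

lemma relInfo_map_left_le {f : 𝒲 → 𝒲'} (hf : Measurable f) :
    relInfo (M.map (Prod.map f id)) π ≤ relInfo M π := by
  rw [relInfo, ← map_left_fst_prod M π hf]
  exact klDiv_map_le _ _ (by fun_prop)

lemma relInfo_map_left_of_leftInverse {f : 𝒲 → 𝒲'} (hf : Measurable f) {g : 𝒲' → 𝒲}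
    (hg : Measurable g) (hgf : Function.LeftInverse g f) :
    relInfo (M.map (Prod.map f id)) π = relInfo M π := by
  rw [relInfo, ← map_left_fst_prod M π hf, relInfo]
  exact klDiv_map_of_leftInverse _ _ (h := Prod.map g id) (by fun_prop) (by fun_prop)
    fun p => Prod.ext (hgf p.1) rfl

lemma relInfo_map_right_of_leftInverse {f : 𝒳 → 𝒴} (hf : Measurable f) {g : 𝒴 → 𝒳}
    (hg : Measurable g) (hgf : Function.LeftInverse g f) :
    relInfo (M.map (Prod.map id f)) (π.map f) = relInfo M π := by
  have h1 : (M.fst.prod π).map (Prod.map id f) = (M.map (Prod.map id f)).fst.prod (π.map f) := by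
    rw [← Measure.map_prod_map _ _ measurable_id hf, Measure.map_id, Measure.fst, Measure.fst,
      Measure.map_map (by fun_prop) (by fun_prop)]
    rfl
  rw [relInfo, ← h1, relInfo]
  exact klDiv_map_of_leftInverse _ _ (h := Prod.map id g) (by fun_prop) (by fun_prop)
    fun p => Prod.ext rfl (hgf p.2)

lemma relInfo_comp_left_le (T : Kernel 𝒲 𝒲') [IsMarkovKernel T] :
    relInfo ((T ∥ₖ Kernel.id) ∘ₘ M) π ≤ relInfo M π := by
  rw [relInfo, fst_comp_left, Measure.prod_comp_left]
  exact klDiv_comp_right_le _ _ _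

lemma relInfo_compProd [MeasurableSpace.CountableOrCountablyGenerated 𝒲 𝒳]
    (ν : Measure 𝒲) [IsProbabilityMeasure ν] (ζ : Kernel 𝒲 𝒳) [IsMarkovKernel ζ] :
    relInfo (ν ⊗ₘ ζ) π = ∫⁻ w, klDiv (ζ w) π ∂ν := by
  rw [relInfo, Measure.fst_compProd, ← Measure.compProd_const, klDiv_compProd_eq_lintegral]
  rfl

end Through

/-! ### Chain rules and monotonicity of the information lost in a channel. -/

section Chain

variable {𝒜 ℬ 𝒞 𝒲 𝒲' 𝒳 𝒵 : Type*} [MeasurableSpace 𝒜] [MeasurableSpace ℬ] [MeasurableSpace 𝒞]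
  [MeasurableSpace 𝒲] [MeasurableSpace 𝒲'] [MeasurableSpace 𝒳] [MeasurableSpace 𝒵]

/-- Chain rule for `relInfo` in its second variable. -/
lemma relInfo_prod [StandardBorelSpace 𝒞] [Nonempty 𝒞] (N : Measure (𝒲 × (ℬ × 𝒞)))
    [IsProbabilityMeasure N] (ρ : Measure ℬ) [IsProbabilityMeasure ρ] (τ : Measure 𝒞)
    [IsProbabilityMeasure τ] :
    relInfo N (ρ.prod τ) = relInfo (N.map fun p => (p.1, p.2.1)) ρ
      + relInfo (N.map fun p => ((p.1, p.2.1), p.2.2)) τ := by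
  let e : 𝒲 × (ℬ × 𝒞) → (𝒲 × ℬ) × 𝒞 := fun p => ((p.1, p.2.1), p.2.2)
  have he : Measurable e := by fun_prop
  have h1 : (N.map e).fst = N.map fun p => (p.1, p.2.1) := by
    rw [Measure.fst, Measure.map_map (by fun_prop) he]; rfl
  have h2 : (N.map fun p => (p.1, p.2.1)).fst = N.fst := by
    rw [Measure.fst, Measure.map_map (by fun_prop) (by fun_prop)]; rfl
  have : IsProbabilityMeasure (N.map e) := Measure.isProbabilityMeasure_map he.aemeasurable
  have : IsProbabilityMeasure (N.map fun p => (p.1, p.2.1)) :=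
    Measure.isProbabilityMeasure_map (by fun_prop)
  have h3 : (N.fst.prod (ρ.prod τ)).map e = (N.fst.prod ρ).prod τ :=
    Measure.prodAssoc_prod (μ := N.fst) (ν := ρ) (τ := τ) ▸ by
      rw [Measure.map_map he (by fun_prop)]
      exact Measure.map_id
  rw [relInfo, ← klDiv_map_of_leftInverse N _ he
    (h := fun p : (𝒲 × ℬ) × 𝒞 => (p.1.1, (p.1.2, p.2))) (by fun_prop) (fun _ => rfl), h3]
  change _ = _ + relInfo (N.map e) τ
  -- The reference law has constant conditional law τ given the first pair, so the chain rule splits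
  -- off exactly the divergence from independence of the last coordinate.
  conv_lhs => rw [← (N.map e).disintegrate (N.map e).condKernel, ← Measure.compProd_const,
    klDiv_compProd_eq_add, Measure.disintegrate, Measure.compProd_const]
  rw [h1, relInfo, h2, relInfo, h1]

lemma relInfo_prod_swap [StandardBorelSpace ℬ] [Nonempty ℬ] (N : Measure (𝒲 × (ℬ × 𝒞)))
    [IsProbabilityMeasure N] (ρ : Measure ℬ) [IsProbabilityMeasure ρ] (τ : Measure 𝒞)
    [IsProbabilityMeasure τ] :
    relInfo N (ρ.prod τ) = relInfo (N.map fun p => (p.1, p.2.2)) τ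
      + relInfo (N.map fun p => ((p.1, p.2.2), p.2.1)) ρ := by
  have : IsProbabilityMeasure (N.map (Prod.map id Prod.swap)) :=
    Measure.isProbabilityMeasure_map (by fun_prop)
  rw [← relInfo_map_right_of_leftInverse N _ measurable_swap measurable_swap Prod.swap_swap,
    Measure.prod_swap, relInfo_prod, Measure.map_map (by fun_prop) (by fun_prop),
    Measure.map_map (by fun_prop) (by fun_prop)]
  rfl

/-- Chain rule for `relInfo` in its first variable. -/
lemma relInfo_pair [StandardBorelSpace ℬ] [Nonempty ℬ] (J : Measure ((𝒜 × ℬ) × 𝒳))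
    [IsProbabilityMeasure J] (π : Measure 𝒳) [IsProbabilityMeasure π] (β : Kernel 𝒜 ℬ)
    [IsMarkovKernel β] (hβ : J.fst = J.fst.fst ⊗ₘ β) :
    relInfo J π = relInfo (J.map fun p => (p.1.1, p.2)) π
      + klDiv (J.map fun p => ((p.1.1, p.2), p.1.2))
          ((J.map fun p => (p.1.1, p.2)) ⊗ₘ β.comap Prod.fst measurable_fst) := by
  let e : (𝒜 × ℬ) × 𝒳 → (𝒜 × 𝒳) × ℬ := fun p => ((p.1.1, p.2), p.1.2)
  have he : Measurable e := by fun_prop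
  have h1 : (J.map e).fst = J.map fun p => (p.1.1, p.2) := by
    rw [Measure.fst, Measure.map_map (by fun_prop) he]; rfl
  have h2 : (J.map fun p => (p.1.1, p.2)).fst = J.fst.fst := by
    rw [Measure.fst, Measure.fst, Measure.fst, Measure.map_map (by fun_prop) (by fun_prop),
      Measure.map_map (by fun_prop) (by fun_prop)]
    rfl
  have : IsProbabilityMeasure (J.map e) := Measure.isProbabilityMeasure_map he.aemeasurable
  have : IsProbabilityMeasure (J.map fun p => (p.1.1, p.2)) :=
    Measure.isProbabilityMeasure_map (by fun_prop)
  -- Under the reference law X is independent of the pair, so the conditional law of the second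
  -- component still depends on the first one only.
  have h3 : (J.fst.prod π).map e = (J.fst.fst.prod π) ⊗ₘ β.comap Prod.fst measurable_fst := by
    conv_lhs => rw [hβ]
    refine Measure.ext_of_lintegral _ fun f hf => ?_
    rw [lintegral_map hf he, lintegral_prod _ (by fun_prop),
      Measure.lintegral_compProd (by fun_prop), Measure.lintegral_compProd hf,
      lintegral_prod _ (Measurable.aemeasurable (by fun_prop))]
    refine lintegral_congr fun a => ?_
    exact lintegral_lintegral_swap (by fun_prop)
  rw [relInfo, ← klDiv_map_of_leftInverse J _ he
    (h := fun p : (𝒜 × 𝒳) × ℬ => ((p.1.1, p.2), p.1.2)) (by fun_prop) (fun _ => rfl), h3]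
  change _ = _ + klDiv (J.map e) _
  conv_lhs => rw [← (J.map e).disintegrate (J.map e).condKernel,
    klDiv_compProd_eq_add, Measure.disintegrate]
  rw [h1, relInfo, h2]

/-- Passing to the output of a channel decreases the conditional information of the second component
of the first variable. -/
lemma relInfo_through_add_le [StandardBorelSpace ℬ] [Nonempty ℬ] (J : Measure ((𝒜 × ℬ) × 𝒳))
    [IsProbabilityMeasure J] (π : Measure 𝒳) [IsProbabilityMeasure π] (L : Kernel 𝒳 𝒵)
    [IsMarkovKernel L] :
    relInfo (through L J) (L ∘ₘ π) + relInfo (J.map fun p => (p.1.1, p.2)) π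
      ≤ relInfo J π + relInfo (through L (J.map fun p => (p.1.1, p.2))) (L ∘ₘ π) := by
  have : IsProbabilityMeasure (J.map fun p => (p.1.1, p.2)) :=
    Measure.isProbabilityMeasure_map (by fun_prop)
  have hβ : J.fst = J.fst.fst ⊗ₘ J.fst.condKernel := (Measure.disintegrate _ _).symm
  have hm : (through L J).map (fun p => (p.1.1, p.2)) = through L (J.map fun p => (p.1.1, p.2)) :=
    (through_map_left L J (f := Prod.fst) measurable_fst).symm
  rw [relInfo_pair J π _ hβ, relInfo_pair (through L J) (L ∘ₘ π) J.fst.condKernel (by simp [← hβ]),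
    hm]
  -- After the common terms of the two chain rules are removed, a conditional information of the
  -- second component remains on each side. Both laws on the output side are images under L acting
  -- on the coordinate X alone, since the conditional law does not involve X.
  have key : klDiv ((through L J).map fun p => ((p.1.1, p.2), p.1.2))
      ((through L (J.map fun p => (p.1.1, p.2))) ⊗ₘ J.fst.condKernel.comap Prod.fst measurable_fst)
      ≤ klDiv (J.map fun p => ((p.1.1, p.2), p.1.2))
          ((J.map fun p => (p.1.1, p.2)) ⊗ₘ J.fst.condKernel.comap Prod.fst measurable_fst) := by
    convert klDiv_comp_right_le (J.map fun p => ((p.1.1, p.2), p.1.2))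
      ((J.map fun p => (p.1.1, p.2)) ⊗ₘ J.fst.condKernel.comap Prod.fst measurable_fst)
      ((Kernel.id ∥ₖ L) ∥ₖ Kernel.id) using 1
    congr 1
    · refine Measure.ext_of_lintegral _ fun f hf => ?_
      rw [lintegral_map hf (by fun_prop), lintegral_through _ _ (by fun_prop),
        Measure.lintegral_bind (by fun_prop) (by fun_prop),
        lintegral_map (by fun_prop) (by fun_prop)]
      refine lintegral_congr fun p => ?_
      rw [Kernel.lintegral_parallelComp_symm, Kernel.id_apply, lintegral_dirac',
        Kernel.lintegral_parallelComp, Kernel.id_apply, lintegral_dirac']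
      all_goals fun_prop
    · refine Measure.ext_of_lintegral _ fun f hf => ?_
      rw [Measure.lintegral_compProd hf, lintegral_through _ _ (by fun_prop),
        Measure.lintegral_bind (by fun_prop) (by fun_prop),
        Measure.lintegral_compProd (by fun_prop)]
      refine lintegral_congr fun p => ?_
      simp only [Kernel.comap_apply]
      rw [lintegral_lintegral_swap (by fun_prop)]
      refine lintegral_congr fun b => ?_
      rw [Kernel.lintegral_parallelComp_symm, Kernel.id_apply, lintegral_dirac',
        Kernel.lintegral_parallelComp, Kernel.id_apply, lintegral_dirac']
      all_goals fun_prop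
  calc _ ≤ relInfo (through L (J.map fun p => (p.1.1, p.2))) (L ∘ₘ π)
        + klDiv (J.map fun p => ((p.1.1, p.2), p.1.2))
          ((J.map fun p => (p.1.1, p.2)) ⊗ₘ J.fst.condKernel.comap Prod.fst measurable_fst)
        + relInfo (J.map fun p => (p.1.1, p.2)) π := by gcongr
    _ = _ := by abel

/-- Processing the first variable decreases the loss of information in a channel. -/
lemma relInfo_through_comp_left_add_le [StandardBorelSpace 𝒲] [Nonempty 𝒲]
    (M : Measure (𝒲 × 𝒳)) [IsProbabilityMeasure M] (π : Measure 𝒳) [IsProbabilityMeasure π]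
    (L : Kernel 𝒳 𝒵) [IsMarkovKernel L] (T : Kernel 𝒲 𝒲') [IsMarkovKernel T] :
    relInfo (through L M) (L ∘ₘ π) + relInfo ((T ∥ₖ Kernel.id) ∘ₘ M) π
      ≤ relInfo M π + relInfo (through L ((T ∥ₖ Kernel.id) ∘ₘ M)) (L ∘ₘ π) := by
  -- The processed variable W' is kept together with W. Adjoining W' does not increase the
  -- information about X, and forgetting it does not increase the information about Z; the preceding
  -- lemma then discards W from the pair.
  let J : Measure ((𝒲' × 𝒲) × 𝒳) := ((T ×ₖ Kernel.id) ∥ₖ Kernel.id) ∘ₘ M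
  have hT : ∀ {f : 𝒲' × 𝒲 → ℝ≥0∞}, Measurable f → ∀ w,
      ∫⁻ q, f q ∂(T ×ₖ Kernel.id) w = ∫⁻ w', f (w', w) ∂T w := by
    intro f hf w
    rw [Kernel.lintegral_prod _ _ _ hf]
    refine lintegral_congr fun w' => ?_
    rw [Kernel.id_apply, lintegral_dirac' _ (by fun_prop)]
  have hJ1 : J.map (fun p => (p.1.1, p.2)) = (T ∥ₖ Kernel.id) ∘ₘ M := by
    refine Measure.ext_of_lintegral _ fun f hf => ?_
    rw [lintegral_map hf (by fun_prop), lintegral_comp_left _ _ (by fun_prop),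
      lintegral_comp_left _ _ hf]
    refine lintegral_congr fun p => ?_
    rw [hT (by fun_prop)]
  have hJ2 : J.map (Prod.map Prod.snd id) = M := by
    refine Measure.ext_of_lintegral _ fun f hf => ?_
    rw [lintegral_map hf (by fun_prop), lintegral_comp_left _ _ (by fun_prop)]
    refine lintegral_congr fun p => ?_
    rw [hT (by fun_prop)]
    simp
  have hJL : through L J = ((T ×ₖ Kernel.id) ∥ₖ Kernel.id) ∘ₘ (through L M) := by
    refine Measure.ext_of_lintegral _ fun f hf => ?_
    rw [lintegral_through _ _ hf, lintegral_comp_left _ _ (by fun_prop),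
      lintegral_comp_left _ _ hf, lintegral_through _ _ (by fun_prop)]
    refine lintegral_congr fun p => ?_
    exact lintegral_lintegral_swap (μ := (T ×ₖ Kernel.id) p.1) (ν := L p.2)
      (f := fun q z => f (q, z)) (by fun_prop)
  have h := relInfo_through_add_le J π L
  have h1 : relInfo J π ≤ relInfo M π := relInfo_comp_left_le M π _
  have h2 : relInfo (through L M) (L ∘ₘ π) ≤ relInfo (through L J) (L ∘ₘ π) := by
    rw [← hJ2, through_map_left _ _ measurable_snd]
    exact relInfo_map_left_le _ _ measurable_snd
  rw [hJ1] at h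
  calc _ ≤ _ := by gcongr
    _ ≤ _ := h
    _ ≤ _ := by gcongr

end Chain

/-! ### Disintegration over the first auxiliary variable. -/

section Fibers

variable {𝒰 𝒱 𝒲 𝒳 𝒴 𝒵 : Type*} [MeasurableSpace 𝒰] [MeasurableSpace 𝒱] [MeasurableSpace 𝒲]
  [MeasurableSpace 𝒳] [MeasurableSpace 𝒴] [MeasurableSpace 𝒵]

/-- The law of `((U, V), X)` when `U` has law `ν` and `(V, X)` has conditional law `η` given `U`. -/
noncomputable def glue (ν : Measure 𝒰) (η : Kernel 𝒰 (𝒱 × 𝒳)) : Measure ((𝒰 × 𝒱) × 𝒳) :=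
  (ν ⊗ₘ η).map fun p => ((p.1, p.2.1), p.2.2)

instance (ν : Measure 𝒰) [IsProbabilityMeasure ν] (η : Kernel 𝒰 (𝒱 × 𝒳)) [IsMarkovKernel η] :
    IsProbabilityMeasure (glue ν η) :=
  Measure.isProbabilityMeasure_map (by fun_prop)

lemma lintegral_glue (ν : Measure 𝒰) [SFinite ν] (η : Kernel 𝒰 (𝒱 × 𝒳)) [IsSFiniteKernel η]
    {f : (𝒰 × 𝒱) × 𝒳 → ℝ≥0∞} (hf : Measurable f) :
    ∫⁻ p, f p ∂(glue ν η) = ∫⁻ u, ∫⁻ q, f ((u, q.1), q.2) ∂η u ∂ν := by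
  rw [glue, lintegral_map hf (by fun_prop), Measure.lintegral_compProd (by fun_prop)]

lemma glue_map_fst (ν : Measure 𝒰) [SFinite ν] (η : Kernel 𝒰 (𝒱 × 𝒳)) [IsSFiniteKernel η] :
    (glue ν η).map (fun p => (p.1.1, p.2)) = ν ⊗ₘ η.snd := by
  refine Measure.ext_of_lintegral _ fun f hf => ?_
  rw [lintegral_map hf (by fun_prop), lintegral_glue _ _ (by fun_prop),
    Measure.lintegral_compProd hf]
  refine lintegral_congr fun u => ?_
  rw [Kernel.lintegral_snd _ _ (by fun_prop)]

lemma through_glue (K : Kernel 𝒳 𝒴) [IsMarkovKernel K] (ν : Measure 𝒰) [SFinite ν]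
    (η : Kernel 𝒰 (𝒱 × 𝒳)) [IsMarkovKernel η] :
    through K (glue ν η) = glue ν ((Kernel.id ∥ₖ K) ∘ₖ η) := by
  refine Measure.ext_of_lintegral _ fun f hf => ?_
  rw [lintegral_through _ _ hf, lintegral_glue _ _ (by fun_prop), lintegral_glue _ _ hf]
  refine lintegral_congr fun u => ?_
  rw [Kernel.comp_apply, ← through, lintegral_through _ _ (by fun_prop)]

lemma exists_eq_glue [StandardBorelSpace 𝒱] [Nonempty 𝒱] [StandardBorelSpace 𝒳] [Nonempty 𝒳]
    (M : Measure ((𝒰 × 𝒱) × 𝒳)) [IsProbabilityMeasure M] :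
    ∃ (ν : Measure 𝒰) (_ : IsProbabilityMeasure ν) (η : Kernel 𝒰 (𝒱 × 𝒳)) (_ : IsMarkovKernel η),
      M = glue ν η := by
  let N : Measure (𝒰 × (𝒱 × 𝒳)) := M.map fun p => (p.1.1, (p.1.2, p.2))
  have : IsProbabilityMeasure N := Measure.isProbabilityMeasure_map (by fun_prop)
  refine ⟨N.fst, inferInstance, N.condKernel, inferInstance, ?_⟩
  rw [glue, N.disintegrate, Measure.map_map (by fun_prop) (by fun_prop)]
  exact Measure.map_id.symm

lemma klDiv_glue_kernel (η : Kernel 𝒰 (𝒱 × 𝒳)) [IsMarkovKernel η] (π : Measure 𝒳)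
    [IsProbabilityMeasure π] (u : 𝒰) :
    klDiv (η u) ((η.fst ×ₖ Kernel.const 𝒰 π) u) = relInfo (η u) π := by
  rw [relInfo, Kernel.prod_apply, Kernel.fst_apply, Kernel.const_apply, Measure.fst]

lemma measurable_relInfo_kernel [MeasurableSpace.CountableOrCountablyGenerated 𝒰 (𝒱 × 𝒳)]
    (η : Kernel 𝒰 (𝒱 × 𝒳)) [IsMarkovKernel η] (π : Measure 𝒳) [IsProbabilityMeasure π] :
    Measurable fun u => relInfo (η u) π := by
  simp_rw [← klDiv_glue_kernel]
  exact measurable_klDiv_kernel _ _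

/-- Both laws have the same U-marginal ν, and the fiber of the reference law at u is the V-marginal
of `η u` times π; the divergence is thus the mean of the fiber divergences. -/
lemma relInfo_glue [MeasurableSpace.CountableOrCountablyGenerated 𝒰 (𝒱 × 𝒳)]
    (ν : Measure 𝒰) [IsProbabilityMeasure ν] (η : Kernel 𝒰 (𝒱 × 𝒳)) [IsMarkovKernel η]
    (π : Measure 𝒳) [IsProbabilityMeasure π] :
    relInfo (glue ν η) π = ∫⁻ u, relInfo (η u) π ∂ν := by
  have h : (glue ν η).fst.prod π
      = (ν ⊗ₘ (η.fst ×ₖ Kernel.const 𝒰 π)).map fun p => ((p.1, p.2.1), p.2.2) := by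
    refine Measure.ext_of_lintegral _ fun f hf => ?_
    rw [lintegral_prod _ hf.aemeasurable, Measure.fst, lintegral_map (by fun_prop) (by fun_prop),
      lintegral_glue _ _ (by fun_prop), lintegral_map hf (by fun_prop),
      Measure.lintegral_compProd (by fun_prop)]
    refine lintegral_congr fun u => ?_
    rw [Kernel.lintegral_prod _ _ _ (by fun_prop), Kernel.lintegral_fst _ _ (by fun_prop)]
    rfl
  rw [relInfo, h, glue, klDiv_map_of_leftInverse _ _
    (h := fun p : (𝒰 × 𝒱) × 𝒳 => (p.1.1, (p.1.2, p.2))) (by fun_prop) (by fun_prop) (fun _ => rfl),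
    klDiv_compProd_eq_lintegral]
  simp_rw [klDiv_glue_kernel]

/-- The information `I(W; Y) + D(Q_Y ‖ P_Y)`, where `(W, X)` has law `M`, `Y` is the output of the
channel `K` for the input `X`, and `P_Y` is the output law for the input law `π`. -/
noncomputable def info (π : Measure 𝒳) (K : Kernel 𝒳 𝒴) (M : Measure (𝒲 × 𝒳)) : ℝ :=
  (relInfo (through K M) (K ∘ₘ π)).toReal

/-- The divergence of the outputs of the channel `K` for the inputs `Q` and `π`. -/
noncomputable def outDiv (π : Measure 𝒳) (K : Kernel 𝒳 𝒴) (Q : Measure 𝒳) : ℝ :=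
  (klDiv (K ∘ₘ Q) (K ∘ₘ π)).toReal

/-- The advantage of the channel `K` over the channel `L` in terms of `info`. -/
noncomputable def excess (π : Measure 𝒳) (K : Kernel 𝒳 𝒴) (L : Kernel 𝒳 𝒵)
    (M : Measure (𝒲 × 𝒳)) : ℝ :=
  info π K M - info π L M

/-- The advantage of the channel `K` over the channel `L` in terms of output divergences. -/
noncomputable def divExcess (π : Measure 𝒳) (K : Kernel 𝒳 𝒴) (L : Kernel 𝒳 𝒵)
    (Q : Measure 𝒳) : ℝ :=
  outDiv π K Q - outDiv π L Q

section Basic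

variable {π : Measure 𝒳} [IsProbabilityMeasure π] {K : Kernel 𝒳 𝒴} [IsMarkovKernel K]
  {L : Kernel 𝒳 𝒵} [IsMarkovKernel L] {M : Measure (𝒲 × 𝒳)} [IsProbabilityMeasure M]
  {Q : Measure 𝒳} [IsProbabilityMeasure Q]

lemma info_id : info π Kernel.id M = (relInfo M π).toReal := by
  rw [info, through_id, Measure.id_comp]

lemma outDiv_id : outDiv π Kernel.id Q = (klDiv Q π).toReal := by
  rw [outDiv, Measure.id_comp, Measure.id_comp]

lemma relInfo_through_ne_top (h : relInfo M π ≠ ∞) : relInfo (through K M) (K ∘ₘ π) ≠ ∞ :=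
  ((relInfo_through_le M π K).trans_lt h.lt_top).ne

lemma klDiv_comp_ne_top (h : klDiv Q π ≠ ∞) : klDiv (K ∘ₘ Q) (K ∘ₘ π) ≠ ∞ :=
  ((klDiv_comp_right_le Q π K).trans_lt h.lt_top).ne

lemma info_le_info_id (h : relInfo M π ≠ ∞) : info π K M ≤ info π Kernel.id M := by
  rw [info_id]
  exact ENNReal.toReal_mono h (relInfo_through_le M π K)

lemma outDiv_le_outDiv_id (h : klDiv Q π ≠ ∞) : outDiv π K Q ≤ outDiv π Kernel.id Q := by
  rw [outDiv_id]
  exact ENNReal.toReal_mono h (klDiv_comp_right_le Q π K)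

lemma outDiv_nonneg : 0 ≤ outDiv π K Q := ENNReal.toReal_nonneg

lemma info_nonneg : 0 ≤ info π K M := ENNReal.toReal_nonneg

@[simp]
lemma outDiv_self : outDiv π K π = 0 := by
  simp [outDiv, klDiv_self]

lemma relInfo_map_fst_ne_top {M : Measure ((𝒰 × 𝒱) × 𝒳)} [IsProbabilityMeasure M]
    (h : relInfo M π ≠ ∞) : relInfo (M.map fun p => (p.1.1, p.2)) π ≠ ∞ :=
  ((relInfo_map_left_le M π measurable_fst).trans_lt h.lt_top).ne

variable [MeasurableSpace.CountablyGenerated 𝒳] [MeasurableSpace.CountablyGenerated 𝒴]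
  [MeasurableSpace.CountablyGenerated 𝒱]

/-- The average of `relInfo_glue` applied after the channel. Finiteness at the input suffices, by
data processing, for passing from extended to real integrals. -/
lemma integral_info_glue {ν : Measure 𝒰} [IsProbabilityMeasure ν]
    {η : Kernel 𝒰 (𝒱 × 𝒳)} [IsMarkovKernel η] (h : relInfo (glue ν η) π ≠ ∞) :
    Integrable (fun u => info π K (η u)) ν ∧ info π K (glue ν η) = ∫ u, info π K (η u) ∂ν := by
  have hm : Measurable fun u => relInfo (through K (η u)) (K ∘ₘ π) := by
    have := measurable_relInfo_kernel ((Kernel.id ∥ₖ K) ∘ₖ η) (K ∘ₘ π)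
    simp only [Kernel.comp_apply] at this
    exact this
  have h1 : relInfo (through K (glue ν η)) (K ∘ₘ π)
      = ∫⁻ u, relInfo (through K (η u)) (K ∘ₘ π) ∂ν := by
    rw [through_glue, relInfo_glue]
    simp only [Kernel.comp_apply]
    rfl
  have h2 := relInfo_through_ne_top (K := K) h
  rw [h1] at h2
  refine ⟨integrable_toReal_of_lintegral_ne_top hm.aemeasurable h2, ?_⟩
  rw [info, h1]
  exact (integral_toReal hm.aemeasurable (ae_lt_top hm h2)).symm

/-- With U alone nothing but the input law is left in a fiber, so output divergences are averaged
instead of informations. -/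
lemma integral_outDiv_compProd {ν : Measure 𝒰} [IsProbabilityMeasure ν]
    {ζ : Kernel 𝒰 𝒳} [IsMarkovKernel ζ] (h : relInfo (ν ⊗ₘ ζ) π ≠ ∞) :
    Integrable (fun u => outDiv π K (ζ u)) ν ∧ info π K (ν ⊗ₘ ζ) = ∫ u, outDiv π K (ζ u) ∂ν := by
  have hm : Measurable fun u => klDiv (K ∘ₘ (ζ u)) (K ∘ₘ π) := by
    have := measurable_klDiv_kernel (K ∘ₖ ζ) (Kernel.const 𝒰 (K ∘ₘ π))
    simpa only [Kernel.comp_apply, Kernel.const_apply] using this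
  have h1 : relInfo (through K (ν ⊗ₘ ζ)) (K ∘ₘ π)
      = ∫⁻ u, klDiv (K ∘ₘ (ζ u)) (K ∘ₘ π) ∂ν := by
    rw [through_compProd, relInfo_compProd]
    simp only [Kernel.comp_apply]
  have h2 := relInfo_through_ne_top (K := K) h
  rw [h1] at h2
  refine ⟨integrable_toReal_of_lintegral_ne_top hm.aemeasurable h2, ?_⟩
  rw [info, h1]
  exact (integral_toReal hm.aemeasurable (ae_lt_top hm h2)).symm

end Basic

end Fibers

/-! ### The linear inequalities behind the suprema. -/

section Bounds

variable {𝒳 𝒴 𝒵 : Type u} [MeasurableSpace 𝒳] [MeasurableSpace 𝒴] [MeasurableSpace 𝒵]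

/-- The inequality `num ≤ t * den` for all laws of `((U, V), X)`, in terms of `excess`. -/
def KeyBound (t : ℝ) (π : Measure 𝒳) (K : Kernel 𝒳 𝒴) (L : Kernel 𝒳 𝒵) : Prop :=
  ∀ (𝒰 𝒱 : Type u) [MeasurableSpace 𝒰] [StandardBorelSpace 𝒰] [Nonempty 𝒰]
    [MeasurableSpace 𝒱] [StandardBorelSpace 𝒱] [Nonempty 𝒱]
    (M : Measure ((𝒰 × 𝒱) × 𝒳)) [IsProbabilityMeasure M], relInfo M π ≠ ∞ →
    excess π K L M - excess π K L (M.map fun p => (p.1.1, p.2))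
      ≤ t * (excess π Kernel.id L M - excess π K L (M.map fun p => (p.1.1, p.2)))

/-- The restriction of `KeyBound` to the laws of `((U, V), X)` for which `X` has law `π`. -/
def SourceKeyBound (t : ℝ) (π : Measure 𝒳) (K : Kernel 𝒳 𝒴) (L : Kernel 𝒳 𝒵) : Prop :=
  ∀ (𝒰 𝒱 : Type u) [MeasurableSpace 𝒰] [StandardBorelSpace 𝒰] [Nonempty 𝒰]
    [MeasurableSpace 𝒱] [StandardBorelSpace 𝒱] [Nonempty 𝒱]
    (M : Measure ((𝒰 × 𝒱) × 𝒳)) [IsProbabilityMeasure M], M.snd = π → relInfo M π ≠ ∞ →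
    excess π K L M - excess π K L (M.map fun p => (p.1.1, p.2))
      ≤ t * (excess π Kernel.id L M - excess π K L (M.map fun p => (p.1.1, p.2)))

/-- The version of `KeyBound` for constant `U`. -/
def VariationalBound (t : ℝ) (π : Measure 𝒳) (K : Kernel 𝒳 𝒴) (L : Kernel 𝒳 𝒵) : Prop :=
  ∀ (𝒱 : Type u) [MeasurableSpace 𝒱] [StandardBorelSpace 𝒱] [Nonempty 𝒱]
    (M : Measure (𝒱 × 𝒳)) [IsProbabilityMeasure M], relInfo M π ≠ ∞ →
    excess π K L M - divExcess π K L M.snd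
      ≤ t * (excess π Kernel.id L M - divExcess π K L M.snd)

/-- The version of `SourceKeyBound` for constant `U`. -/
def InfoBound (t : ℝ) (π : Measure 𝒳) (K : Kernel 𝒳 𝒴) (L : Kernel 𝒳 𝒵) : Prop :=
  ∀ (𝒰 : Type u) [MeasurableSpace 𝒰] [StandardBorelSpace 𝒰] [Nonempty 𝒰]
    (M : Measure (𝒰 × 𝒳)) [IsProbabilityMeasure M], M.snd = π → relInfo M π ≠ ∞ →
    excess π K L M ≤ t * excess π Kernel.id L M

/-- The inequality between output divergences that corresponds to `InfoBound`. -/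
def DivergenceBound (t : ℝ) (π : Measure 𝒳) (K : Kernel 𝒳 𝒴) (L : Kernel 𝒳 𝒵) : Prop :=
  ∀ (Q : Measure 𝒳) [IsProbabilityMeasure Q], klDiv Q π ≠ ∞ →
    divExcess π K L Q ≤ t * divExcess π Kernel.id L Q

variable [StandardBorelSpace 𝒳] [Nonempty 𝒳] [StandardBorelSpace 𝒴] [StandardBorelSpace 𝒵]
  {t : ℝ} {π : Measure 𝒳} [IsProbabilityMeasure π]
  {K : Kernel 𝒳 𝒴} [IsMarkovKernel K] {L : Kernel 𝒳 𝒵} [IsMarkovKernel L]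

lemma KeyBound.source (h : KeyBound t π K L) : SourceKeyBound t π K L :=
  fun 𝒰 𝒱 _ _ _ _ _ _ M _ _ hM => h 𝒰 𝒱 M hM

/-- Both sides are averages over u of the variational quantities of the fiber `η u`. The X-law of a
fiber is generally not π, which is why the variational bound has to cover all input laws. -/
lemma VariationalBound.keyBound (h : VariationalBound t π K L) : KeyBound t π K L := by
  intro 𝒰 𝒱 _ _ _ _ _ _ M _ hM
  obtain ⟨ν, _, η, _, rfl⟩ := exists_eq_glue M
  have hU := relInfo_map_fst_ne_top hM
  rw [glue_map_fst] at hU ⊢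
  obtain ⟨hK1, hK2⟩ := integral_info_glue (K := K) hM
  obtain ⟨hL1, hL2⟩ := integral_info_glue (K := L) hM
  obtain ⟨hI1, hI2⟩ := integral_info_glue (K := Kernel.id) hM
  obtain ⟨hKU1, hKU2⟩ := integral_outDiv_compProd (K := K) hU
  obtain ⟨hLU1, hLU2⟩ := integral_outDiv_compProd (K := L) hU
  simp only [excess, hK2, hL2, hI2, hKU2, hLU2]
  have hE : Integrable (fun u => info π K (η u) - info π L (η u)) ν := hK1.sub hL1
  have hF : Integrable (fun u => info π Kernel.id (η u) - info π L (η u)) ν := hI1.sub hL1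
  have hG : Integrable (fun u => outDiv π K (η.snd u) - outDiv π L (η.snd u)) ν := hKU1.sub hLU1
  rw [← integral_sub hK1 hL1, ← integral_sub hKU1 hLU1, ← integral_sub hI1 hL1,
    ← integral_sub hE hG, ← integral_sub hF hG, ← integral_const_mul]
  refine integral_mono_ae (hE.sub hG) ((hF.sub hG).const_mul t) ?_
  rw [relInfo_glue] at hM
  filter_upwards [ae_lt_top (measurable_relInfo_kernel η π) hM] with u hu
  have := h 𝒱 (η u) hu.ne
  simpa only [excess, divExcess, Kernel.snd_apply, Measure.snd] using this

lemma VariationalBound.infoBound (h : VariationalBound t π K L) : InfoBound t π K L := by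
  intro 𝒰 _ _ _ M _ hM hfin
  simpa [hM, divExcess] using h 𝒰 M hfin

/-- For a channel `K` that is more capable of preserving divergences than `L`, the bound on
divergences suffices. -/
lemma DivergenceBound.keyBound (h : DivergenceBound t π K L) (ht : t ≤ 1)
    (hKL : ∀ (Q : Measure 𝒳) [IsProbabilityMeasure Q], klDiv Q π ≠ ∞ → 0 ≤ divExcess π K L Q) :
    KeyBound t π K L := by
  -- Averaging the pointwise inequalities over the values of the auxiliary variable turns
  -- divergences into informations.
  have key : ∀ (𝒰 : Type u) [MeasurableSpace 𝒰] [StandardBorelSpace 𝒰] [Nonempty 𝒰]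
      (M : Measure (𝒰 × 𝒳)) [IsProbabilityMeasure M], relInfo M π ≠ ∞ →
      excess π K L M ≤ t * excess π Kernel.id L M ∧ 0 ≤ excess π K L M := by
    intro 𝒰 _ _ _ M _ hM
    obtain ⟨ν, _, ζ, _, rfl⟩ : ∃ (ν : Measure 𝒰) (_ : IsProbabilityMeasure ν) (ζ : Kernel 𝒰 𝒳)
        (_ : IsMarkovKernel ζ), M = ν ⊗ₘ ζ :=
      ⟨M.fst, inferInstance, M.condKernel, inferInstance, (M.disintegrate _).symm⟩
    obtain ⟨hK1, hK2⟩ := integral_outDiv_compProd (K := K) hM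
    obtain ⟨hL1, hL2⟩ := integral_outDiv_compProd (K := L) hM
    obtain ⟨hI1, hI2⟩ := integral_outDiv_compProd (K := Kernel.id) hM
    have hfin : ∀ᵐ u ∂ν, klDiv (ζ u) π ≠ ∞ := by
      rw [relInfo_compProd] at hM
      filter_upwards [ae_lt_top (measurable_klDiv_kernel ζ (Kernel.const 𝒰 π)) hM] with u hu
      exact hu.ne
    simp only [excess, hK2, hL2, hI2]
    rw [← integral_sub hK1 hL1, ← integral_sub hI1 hL1, ← integral_const_mul]
    constructor
    · refine integral_mono_ae (hK1.sub hL1) ((hI1.sub hL1).const_mul t) ?_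
      filter_upwards [hfin] with u hu
      exact h (ζ u) hu
    · refine integral_nonneg_of_ae ?_
      filter_upwards [hfin] with u hu
      exact hKL (ζ u) hu
  intro 𝒰 𝒱 _ _ _ _ _ _ M _ hM
  have : IsProbabilityMeasure (M.map fun p => (p.1.1, p.2)) :=
    Measure.isProbabilityMeasure_map (by fun_prop)
  have h1 := key (𝒰 × 𝒱) M hM
  have h2 := key 𝒰 (M.map fun p => (p.1.1, p.2)) (relInfo_map_fst_ne_top hM)
  -- The bound for the pair dominates the first term; replacing the subtracted E(U) by t * E(U) is
  -- allowed since (1 - t) * E(U) ≥ 0.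
  nlinarith [mul_nonneg (sub_nonneg.mpr ht) h2.2]

end Bounds

open Filter Topology

/-! ### Bounded densities and splitting off a small component. -/

section Bounded

variable {α : Type*} {mα : MeasurableSpace α}

lemma rnDeriv_le_of_le_smul {ν ρ : Measure α} [IsFiniteMeasure ν] [IsFiniteMeasure ρ] {C : ℝ≥0∞}
    (h : ν ≤ C • ρ) : ∀ᵐ a ∂ρ, ν.rnDeriv ρ a ≤ C := by
  refine ae_le_of_forall_setLIntegral_le_of_sigmaFinite (Measure.measurable_rnDeriv ν ρ)
    fun s hs _ => ?_
  calc ∫⁻ a in s, ν.rnDeriv ρ a ∂ρ ≤ ν s := Measure.setLIntegral_rnDeriv_le s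
    _ ≤ C * ρ s := by simpa using h s
    _ = ∫⁻ _ in s, C ∂ρ := by simp

lemma absolutelyContinuous_of_le_smul {ν ρ : Measure α} {C : ℝ≥0∞} (h : ν ≤ C • ρ) : ν ≪ ρ :=
  (Measure.absolutelyContinuous_of_le h).trans Measure.smul_absolutelyContinuous

lemma klDiv_ne_top_of_le_smul {ν ρ : Measure α} [IsFiniteMeasure ν] [IsFiniteMeasure ρ]
    {C : ℝ≥0∞} (hC : C ≠ ∞) (h : ν ≤ C • ρ) : klDiv ν ρ ≠ ∞ := by
  rw [klDiv_eq_lintegral_klFun_of_ac (absolutelyContinuous_of_le_smul h)]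
  have hC1 : 1 ≤ C.toReal + 1 := by simp
  -- The constant is the right side of `klFun_le_of_le_mul` at x = 0.
  refine ((lintegral_mono_ae (g := fun _ => ENNReal.ofReal
    ((C.toReal + 1) * klFun 0 + ((C.toReal + 1) * Real.log (C.toReal + 1) * (0 + 1)
      + 2 * (C.toReal + 1) * 0 + 1))) ?_).trans_lt ?_).ne
  · filter_upwards [rnDeriv_le_of_le_smul h] with a ha
    refine ENNReal.ofReal_le_ofReal
      (klFun_le_of_le_mul hC1 le_rfl ENNReal.toReal_nonneg ?_)
    have := ENNReal.toReal_mono hC ha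
    linarith
  · rw [lintegral_const]
    exact ENNReal.mul_lt_top ENNReal.ofReal_lt_top (measure_lt_top _ _)

/-- Follows from log x ≤ x - 1. The quadratic order matters: a perturbation of size ε costs only
O(ε²) in divergence. -/
lemma klFun_le_sub_one_sq {x : ℝ} (hx : 0 ≤ x) : klFun x ≤ (x - 1) ^ 2 := by
  rcases hx.eq_or_lt with rfl | hx
  · simp [klFun_zero]
  · have := Real.log_le_sub_one_of_pos hx
    rw [klFun_apply]
    nlinarith

/-- A law `Q` with bounded density with respect to `π` is a component of `π` with a small weight, the
other component being close to `π`. -/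
lemma exists_mixture {π Q : Measure α} [IsProbabilityMeasure π] [IsProbabilityMeasure Q]
    {C : ℝ} (hC : 1 ≤ C) (hQ : Q ≤ ENNReal.ofReal C • π) {ε : ℝ} (hε : 0 < ε)
    (hεC : 2 * ε * C ≤ 1) :
    ∃ (ξ : Measure α) (_ : IsProbabilityMeasure ξ),
      klDiv ξ π ≤ ENNReal.ofReal (4 * ε ^ 2 * C ^ 2) ∧
      ENNReal.ofReal ε • Q + ENNReal.ofReal (1 - ε) • ξ = π := by
  have hC0 : 0 < C := by linarith
  have hε2 : 2 * ε ≤ 1 := by nlinarith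
  have hεC' : ε * C ≤ 1 / 2 := by linarith
  -- The minimum with C changes the density on a null set only and makes the bound hold everywhere.
  let f : α → ℝ := fun a => min (Q.rnDeriv π a).toReal C
  have hfm : Measurable f := by fun_prop
  have hf0 : ∀ a, 0 ≤ f a := fun a => le_min ENNReal.toReal_nonneg hC0.le
  have hfC : ∀ a, f a ≤ C := fun a => min_le_right _ _
  have hQf : Q = π.withDensity fun a => ENNReal.ofReal (f a) := by
    conv_lhs => rw [← Measure.withDensity_rnDeriv_eq Q π (absolutelyContinuous_of_le_smul hQ)]
    refine withDensity_congr_ae ?_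
    filter_upwards [rnDeriv_le_of_le_smul hQ] with a ha
    have h1 : (Q.rnDeriv π a).toReal ≤ C := by
      have := ENNReal.toReal_mono ENNReal.ofReal_ne_top ha
      rwa [ENNReal.toReal_ofReal hC0.le] at this
    simp only [f, min_eq_left h1]
    rw [ENNReal.ofReal_toReal (ha.trans_lt ENNReal.ofReal_lt_top).ne]
  -- The solution of ε f + (1 - ε) r = 1; it is nonnegative because ε C ≤ 1/2.
  let r : α → ℝ := fun a => (1 - ε * f a) / (1 - ε)
  have hrm : Measurable r := by fun_prop
  have hr0 : ∀ a, 0 ≤ r a := fun a => by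
    have : ε * f a ≤ ε * C := mul_le_mul_of_nonneg_left (hfC a) hε.le
    exact div_nonneg (by linarith) (by linarith)
  let ξ := π.withDensity fun a => ENNReal.ofReal (r a)
  have hmix : ENNReal.ofReal ε • Q + ENNReal.ofReal (1 - ε) • ξ = π := by
    rw [hQf, ← withDensity_smul _ (by fun_prop), ← withDensity_smul _ (by fun_prop),
      ← withDensity_add_left (by fun_prop)]
    conv_rhs => rw [← withDensity_one (μ := π)]
    congr 1
    funext a
    simp only [Pi.add_apply, Pi.smul_apply, smul_eq_mul, Pi.one_apply]
    rw [← ENNReal.ofReal_mul hε.le, ← ENNReal.ofReal_mul (by linarith), ← ENNReal.ofReal_add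
      (mul_nonneg hε.le (hf0 a)) (mul_nonneg (by linarith) (hr0 a)), ← ENNReal.ofReal_one]
    congr 1
    have : (1 - ε) ≠ 0 := by linarith
    simp only [r]
    field_simp
    ring
  -- The total mass m is read off from the mixture identity, ε + (1 - ε) m = 1.
  have hξ : IsProbabilityMeasure ξ := by
    constructor
    have h1 := congrArg (fun m : Measure α => m Set.univ) hmix
    simp only [Measure.add_apply, Measure.smul_apply, measure_univ, smul_eq_mul, mul_one] at h1
    have hpos : ENNReal.ofReal (1 - ε) ≠ 0 := by simp; linarith
    have hx : ξ Set.univ ≠ ∞ := by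
      intro h
      rw [h, ENNReal.mul_top hpos] at h1
      simp at h1
    have h2 := congrArg ENNReal.toReal h1
    rw [ENNReal.toReal_add (by simp) (ENNReal.mul_ne_top (by simp) hx), ENNReal.toReal_mul,
      ENNReal.toReal_ofReal hε.le, ENNReal.toReal_ofReal (by linarith), ENNReal.toReal_one] at h2
    have h3 : (ξ Set.univ).toReal = 1 := by
      have : (1 - ε) * ((ξ Set.univ).toReal - 1) = 0 := by linarith
      rcases mul_eq_zero.mp this with h | h <;> linarith
    rw [← ENNReal.ofReal_toReal hx, h3, ENNReal.ofReal_one]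
  refine ⟨ξ, hξ, ?_, hmix⟩
  rw [klDiv_withDensity π (by fun_prop)
    (by rw [← setLIntegral_univ, ← withDensity_apply _ MeasurableSet.univ]; exact measure_ne_top ξ _)]
  calc _ ≤ ∫⁻ _, ENNReal.ofReal (4 * ε ^ 2 * C ^ 2) ∂π := by
        refine lintegral_mono fun a => ENNReal.ofReal_le_ofReal ?_
        rw [ENNReal.toReal_ofReal (hr0 a)]
        refine (klFun_le_sub_one_sq (hr0 a)).trans ?_
        have h1 : (1 - ε) ≠ 0 := by linarith
        have h2 : r a - 1 = ε * (1 - f a) / (1 - ε) := by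
          simp only [r]; field_simp; ring
        -- Here |1 - f| ≤ C, since 0 ≤ f ≤ C and C ≥ 1, and 1 - ε ≥ 1/2.
        have h3 : |r a - 1| ≤ 2 * ε * C := by
          rw [h2, abs_div, abs_mul, abs_of_pos hε, abs_of_pos (show 0 < 1 - ε by linarith),
            div_le_iff₀ (by linarith)]
          have h4 : |1 - f a| ≤ C := abs_le.mpr ⟨by linarith [hfC a], by linarith [hf0 a]⟩
          have h5 : ε * |1 - f a| ≤ ε * C := mul_le_mul_of_nonneg_left h4 hε.le
          nlinarith [mul_pos hε hC0]
        calc (r a - 1) ^ 2 = |r a - 1| ^ 2 := (sq_abs _).symm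
          _ ≤ (2 * ε * C) ^ 2 := by gcongr
          _ = _ := by ring
    _ = _ := by simp

end Bounded

/-! ### Embedding a law as a rare event of a source with the prescribed input law. -/

section Mixing

variable {𝒱 𝒳 : Type u} [MeasurableSpace 𝒱] [StandardBorelSpace 𝒱] [Nonempty 𝒱]
  [MeasurableSpace 𝒳] [StandardBorelSpace 𝒳] [Nonempty 𝒳]

lemma relInfo_dirac_prod {𝒲 𝒳 : Type*} [MeasurableSpace 𝒲] [MeasurableSpace 𝒳] (w : 𝒲)
    (Q π : Measure 𝒳) [IsProbabilityMeasure Q] [IsProbabilityMeasure π] :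
    relInfo ((Measure.dirac w).prod Q) π = klDiv Q π := by
  rw [relInfo, Measure.fst_prod, Measure.dirac_prod, Measure.dirac_prod]
  exact klDiv_map_of_leftInverse Q π (by fun_prop) measurable_snd (fun _ => rfl)

lemma info_dirac_prod {𝒲 𝒳 𝒴 : Type*} [MeasurableSpace 𝒲] [MeasurableSpace 𝒳] [MeasurableSpace 𝒴]
    (w : 𝒲) (Q π : Measure 𝒳) [IsProbabilityMeasure Q] [IsProbabilityMeasure π] (K : Kernel 𝒳 𝒴)
    [IsMarkovKernel K] : info π K ((Measure.dirac w).prod Q) = outDiv π K Q := by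
  rw [info, through_prod, relInfo_dirac_prod, outDiv]

/-- The law on a two-point space with weights `ε` and `1 - ε`. -/
noncomputable def coin (ε : ℝ) : Measure (ULift.{u} Bool) :=
  ENNReal.ofReal ε • Measure.dirac ⟨true⟩ + ENNReal.ofReal (1 - ε) • Measure.dirac ⟨false⟩

lemma isProbabilityMeasure_coin {ε : ℝ} (h0 : 0 ≤ ε) (h1 : ε ≤ 1) :
    IsProbabilityMeasure (coin.{u} ε) := by
  constructor
  simp [coin, ← ENNReal.ofReal_add h0 (sub_nonneg.mpr h1)]

lemma lintegral_coin (ε : ℝ) (f : ULift.{u} Bool → ℝ≥0∞) :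
    ∫⁻ u, f u ∂(coin ε) = ENNReal.ofReal ε * f ⟨true⟩ + ENNReal.ofReal (1 - ε) * f ⟨false⟩ := by
  simp [coin]

lemma integral_coin {ε : ℝ} (h0 : 0 ≤ ε) (h1 : ε ≤ 1) (f : ULift.{u} Bool → ℝ) :
    ∫ u, f u ∂(coin ε) = ε * f ⟨true⟩ + (1 - ε) * f ⟨false⟩ := by
  rw [coin, integral_add_measure (integrable_dirac (by simp) |>.smul_measure (by simp))
    (integrable_dirac (by simp) |>.smul_measure (by simp)), integral_smul_measure,
    integral_smul_measure, integral_dirac, integral_dirac, ENNReal.toReal_ofReal h0,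
    ENNReal.toReal_ofReal (sub_nonneg.mpr h1)]
  simp

/-- A law of `(V, X)` whose second marginal has a bounded density with respect to `π` is the
conditional law, given an event of small probability, of a law for which `X` has law `π`. -/
lemma exists_source_mixture {π : Measure 𝒳} [IsProbabilityMeasure π] {M : Measure (𝒱 × 𝒳)}
    [IsProbabilityMeasure M] (hM : relInfo M π ≠ ∞) {C : ℝ} (hC : 1 ≤ C)
    (hMC : M.snd ≤ ENNReal.ofReal C • π) {ε : ℝ} (hε : 0 < ε) (hεC : 2 * ε * C ≤ 1) :
    ∃ (ξ : Measure 𝒳) (_ : IsProbabilityMeasure ξ) (N : Measure ((ULift.{u} Bool × 𝒱) × 𝒳))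
      (_ : IsProbabilityMeasure N), klDiv ξ π ≤ ENNReal.ofReal (4 * ε ^ 2 * C ^ 2) ∧
      N.snd = π ∧ relInfo N π ≠ ∞ ∧
      ∀ {𝒴 : Type u} [MeasurableSpace 𝒴] [StandardBorelSpace 𝒴] (K : Kernel 𝒳 𝒴)
        [IsMarkovKernel K],
        info π K N = ε * info π K M + (1 - ε) * outDiv π K ξ ∧
        info π K (N.map fun p => (p.1.1, p.2)) = ε * outDiv π K M.snd + (1 - ε) * outDiv π K ξ := by
  have hε1 : ε ≤ 1 := by nlinarith
  obtain ⟨ξ, _, hξ, hmix⟩ := exists_mixture hC hMC hε hεC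
  have := isProbabilityMeasure_coin.{u} hε.le hε1
  -- The coin is the variable U: heads gives the law M, tails an input from ξ with V frozen at v.
  -- Frozen V carries no information, so on tails only the output divergence of ξ remains.
  let v : 𝒱 := Classical.arbitrary 𝒱
  let η : Kernel (ULift.{u} Bool) (𝒱 × 𝒳) :=
    Kernel.ofFunOfCountable fun b => if b.down then M else (Measure.dirac v).prod ξ
  have hηt : η ⟨true⟩ = M := rfl
  have hηf : η ⟨false⟩ = (Measure.dirac v).prod ξ := rfl
  have : IsMarkovKernel η := by
    constructor
    rintro ⟨b⟩
    cases b
    · rw [hηf]; infer_instance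
    · rw [hηt]; infer_instance
  have hfin : relInfo (glue (coin ε) η) π ≠ ∞ := by
    rw [relInfo_glue, lintegral_coin, hηt, hηf, relInfo_dirac_prod]
    refine ENNReal.add_ne_top.mpr ⟨ENNReal.mul_ne_top (by simp) hM,
      ENNReal.mul_ne_top (by simp) (hξ.trans_lt ENNReal.ofReal_lt_top).ne⟩
  refine ⟨ξ, inferInstance, glue (coin ε) η, inferInstance, hξ, ?_, hfin, ?_⟩
  · refine Measure.ext_of_lintegral _ fun f hf => ?_
    rw [Measure.snd, lintegral_map hf measurable_snd, lintegral_glue _ _ (by fun_prop),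
      lintegral_coin, hηt, hηf]
    conv_rhs => rw [← hmix]
    rw [lintegral_add_measure, lintegral_smul_measure, lintegral_smul_measure, Measure.snd,
      lintegral_map hf measurable_snd, lintegral_prod _ (by fun_prop)]
    simp
  · intro 𝒴 _ _ K _
    constructor
    · rw [(integral_info_glue (K := K) hfin).2, integral_coin hε.le hε1, hηt, hηf, info_dirac_prod]
    · have hU := relInfo_map_fst_ne_top hfin
      rw [glue_map_fst] at hU ⊢
      rw [(integral_outDiv_compProd (K := K) hU).2, integral_coin hε.le hε1, Kernel.snd_apply,
        Kernel.snd_apply, hηt, hηf, ← Measure.snd, ← Measure.snd, Measure.snd_prod]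

end Mixing

/-! ### Approximation by laws with bounded density. -/

section Truncation

variable {𝒱 𝒳 : Type u} [MeasurableSpace 𝒱] [StandardBorelSpace 𝒱] [Nonempty 𝒱]
  [MeasurableSpace 𝒳] [StandardBorelSpace 𝒳] [Nonempty 𝒳]

/-- The chain rule with an arbitrary reference law for W; it separates the divergence of the
W-marginal from `relInfo`. -/
lemma klDiv_prod_eq_add_relInfo {𝒲 𝒴 : Type*} [MeasurableSpace 𝒲] [MeasurableSpace 𝒴]
    [StandardBorelSpace 𝒴] [Nonempty 𝒴] (N : Measure (𝒲 × 𝒴)) [IsProbabilityMeasure N]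
    (σ : Measure 𝒲) [IsProbabilityMeasure σ] (ρ : Measure 𝒴) [IsProbabilityMeasure ρ] :
    klDiv N (σ.prod ρ) = klDiv N.fst σ + relInfo N ρ := by
  rw [relInfo, ← Measure.compProd_const, ← Measure.compProd_const]
  conv_lhs => rw [← N.disintegrate N.condKernel, klDiv_compProd_eq_add]
  rw [N.disintegrate]

/-- Truncation of the density: a law with finite `relInfo` is a limit of laws with bounded density. -/
lemma exists_truncation {π : Measure 𝒳} [IsProbabilityMeasure π] {M : Measure (𝒱 × 𝒳)}
    [IsProbabilityMeasure M] (hM : relInfo M π ≠ ∞) :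
    ∃ (N : ℕ → Measure (𝒱 × 𝒳)) (_ : ∀ n, IsProbabilityMeasure (N n)) (C : ℕ → ℝ),
      (∀ n, 1 ≤ C n) ∧ (∀ n, (N n).snd ≤ ENNReal.ofReal (C n) • π) ∧
      (∀ n, relInfo (N n) π ≠ ∞) ∧
      ∀ {𝒴 : Type u} [MeasurableSpace 𝒴] [StandardBorelSpace 𝒴] [Nonempty 𝒴] (K : Kernel 𝒳 𝒴)
        [IsMarkovKernel K],
        Tendsto (fun n => info π K (N n)) atTop (𝓝 (info π K M)) ∧
        Tendsto (fun n => outDiv π K (N n).snd) atTop (𝓝 (outDiv π K M.snd)) := by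
  let S : Measure (𝒱 × 𝒳) := M.fst.prod π
  let f := M.rnDeriv S
  have hfm : Measurable f := Measure.measurable_rnDeriv M S
  have hMf : S.withDensity f = M := Measure.withDensity_rnDeriv_eq M S (klDiv_ne_top_iff.mp hM).1
  have hfi : ∫⁻ a, f a ∂S ≠ ∞ := Measure.lintegral_rnDeriv_lt_top M S |>.ne
  have hftop : ∀ᵐ a ∂S, f a < ∞ := Measure.rnDeriv_lt_top M S
  let A : ℕ → Set (𝒱 × 𝒳) := fun n => {a | f a ≤ n}
  have hA : ∀ n, MeasurableSet (A n) := fun n => measurableSet_le hfm measurable_const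
  have hAmono : Monotone A := fun m n hmn a (ha : f a ≤ m) =>
    ha.trans (by exact_mod_cast hmn)
  have hAev : ∀ a, f a < ∞ → ∀ᶠ n in atTop, a ∈ A n := by
    intro a ha
    obtain ⟨m, hm⟩ := ENNReal.exists_nat_gt ha.ne
    filter_upwards [eventually_ge_atTop m] with n hn
    exact hAmono hn hm.le
  have hp : Tendsto (fun n => M (A n)) atTop (𝓝 1) := by
    have h1 := tendsto_measure_iUnion_atTop (μ := M) hAmono
    have h2 : M (⋃ n, A n) = 1 := by
      rw [prob_compl_eq_zero_iff (MeasurableSet.iUnion hA) |>.symm]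
      refine (klDiv_ne_top_iff.mp hM).1 (measure_mono_null ?_ (ae_iff.mp hftop))
      intro a ha ha'
      exact ha (Set.mem_iUnion.mpr (hAev a ha').exists)
    rwa [h2] at h1
  -- From n₀ on the event where the density is at most n has probability at least 1/2, so
  -- conditioning on it multiplies densities by at most 2.
  obtain ⟨n₀, hn₀⟩ : ∃ n₀, ∀ n, n₀ ≤ n → 2⁻¹ ≤ M (A n) :=
    eventually_atTop.mp (hp.eventually (eventually_ge_nhds (by simp)))
  have hinv : ∀ n, (M (A (n + n₀)))⁻¹ ≤ 2 := fun n => by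
    rw [← inv_inv (2 : ℝ≥0∞)]
    exact ENNReal.inv_le_inv.mpr (hn₀ _ (Nat.le_add_left _ _))
  have hpos : ∀ n, M (A (n + n₀)) ≠ 0 := fun n h => by
    have := hn₀ _ (Nat.le_add_left n₀ n)
    simp [h] at this
  -- The density of M conditioned on the event that its density is at most n + n₀.
  let g : ℕ → 𝒱 × 𝒳 → ℝ≥0∞ := fun n a => (M (A (n + n₀)))⁻¹ * (A (n + n₀)).indicator f a
  have hgm : ∀ n, Measurable (g n) := fun n => (hfm.indicator (hA _)).const_mul _
  let N : ℕ → Measure (𝒱 × 𝒳) := fun n => S.withDensity (g n)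
  have hNcond : ∀ n, N n = M[|A (n + n₀)] := by
    intro n
    change S.withDensity ((M (A (n + n₀)))⁻¹ • (A (n + n₀)).indicator f) = _
    rw [withDensity_smul _ (hfm.indicator (hA _)), withDensity_indicator (hA _),
      ← restrict_withDensity (hA _), hMf, ProbabilityTheory.cond]
  have hN : ∀ n, IsProbabilityMeasure (N n) := fun n => by
    rw [hNcond]; exact cond_isProbabilityMeasure (hpos n)
  let C : ℕ → ℝ := fun n => 2 * (n + n₀ : ℕ) + 1
  have hNC : ∀ n, N n ≤ ENNReal.ofReal (C n) • S := by
    intro n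
    rw [← withDensity_const]
    refine withDensity_mono (ae_of_all _ fun a => ?_)
    have h1 : (A (n + n₀)).indicator f a ≤ (n + n₀ : ℕ) := by
      by_cases ha : a ∈ A (n + n₀)
      · rw [Set.indicator_of_mem ha]; exact ha
      · simp [Set.indicator_of_notMem ha]
    calc g n a ≤ 2 * (n + n₀ : ℕ) := mul_le_mul' (hinv n) h1
      _ = ENNReal.ofReal (2 * (n + n₀ : ℕ)) := by
          rw [ENNReal.ofReal_mul (by norm_num), ENNReal.ofReal_natCast]; simp
      _ ≤ ENNReal.ofReal (C n) := ENNReal.ofReal_le_ofReal (by simp [C])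
  have hNfin : ∀ n, klDiv (N n) S ≠ ∞ := fun n =>
    klDiv_ne_top_of_le_smul ENNReal.ofReal_ne_top (hNC n)
  -- The densities are dominated by 2 f and converge to f almost everywhere, so divergences converge
  -- at the output of every channel acting on the pair.
  have hconv : ∀ {β : Type u} [MeasurableSpace β] (κ : Kernel (𝒱 × 𝒳) β)
      [IsMarkovKernel κ], Tendsto (fun n => (klDiv (κ ∘ₘ (N n)) (κ ∘ₘ S)).toReal) atTop
        (𝓝 (klDiv (κ ∘ₘ M) (κ ∘ₘ S)).toReal) := by
    intro β _ κ _
    have hfin : klDiv (S.withDensity f) S ≠ ∞ := by rw [hMf]; exact hM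
    have h := tendsto_klDiv_comp_withDensity S κ hfm hgm hfi (C := 2) (by norm_num)
      (fun n => ae_of_all _ fun a => ?_) ?_ hfin
    · rw [hMf] at h
      refine (ENNReal.tendsto_toReal ?_).comp h
      exact ((klDiv_comp_right_le M S κ).trans_lt hM.lt_top).ne
    · simp only [ENNReal.ofReal_ofNat]
      exact mul_le_mul' (hinv n) ((Set.indicator_le_self _ _ a).trans le_self_add)
    · filter_upwards [hftop] with a ha
      have h1 : Tendsto (fun n => (M (A (n + n₀)))⁻¹ * f a) atTop (𝓝 (1⁻¹ * f a)) :=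
        ENNReal.Tendsto.mul_const
          (tendsto_inv_iff.mpr ((tendsto_add_atTop_iff_nat n₀).mpr hp)) (by simp)
      rw [inv_one, one_mul] at h1
      refine h1.congr' ?_
      filter_upwards [(tendsto_add_atTop_nat n₀).eventually (hAev a ha)] with n hn
      simp only [g, Set.indicator_of_mem hn]
  have hNrel : ∀ n, relInfo (N n) π ≠ ∞ := fun n h => by
    have := hNfin n
    simp [S, klDiv_prod_eq_add_relInfo, h] at this
  refine ⟨N, hN, C, fun n => ?_, fun n => ?_, hNrel, ?_⟩
  · simp only [C]; linarith [Nat.cast_nonneg (α := ℝ) (n + n₀)]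
  · calc (N n).snd ≤ (ENNReal.ofReal (C n) • S).snd := Measure.map_mono (hNC n) measurable_snd
      _ = ENNReal.ofReal (C n) • π := by
        rw [Measure.snd, Measure.map_smul, ← Measure.snd, Measure.snd_prod]
  · intro 𝒴 _ _ _ K _
    constructor
    · have h1 := hconv (Kernel.id ∥ₖ K : Kernel (𝒱 × 𝒳) (𝒱 × 𝒴))
      -- `info` of the n-th law refers to its own V-marginal, whereas `hconv` refers to that of M.
      -- The discrepancy is the divergence of the two marginals, which tends to 0 by `hconv` for the
      -- projection.
      have h2 := hconv (Kernel.deterministic (Prod.fst : 𝒱 × 𝒳 → 𝒱) measurable_fst)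
      simp only [Measure.deterministic_comp_eq_map, ← through.eq_1, ← Measure.fst.eq_1] at h1 h2
      have hSK : through K S = M.fst.prod (K ∘ₘ π) := through_prod K M.fst π
      have hSf : S.fst = M.fst := Measure.fst_prod
      rw [hSf, klDiv_self, ENNReal.toReal_zero] at h2
      rw [hSK] at h1
      have h3 := h1.sub h2
      rw [sub_zero] at h3
      rw [info, relInfo, fst_through]
      refine h3.congr fun n => ?_
      have h4 : klDiv (N n).fst M.fst ≠ ∞ := by
        intro h
        have := hNfin n
        simp [S, klDiv_prod_eq_add_relInfo, h] at this
      rw [klDiv_prod_eq_add_relInfo, fst_through,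
        ENNReal.toReal_add h4 (relInfo_through_ne_top (hNrel n)), info]
      ring
    · have h1 := hconv (K ∘ₖ Kernel.deterministic (Prod.snd : 𝒱 × 𝒳 → 𝒳) measurable_snd)
      simp only [← Measure.comp_assoc, Measure.deterministic_comp_eq_map, ← Measure.snd.eq_1] at h1
      have hS : S.snd = π := Measure.snd_prod
      rw [hS] at h1
      exact h1

end Truncation

/-! ### The perturbation argument. -/

section Approximation

variable {𝒳 𝒴 𝒵 : Type u} [MeasurableSpace 𝒳] [StandardBorelSpace 𝒳] [Nonempty 𝒳]
  [MeasurableSpace 𝒴] [StandardBorelSpace 𝒴] [Nonempty 𝒴] [MeasurableSpace 𝒵]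
  [StandardBorelSpace 𝒵] [Nonempty 𝒵] {t : ℝ} {π : Measure 𝒳} [IsProbabilityMeasure π]
  {K : Kernel 𝒳 𝒴} [IsMarkovKernel K] {L : Kernel 𝒳 𝒵} [IsMarkovKernel L]

lemma le_of_forall_le_add_mul {a b c δ : ℝ} (hδ : 0 < δ) (h : ∀ ε, 0 < ε → ε ≤ δ → a ≤ b + ε * c) :
    a ≤ b := by
  have h1 : Tendsto (fun ε : ℝ => b + ε * c) (𝓝[>] 0) (𝓝 (b + 0 * c)) :=
    (tendsto_const_nhds.add (tendsto_id.mul_const c)).mono_left nhdsWithin_le_nhds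
  rw [zero_mul, add_zero] at h1
  refine ge_of_tendsto h1 ?_
  filter_upwards [Ioc_mem_nhdsGT hδ] with ε hε
  exact h ε hε.1 hε.2

/-- For the mixed source the numerator is exactly ε times the variational numerator, because the
ξ-terms for (U, V) and for U coincide. The denominator is ε times the variational one plus (1 - ε)
(D(ξ ‖ π) - D(Kξ ‖ Kπ)), which is O(ε²). Division by ε and ε → 0 settle bounded densities;
truncation settles the rest. -/
lemma SourceKeyBound.variationalBound (h : SourceKeyBound t π K L) (ht : 0 ≤ t) :
    VariationalBound t π K L := by
  intro 𝒱 _ _ _ M _ hM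
  obtain ⟨N, _, C, hC, hNC, hN, hlim⟩ := exists_truncation.{u} hM
  refine le_of_tendsto_of_tendsto'
    (((hlim K).1.sub (hlim L).1).sub ((hlim K).2.sub (hlim L).2))
    ((((hlim Kernel.id).1.sub (hlim L).1).sub ((hlim K).2.sub (hlim L).2)).const_mul t)
    fun n => ?_
  have hCn : 0 < C n := by linarith [hC n]
  -- The range of ε is the one allowed by the mixture, and the constant is t times the bound on D(ξ
  -- ‖ π) divided by ε².
  refine le_of_forall_le_add_mul (δ := 1 / (2 * C n)) (c := t * (4 * C n ^ 2)) (by positivity)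
    fun ε hε hε' => ?_
  have hεC : 2 * ε * C n ≤ 1 := by
    rw [le_div_iff₀ (by positivity)] at hε'
    linarith
  have hε1 : ε ≤ 1 := by nlinarith [hC n]
  obtain ⟨ξ, _, J, _, hξ, hJ, hJfin, hinfo⟩ := exists_source_mixture (hN n) (hC n) (hNC n) hε hεC
  have hkey := h _ _ J hJ hJfin
  have hξfin : klDiv ξ π ≠ ∞ := (hξ.trans_lt ENNReal.ofReal_lt_top).ne
  have h1 : outDiv π Kernel.id ξ ≤ 4 * ε ^ 2 * C n ^ 2 := by
    rw [outDiv_id]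
    exact ENNReal.toReal_le_of_le_ofReal (by positivity) hξ
  have h2 : 0 ≤ outDiv π K ξ := outDiv_nonneg
  simp only [excess, (hinfo K).1, (hinfo K).2, (hinfo L).1, (hinfo L).2, (hinfo Kernel.id).1]
    at hkey
  have h3 : (1 - ε) * (outDiv π Kernel.id ξ - outDiv π K ξ) ≤ 4 * ε ^ 2 * C n ^ 2 := by
    nlinarith [outDiv_nonneg (π := π) (K := Kernel.id) (Q := ξ)]
  have h4 := mul_le_mul_of_nonneg_left h3 ht
  refine le_of_mul_le_mul_left ?_ hε
  nlinarith

/-- The same perturbation with the coin as the only auxiliary variable: its information at an output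
is ε times the divergence of the test input plus 1 - ε times that of ξ. -/
lemma InfoBound.divergenceBound (h : InfoBound t π K L) (ht : 0 ≤ t) :
    DivergenceBound t π K L := by
  intro Q _ hQ
  let M : Measure (PUnit.{u + 1} × 𝒳) := (Measure.dirac PUnit.unit).prod Q
  have hM : relInfo M π ≠ ∞ := by rwa [relInfo_dirac_prod]
  have hMQ : M.snd = Q := Measure.snd_prod
  obtain ⟨N, _, C, hC, hNC, hN, hlim⟩ := exists_truncation.{u} hM
  rw [hMQ] at hlim
  refine le_of_tendsto_of_tendsto' ((hlim K).2.sub (hlim L).2)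
    (((hlim Kernel.id).2.sub (hlim L).2).const_mul t) fun n => ?_
  have hCn : 0 < C n := by linarith [hC n]
  -- Here ξ contributes an error on both sides of the inequality, hence the factor t + 1.
  refine le_of_forall_le_add_mul (δ := 1 / (2 * C n)) (c := (t + 1) * (4 * C n ^ 2)) (by positivity)
    fun ε hε hε' => ?_
  have hεC : 2 * ε * C n ≤ 1 := by
    rw [le_div_iff₀ (by positivity)] at hε'
    linarith
  have hε1 : ε ≤ 1 := by nlinarith [hC n]
  obtain ⟨ξ, _, J, _, hξ, hJ, hJfin, hinfo⟩ := exists_source_mixture (hN n) (hC n) (hNC n) hε hεC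
  have : IsProbabilityMeasure (J.map fun p => (p.1.1, p.2)) :=
    Measure.isProbabilityMeasure_map (by fun_prop)
  have hJ' : (J.map fun p => (p.1.1, p.2)).snd = π := by
    rw [← hJ, Measure.snd, Measure.map_map (by fun_prop) (by fun_prop)]
    rfl
  have hkey := h _ _ hJ' (relInfo_map_fst_ne_top hJfin)
  have hξfin : klDiv ξ π ≠ ∞ := (hξ.trans_lt ENNReal.ofReal_lt_top).ne
  have h1 : outDiv π Kernel.id ξ ≤ 4 * ε ^ 2 * C n ^ 2 := by
    rw [outDiv_id]
    exact ENNReal.toReal_le_of_le_ofReal (by positivity) hξ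
  have h2 : 0 ≤ outDiv π K ξ := outDiv_nonneg
  have h3 : 0 ≤ outDiv π L ξ := outDiv_nonneg
  have h4 : outDiv π L ξ ≤ outDiv π Kernel.id ξ := outDiv_le_outDiv_id hξfin
  simp only [excess, (hinfo K).2, (hinfo L).2, (hinfo Kernel.id).2] at hkey
  have h5 : (1 - ε) * (outDiv π Kernel.id ξ - outDiv π L ξ) ≤ 4 * ε ^ 2 * C n ^ 2 := by
    nlinarith
  have h6 := mul_le_mul_of_nonneg_left h5 ht
  have h7 : (1 - ε) * (outDiv π L ξ - outDiv π K ξ) ≤ 4 * ε ^ 2 * C n ^ 2 := by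
    nlinarith
  refine le_of_mul_le_mul_left ?_ hε
  nlinarith

end Approximation

/-! ### From suprema of ratios to linear inequalities. -/

section Suprema

lemma supOrZero_le_iff {S : Set ℝ} {t : ℝ} (ht : 0 ≤ t) :
    supOrZero S ≤ t ↔ ∀ r ∈ S, r ≤ t := by
  unfold supOrZero
  split_ifs with h
  · simp
  · rw [Set.not_nonempty_iff_eq_empty] at h
    simp [h, ht]

lemma supOrZero_nonneg {S : Set ℝ} (h : S.Nonempty → ∃ r ∈ S, 0 ≤ r) : 0 ≤ supOrZero S := by
  unfold supOrZero
  split_ifs with hS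
  · obtain ⟨r, hr, h0⟩ := h hS
    exact (EReal.coe_nonneg.mpr h0).trans (le_iSup₂_of_le r hr le_rfl)
  · exact le_rfl

/-- A nonnegative extended real is determined by the real upper bounds t ≥ 0 it admits, so
identities need only be checked as equivalences of bounds. -/
lemma eq_of_forall_real_le_iff {a b : EReal} (ha : 0 ≤ a) (hb : 0 ≤ b)
    (h : ∀ t : ℝ, 0 ≤ t → (a ≤ t ↔ b ≤ t)) : a = b := by
  refine le_antisymm ?_ ?_
  · refine EReal.le_of_forall_lt_iff_le.mp fun z hz => ?_
    exact (h z (by exact_mod_cast hb.trans hz.le)).mpr hz.le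
  · refine EReal.le_of_forall_lt_iff_le.mp fun z hz => ?_
    exact (h z (by exact_mod_cast ha.trans hz.le)).mp hz.le

/-- The hypothesis a ≤ b settles b = 0: then a ≤ 0, so excluding zero denominators loses nothing. -/
lemma le_mul_iff_div_le {a b t : ℝ} (hb : 0 ≤ b) (hab : a ≤ b) :
    a ≤ t * b ↔ (b ≠ 0 → a / b ≤ t) := by
  rcases hb.eq_or_lt with rfl | hb
  · simpa using hab
  · simp [hb.ne', div_le_iff₀ hb]

end Suprema

/-! ### Mutual and conditional information in terms of `relInfo`. -/

section RandomVariables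

variable {Ω 𝒜 ℬ 𝒞 : Type*} [MeasurableSpace Ω] [MeasurableSpace 𝒜] [MeasurableSpace ℬ]
  [MeasurableSpace 𝒞] {μ : Measure Ω} [IsProbabilityMeasure μ] {A : Ω → 𝒜} {B : Ω → ℬ} {C : Ω → 𝒞}

lemma mutualInfo_eq_relInfo (hB : Measurable B) :
    mutualInfo μ A B = relInfo (μ.map fun ω => (A ω, B ω)) (μ.map B) := by
  rw [mutualInfo, relInfo, Measure.fst_map_prodMk hB]

lemma mutualInfo_comm (hA : Measurable A) (hB : Measurable B) :
    mutualInfo μ A B = mutualInfo μ B A := by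
  have : IsProbabilityMeasure (μ.map A) := Measure.isProbabilityMeasure_map hA.aemeasurable
  have : IsProbabilityMeasure (μ.map B) := Measure.isProbabilityMeasure_map hB.aemeasurable
  have : IsProbabilityMeasure (μ.map fun ω => (A ω, B ω)) :=
    Measure.isProbabilityMeasure_map (hA.prodMk hB).aemeasurable
  rw [mutualInfo, ← klDiv_map_of_leftInverse _ _ measurable_swap measurable_swap Prod.swap_swap,
    Measure.prod_swap, Measure.map_map measurable_swap (hA.prodMk hB), mutualInfo]
  rfl

variable [StandardBorelSpace 𝒜] [Nonempty 𝒜] [StandardBorelSpace ℬ] [Nonempty ℬ]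

lemma condMutualInfo_comm (hA : Measurable A) (hB : Measurable B) (hC : Measurable C) :
    condMutualInfo μ A B C = condMutualInfo μ B A C := by
  have : IsProbabilityMeasure (μ.map C) := Measure.isProbabilityMeasure_map hC.aemeasurable
  have : IsProbabilityMeasure (μ.map fun ω => (C ω, (A ω, B ω))) :=
    Measure.isProbabilityMeasure_map (hC.prodMk (hA.prodMk hB)).aemeasurable
  rw [condMutualInfo, ← klDiv_map_of_leftInverse _ _ (g := Prod.map id Prod.swap)
    (h := Prod.map id Prod.swap) (by fun_prop) (by fun_prop) (fun _ => rfl),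
    Measure.map_map (by fun_prop) (hC.prodMk (hA.prodMk hB)), condMutualInfo]
  congr 1
  rw [← Measure.compProd_map measurable_swap, Kernel.map_prod_swap]

/-- The chain rule for the mutual information, with an arbitrary reference law. -/
lemma relInfo_eq_add_condMutualInfo (hA : Measurable A) (hB : Measurable B) (hC : Measurable C)
    (π : Measure ℬ) [IsProbabilityMeasure π] :
    relInfo (μ.map fun ω => ((C ω, A ω), B ω)) π
      = relInfo (μ.map fun ω => (C ω, B ω)) π + condMutualInfo μ A B C := by
  have : IsProbabilityMeasure (μ.map C) := Measure.isProbabilityMeasure_map hC.aemeasurable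
  have : IsProbabilityMeasure (μ.map fun ω => (C ω, B ω)) :=
    Measure.isProbabilityMeasure_map (hC.prodMk hB).aemeasurable
  have : IsProbabilityMeasure (μ.map fun ω => ((C ω, A ω), B ω)) :=
    Measure.isProbabilityMeasure_map ((hC.prodMk hA).prodMk hB).aemeasurable
  have hJ : Measurable fun ω => ((C ω, A ω), B ω) := (hC.prodMk hA).prodMk hB
  have h1 : (μ.map fun ω => ((C ω, A ω), B ω)).fst = μ.map fun ω => (C ω, A ω) :=
    Measure.fst_map_prodMk hB
  have h2 : (μ.map fun ω => (C ω, A ω)).fst = μ.map C := Measure.fst_map_prodMk hA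
  -- With P_{A|C} as the conditional law, the remainder in the chain rule is the conditional
  -- information with its coordinates reordered.
  rw [relInfo_pair _ π (condDistrib A C μ)
    (by rw [h1, h2, compProd_map_condDistrib hA.aemeasurable]),
    Measure.map_map (by fun_prop) hJ, Measure.map_map (by fun_prop) hJ]
  congr 1
  have h3 : IsProbabilityMeasure (μ.map fun ω => ((C ω, B ω), A ω)) :=
    Measure.isProbabilityMeasure_map ((hC.prodMk hB).prodMk hA).aemeasurable
  change klDiv (μ.map fun ω => ((C ω, B ω), A ω))
    ((μ.map fun ω => (C ω, B ω)) ⊗ₘ (condDistrib A C μ).comap Prod.fst measurable_fst) = _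
  rw [← klDiv_map_of_leftInverse _ _ (g := fun p : (𝒞 × ℬ) × 𝒜 => (p.1.1, (p.2, p.1.2)))
    (h := fun p : 𝒞 × (𝒜 × ℬ) => ((p.1, p.2.2), p.2.1)) (by fun_prop) (by fun_prop) (fun _ => rfl),
    Measure.map_map (by fun_prop) ((hC.prodMk hB).prodMk hA), condMutualInfo]
  congr 1
  rw [← compProd_map_condDistrib (X := C) hB.aemeasurable]
  refine Measure.ext_of_lintegral _ fun f hf => ?_
  rw [lintegral_map hf (by fun_prop), Measure.lintegral_compProd (by fun_prop),
    Measure.lintegral_compProd (by fun_prop), Measure.lintegral_compProd hf]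
  refine lintegral_congr fun c => ?_
  rw [Kernel.lintegral_prod _ _ _ (by fun_prop)]
  exact lintegral_lintegral_swap (μ := condDistrib B C μ c) (ν := condDistrib A C μ c)
    (f := fun b a => f (c, (a, b))) (by fun_prop)

end RandomVariables

/-! ### Markov chains as an input law followed by a channel. -/

section Channels

variable {𝒲 𝒳 𝒯 𝒮 : Type*} [MeasurableSpace 𝒲] [MeasurableSpace 𝒳] [MeasurableSpace 𝒯]
  [StandardBorelSpace 𝒯] [Nonempty 𝒯] [MeasurableSpace 𝒮]
  (P : Measure (𝒳 × 𝒯)) [IsProbabilityMeasure P] (κ : Kernel 𝒳 𝒲) [IsMarkovKernel κ]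

lemma lintegral_markov {f : (𝒳 × 𝒯) × 𝒲 → ℝ≥0∞} (hf : Measurable f) :
    ∫⁻ ω, f ω ∂(P ⊗ₘ κ.comap Prod.fst measurable_fst)
      = ∫⁻ x, ∫⁻ s, ∫⁻ w, f ((x, s), w) ∂κ x ∂P.condKernel x ∂P.fst := by
  conv_lhs => rw [← P.disintegrate P.condKernel]
  rw [Measure.lintegral_compProd hf, Measure.lintegral_compProd (by fun_prop)]
  rfl

lemma markov_map_input :
    (P ⊗ₘ κ.comap Prod.fst measurable_fst).map (fun ω => (ω.2, ω.1.1))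
      = (P.fst ⊗ₘ κ).map Prod.swap := by
  refine Measure.ext_of_lintegral _ fun f hf => ?_
  rw [lintegral_map hf (by fun_prop), lintegral_markov _ _ (by fun_prop),
    lintegral_map hf measurable_swap, Measure.lintegral_compProd (by fun_prop)]
  simp

lemma markov_map_output {g : 𝒯 → 𝒮} (hg : Measurable g) :
    (P ⊗ₘ κ.comap Prod.fst measurable_fst).map (fun ω => (ω.2, g ω.1.2))
      = through (P.condKernel.map g) ((P.fst ⊗ₘ κ).map Prod.swap) := by
  refine Measure.ext_of_lintegral _ fun f hf => ?_
  rw [lintegral_map hf (by fun_prop), lintegral_markov _ _ (by fun_prop),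
    lintegral_through _ _ hf, lintegral_map (by fun_prop) measurable_swap,
    Measure.lintegral_compProd (by fun_prop)]
  refine lintegral_congr fun x => ?_
  rw [lintegral_lintegral_swap (Measurable.aemeasurable (by fun_prop))]
  refine lintegral_congr fun w => ?_
  simp only [Prod.swap_prod_mk]
  rw [Kernel.lintegral_map _ hg _ (by fun_prop)]

/-- Conditioning on X recovers P_{W|X}, so suprema over auxiliary kernels become suprema over joint
laws of (W, X). -/
lemma exists_markov_kernel [StandardBorelSpace 𝒲] [Nonempty 𝒲] {M : Measure (𝒲 × 𝒳)}
    [IsProbabilityMeasure M] :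
    ∃ (κ : Kernel 𝒳 𝒲) (_ : IsMarkovKernel κ), M = (M.snd ⊗ₘ κ).map Prod.swap := by
  have : IsProbabilityMeasure (M.map Prod.swap) :=
    Measure.isProbabilityMeasure_map measurable_swap.aemeasurable
  refine ⟨(M.map Prod.swap).condKernel, inferInstance, ?_⟩
  have h : (M.map Prod.swap).fst = M.snd := by
    rw [Measure.fst, Measure.map_map measurable_fst measurable_swap]; rfl
  rw [← h, Measure.disintegrate, Measure.map_map measurable_swap measurable_swap]
  simp

lemma snd_eq_condKernel_comp {g : 𝒯 → 𝒮} (hg : Measurable g) :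
    P.map (fun ω => g ω.2) = (P.condKernel.map g) ∘ₘ P.fst := by
  have h : P.map (fun ω => g ω.2) = P.snd.map g := by
    rw [Measure.snd, Measure.map_map hg measurable_snd]; rfl
  rw [h, ← Measure.map_comp _ _ hg, ← Measure.snd_compProd, P.disintegrate]

end Channels

/-! ### The ratios of the key constant as ratios of `excess`. -/

section Key

variable {𝒳 𝒴 𝒵 : Type u}
  [MeasurableSpace 𝒳] [StandardBorelSpace 𝒳] [Nonempty 𝒳]
  [MeasurableSpace 𝒴] [StandardBorelSpace 𝒴] [Nonempty 𝒴]
  [MeasurableSpace 𝒵] [StandardBorelSpace 𝒵] [Nonempty 𝒵]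
  (P : Measure (𝒳 × 𝒴 × 𝒵)) [IsProbabilityMeasure P]

/-- The channel `P_{Y|X}`. -/
noncomputable def chanY : Kernel 𝒳 𝒴 := P.condKernel.map Prod.fst

/-- The channel `P_{Z|X}`. -/
noncomputable def chanZ : Kernel 𝒳 𝒵 := P.condKernel.map Prod.snd

instance : IsMarkovKernel (chanY P) := Kernel.IsMarkovKernel.map _ measurable_fst

instance : IsMarkovKernel (chanZ P) := Kernel.IsMarkovKernel.map _ measurable_snd

instance : IsProbabilityMeasure (lawX P) := Measure.isProbabilityMeasure_map (by fun_prop)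

lemma lawY_eq : lawY P = chanY P ∘ₘ lawX P := snd_eq_condKernel_comp P measurable_fst

lemma lawZ_eq : lawZ P = chanZ P ∘ₘ lawX P := snd_eq_condKernel_comp P measurable_snd

lemma lawXY_eq : lawXY P = lawX P ⊗ₘ chanY P := by
  rw [chanY, Measure.compProd_map measurable_fst]
  change _ = (P.fst ⊗ₘ P.condKernel).map _
  rw [P.disintegrate]
  rfl

lemma lawXZ_eq : lawXZ P = lawX P ⊗ₘ chanZ P := by
  rw [chanZ, Measure.compProd_map measurable_snd]
  change _ = (P.fst ⊗ₘ P.condKernel).map _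
  rw [P.disintegrate]
  rfl

section Excess

variable {𝒰 𝒱 : Type*} [MeasurableSpace 𝒰] [MeasurableSpace 𝒱] [StandardBorelSpace 𝒱] [Nonempty 𝒱]
  {π : Measure 𝒳} [IsProbabilityMeasure π]
  {K : Kernel 𝒳 𝒴} [IsMarkovKernel K] {L : Kernel 𝒳 𝒵} [IsMarkovKernel L]

/-- Nonnegativity of the denominator. Dropping V can only reduce the information lost from X to Z,
by `relInfo_through_add_le`; replacing X by Y for U then reduces the excess further. -/
lemma excess_map_fst_le {M : Measure ((𝒰 × 𝒱) × 𝒳)} [IsProbabilityMeasure M]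
    (hM : relInfo M π ≠ ∞) :
    excess π K L (M.map fun p => (p.1.1, p.2)) ≤ excess π Kernel.id L M := by
  have : IsProbabilityMeasure (M.map fun p => (p.1.1, p.2)) :=
    Measure.isProbabilityMeasure_map (by fun_prop)
  have hU := relInfo_map_fst_ne_top hM
  have h1 := relInfo_through_add_le M π L
  have h2 := info_le_info_id (K := K) hU
  have h3 := ENNReal.toReal_mono (ENNReal.add_ne_top.mpr ⟨hM, relInfo_through_ne_top hU⟩) h1
  rw [ENNReal.toReal_add (relInfo_through_ne_top hM) hU,
    ENNReal.toReal_add hM (relInfo_through_ne_top hU)] at h3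
  rw [info_id] at h2
  simp only [excess, info_id]
  simp only [info] at *
  linarith

lemma excess_le_excess_id {𝒲 : Type*} [MeasurableSpace 𝒲] {M : Measure (𝒲 × 𝒳)}
    [IsProbabilityMeasure M] (hM : relInfo M π ≠ ∞) :
    excess π K L M ≤ excess π Kernel.id L M :=
  sub_le_sub_right (info_le_info_id hM) _

lemma info_map_left_of_leftInverse {𝒲 𝒲' : Type*} [MeasurableSpace 𝒲] [MeasurableSpace 𝒲']
    (M : Measure (𝒲 × 𝒳)) [IsProbabilityMeasure M] {f : 𝒲 → 𝒲'} (hf : Measurable f) {g : 𝒲' → 𝒲}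
    (hg : Measurable g) (hgf : Function.LeftInverse g f) :
    info π K (M.map (Prod.map f id)) = info π K M := by
  rw [info, through_map_left K M hf, relInfo_map_left_of_leftInverse _ _ hf hg hgf, info]

end Excess

/-- The informations of a Markov chain `(U, V) - X - (Y, Z)` in terms of `relInfo`. -/
lemma relInfo_markov {𝒰 𝒱 𝒯 : Type*} [MeasurableSpace 𝒰] [MeasurableSpace 𝒱]
    [StandardBorelSpace 𝒱] [Nonempty 𝒱] [MeasurableSpace 𝒯] [StandardBorelSpace 𝒯] [Nonempty 𝒯]
    {Ω : Type*} [MeasurableSpace Ω] {μ : Measure Ω} [IsProbabilityMeasure μ] {U : Ω → 𝒰} {V : Ω → 𝒱}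
    {T : Ω → 𝒯} (hU : Measurable U) (hV : Measurable V) (hT : Measurable T)
    {N : Measure ((𝒰 × 𝒱) × 𝒯)} (hN : μ.map (fun ω => ((U ω, V ω), T ω)) = N) :
    relInfo N N.snd = mutualInfo μ U T + condMutualInfo μ V T U ∧
    relInfo (N.map fun p => (p.1.1, p.2)) N.snd = mutualInfo μ U T := by
  have : IsProbabilityMeasure (μ.map T) := Measure.isProbabilityMeasure_map hT.aemeasurable
  have h1 : N.snd = μ.map T := by
    rw [← hN, Measure.snd_map_prodMk (hU.prodMk hV)]
  have h2 : N.map (fun p => (p.1.1, p.2)) = μ.map fun ω => (U ω, T ω) := by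
    rw [← hN, Measure.map_map (by fun_prop) ((hU.prodMk hV).prodMk hT)]
    rfl
  rw [h1, h2, ← hN, relInfo_eq_add_condMutualInfo hV hT hU, mutualInfo_eq_relInfo hT]
  exact ⟨rfl, rfl⟩

lemma snd_map_swap_compProd {𝒲 : Type*} [MeasurableSpace 𝒲] (κ : Kernel 𝒳 𝒲) [IsMarkovKernel κ]
    (π : Measure 𝒳) [IsProbabilityMeasure π] : ((π ⊗ₘ κ).map Prod.swap).snd = π := by
  rw [Measure.snd, Measure.map_map (by fun_prop) (by fun_prop)]
  exact Measure.fst_compProd _ _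

/-- For T = X, Y, Z the chain rule gives `relInfo` as I(U;T) + I(V;T|U), and the reference
divergence vanishes because the source law is kept. Data processing from X to Y and Z reduces all
finiteness conditions to one; I(U;Z) cancels from both differences. -/
lemma info_markov_iff {𝒰 𝒱 : Type u} [MeasurableSpace 𝒰] [MeasurableSpace 𝒱]
    [StandardBorelSpace 𝒱] [Nonempty 𝒱] (κ : Kernel 𝒳 (𝒰 × 𝒱)) [IsMarkovKernel κ] :
    let M : Measure ((𝒰 × 𝒱) × 𝒳) := (lawX P ⊗ₘ κ).map Prod.swap
    let μ : Measure ((𝒳 × 𝒴 × 𝒵) × (𝒰 × 𝒱)) := P ⊗ₘ (κ.comap Prod.fst measurable_fst)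
    let X : (𝒳 × 𝒴 × 𝒵) × (𝒰 × 𝒱) → 𝒳 := fun ω => ω.1.1
    let Y : (𝒳 × 𝒴 × 𝒵) × (𝒰 × 𝒱) → 𝒴 := fun ω => ω.1.2.1
    let Z : (𝒳 × 𝒴 × 𝒵) × (𝒰 × 𝒱) → 𝒵 := fun ω => ω.1.2.2
    let U : (𝒳 × 𝒴 × 𝒵) × (𝒰 × 𝒱) → 𝒰 := fun ω => ω.2.1
    let V : (𝒳 × 𝒴 × 𝒵) × (𝒰 × 𝒱) → 𝒱 := fun ω => ω.2.2
    (relInfo M (lawX P) ≠ ∞ ↔ condMutualInfo μ V X U ≠ ∞ ∧ condMutualInfo μ V Y U ≠ ∞ ∧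
      condMutualInfo μ V Z U ≠ ∞ ∧ mutualInfo μ U X ≠ ∞ ∧ mutualInfo μ U Y ≠ ∞) ∧
    (relInfo M (lawX P) ≠ ∞ →
      excess (lawX P) (chanY P) (chanZ P) M
          - excess (lawX P) (chanY P) (chanZ P) (M.map fun p => (p.1.1, p.2))
        = (condMutualInfo μ V Y U).toReal - (condMutualInfo μ V Z U).toReal ∧
      excess (lawX P) Kernel.id (chanZ P) M
          - excess (lawX P) (chanY P) (chanZ P) (M.map fun p => (p.1.1, p.2))
        = (condMutualInfo μ V X U).toReal - (condMutualInfo μ V Z U).toReal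
          + (mutualInfo μ U X).toReal - (mutualInfo μ U Y).toReal) := by
  intro M μ X Y Z U V
  have hMp : IsProbabilityMeasure M := Measure.isProbabilityMeasure_map (by fun_prop)
  have hMs : M.snd = lawX P := snd_map_swap_compProd κ (lawX P)
  obtain ⟨hX, hXU⟩ := relInfo_markov (U := U) (V := V) (T := X) (μ := μ)
    (by fun_prop) (by fun_prop) (by fun_prop) (markov_map_input P κ)
  obtain ⟨hY, hYU⟩ := relInfo_markov (U := U) (V := V) (T := Y) (μ := μ)
    (by fun_prop) (by fun_prop) (by fun_prop) (markov_map_output P κ measurable_fst)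
  obtain ⟨hZ, hZU⟩ := relInfo_markov (U := U) (V := V) (T := Z) (μ := μ)
    (by fun_prop) (by fun_prop) (by fun_prop) (markov_map_output P κ measurable_snd)
  change relInfo M M.snd = _ at hX
  change relInfo (M.map fun p => (p.1.1, p.2)) M.snd = _ at hXU
  change relInfo (through (chanY P) M) (through (chanY P) M).snd = _ at hY
  change relInfo (through (chanZ P) M) (through (chanZ P) M).snd = _ at hZ
  change relInfo ((through (chanY P) M).map fun p => (p.1.1, p.2)) (through (chanY P) M).snd = _
    at hYU
  change relInfo ((through (chanZ P) M).map fun p => (p.1.1, p.2)) (through (chanZ P) M).snd = _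
    at hZU
  have eY := through_map_left (chanY P) M (f := Prod.fst) measurable_fst
  have eZ := through_map_left (chanZ P) M (f := Prod.fst) measurable_fst
  change through (chanY P) (M.map fun p => (p.1.1, p.2))
    = (through (chanY P) M).map fun p => (p.1.1, p.2) at eY
  change through (chanZ P) (M.map fun p => (p.1.1, p.2))
    = (through (chanZ P) M).map fun p => (p.1.1, p.2) at eZ
  rw [hMs] at hX hXU
  rw [snd_through, hMs] at hY hZ
  rw [snd_through, hMs, ← eY] at hYU
  rw [snd_through, hMs, ← eZ] at hZU
  have hYX := relInfo_through_le M (lawX P) (chanY P)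
  have hZX := relInfo_through_le M (lawX P) (chanZ P)
  rw [hX, hY] at hYX
  rw [hX, hZ] at hZX
  have hfin : relInfo M (lawX P) ≠ ∞ → condMutualInfo μ V X U ≠ ∞ ∧ condMutualInfo μ V Y U ≠ ∞ ∧
      condMutualInfo μ V Z U ≠ ∞ ∧ mutualInfo μ U X ≠ ∞ ∧ mutualInfo μ U Y ≠ ∞ := by
    intro h
    rw [hX] at h
    have h1 := ENNReal.add_ne_top.mp h
    have h2 := ENNReal.add_ne_top.mp (hYX.trans_lt h.lt_top).ne
    have h3 := ENNReal.add_ne_top.mp (hZX.trans_lt h.lt_top).ne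
    exact ⟨h1.2, h2.2, h3.2, h1.1, h2.1⟩
  refine ⟨⟨hfin, fun h => by rw [hX]; exact ENNReal.add_ne_top.mpr ⟨h.2.2.2.1, h.1⟩⟩, fun h => ?_⟩
  obtain ⟨h1, h2, h3, h4, h5⟩ := hfin h
  rw [hX] at h
  have h6 := (ENNReal.add_ne_top.mp (hZX.trans_lt h.lt_top).ne).1
  simp only [excess, info_id]
  simp only [info, hX, hY, hZ, hYU, hZU]
  rw [ENNReal.toReal_add h4 h1, ENNReal.toReal_add h5 h2, ENNReal.toReal_add h6 h3]
  constructor <;> ring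

lemma mem_keyRatios_iff {r : ℝ} :
    r ∈ keyRatios P ↔ ∃ (𝒰 𝒱 : Type u)
      (_ : MeasurableSpace 𝒰) (_ : StandardBorelSpace 𝒰) (_ : Nonempty 𝒰)
      (_ : MeasurableSpace 𝒱) (_ : StandardBorelSpace 𝒱) (_ : Nonempty 𝒱)
      (M : Measure ((𝒰 × 𝒱) × 𝒳)) (_ : IsProbabilityMeasure M),
      M.snd = lawX P ∧ relInfo M (lawX P) ≠ ∞ ∧
      excess (lawX P) Kernel.id (chanZ P) M
        - excess (lawX P) (chanY P) (chanZ P) (M.map fun p => (p.1.1, p.2)) ≠ 0 ∧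
      r = (excess (lawX P) (chanY P) (chanZ P) M
          - excess (lawX P) (chanY P) (chanZ P) (M.map fun p => (p.1.1, p.2)))
        / (excess (lawX P) Kernel.id (chanZ P) M
          - excess (lawX P) (chanY P) (chanZ P) (M.map fun p => (p.1.1, p.2))) := by
  constructor
  · rintro ⟨𝒰, 𝒱, _, _, _, _, _, _, κ, _, h1, h2, h3, h4, h5, h6, h7⟩
    obtain ⟨hiff, heq⟩ := info_markov_iff P κ
    have hfin := hiff.mpr ⟨h1, h2, h3, h4, h5⟩
    obtain ⟨e1, e2⟩ := heq hfin
    refine ⟨𝒰, 𝒱, inferInstance, inferInstance, inferInstance, inferInstance, inferInstance,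
      inferInstance, _, Measure.isProbabilityMeasure_map (by fun_prop), snd_map_swap_compProd _ _,
      hfin, ?_, ?_⟩
    · rw [e2]; exact h6
    · rw [e1, e2]; exact h7
  · rintro ⟨𝒰, 𝒱, _, _, _, _, _, _, M, _, hMs, hfin, h6, h7⟩
    obtain ⟨κ, _, hκ⟩ := exists_markov_kernel (M := M)
    rw [hMs] at hκ
    subst hκ
    obtain ⟨hiff, heq⟩ := info_markov_iff P κ
    obtain ⟨h1, h2, h3, h4, h5⟩ := hiff.mp hfin
    obtain ⟨e1, e2⟩ := heq hfin
    rw [e2] at h6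
    rw [e1, e2] at h7
    exact ⟨𝒰, 𝒱, inferInstance, inferInstance, inferInstance, inferInstance, inferInstance,
      inferInstance, κ, inferInstance, h1, h2, h3, h4, h5, h6, h7⟩

lemma sStarZ_le_iff_source {t : ℝ} (ht : 0 ≤ t) :
    sStarZ P ≤ t ↔ SourceKeyBound t (lawX P) (chanY P) (chanZ P) := by
  rw [sStarZ, supOrZero_le_iff ht]
  constructor
  · intro h 𝒰 𝒱 _ _ _ _ _ _ M _ hMs hM
    rw [le_mul_iff_div_le (sub_nonneg.mpr (excess_map_fst_le hM))
      (sub_le_sub_right (excess_le_excess_id hM) _)]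
    exact fun hne => h _ ((mem_keyRatios_iff P).mpr ⟨𝒰, 𝒱, inferInstance, inferInstance,
      inferInstance, inferInstance, inferInstance, inferInstance, M, inferInstance, hMs, hM, hne,
      rfl⟩)
  · intro h r hr
    obtain ⟨𝒰, 𝒱, _, _, _, _, _, _, M, _, hMs, hM, hne, rfl⟩ := (mem_keyRatios_iff P).mp hr
    exact (le_mul_iff_div_le (sub_nonneg.mpr (excess_map_fst_le hM))
      (sub_le_sub_right (excess_le_excess_id hM) _)).mp (h 𝒰 𝒱 M hMs hM) hne

lemma sStarZ_le_iff_key {t : ℝ} (ht : 0 ≤ t) :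
    sStarZ P ≤ t ↔ KeyBound t (lawX P) (chanY P) (chanZ P) := by
  rw [sStarZ_le_iff_source P ht]
  exact ⟨fun h => (h.variationalBound ht).keyBound, fun h => h.source⟩

lemma sStarZ_le_iff_variational {t : ℝ} (ht : 0 ≤ t) :
    sStarZ P ≤ t ↔ VariationalBound t (lawX P) (chanY P) (chanZ P) := by
  rw [sStarZ_le_iff_source P ht]
  exact ⟨fun h => h.variationalBound ht, fun h => h.keyBound.source⟩

/-- Once some ratio exists, the choice U := (U, V) with V trivial has numerator 0 and denominator
I(UV;X) - I(UV;Y). If that denominator vanishes, the original numerator and denominator agree and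
the original ratio is 1. -/
lemma sStarZ_nonneg : 0 ≤ sStarZ P := by
  refine supOrZero_nonneg ?_
  rintro ⟨r, hr⟩
  obtain ⟨𝒰, 𝒱, _, _, _, _, _, _, M, _, hMs, hM, hne, hr'⟩ := (mem_keyRatios_iff P).mp hr
  by_cases h : info (lawX P) Kernel.id M = info (lawX P) (chanY P) M
  · refine ⟨r, hr, ?_⟩
    have e : excess (lawX P) (chanY P) (chanZ P) M = excess (lawX P) Kernel.id (chanZ P) M := by
      rw [excess, excess, h]
    rw [hr', e, div_self hne]
    exact zero_le_one
  · let f : 𝒰 × 𝒱 → (𝒰 × 𝒱) × PUnit.{u + 1} := fun w => (w, PUnit.unit)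
    have hf : Measurable f := by fun_prop
    let N := M.map (Prod.map f id)
    have hN : IsProbabilityMeasure N := Measure.isProbabilityMeasure_map (by fun_prop)
    have hNU : (N.map fun p => (p.1.1, p.2)) = M := by
      rw [Measure.map_map (by fun_prop) (by fun_prop)]
      exact Measure.map_id
    have hinfo : ∀ {𝒯 : Type u} [MeasurableSpace 𝒯] [StandardBorelSpace 𝒯] [Nonempty 𝒯]
        (K : Kernel 𝒳 𝒯) [IsMarkovKernel K], info (lawX P) K N = info (lawX P) K M := fun K _ =>
      info_map_left_of_leftInverse M hf measurable_fst (fun _ => rfl)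
    refine ⟨0, (mem_keyRatios_iff P).mpr ⟨𝒰 × 𝒱, PUnit, inferInstance, inferInstance,
      inferInstance, inferInstance, inferInstance, inferInstance, N, hN, ?_, ?_, ?_, ?_⟩, le_rfl⟩
    · rw [← hMs, Measure.snd, Measure.map_map (by fun_prop) (by fun_prop)]
      rfl
    · rwa [relInfo_map_left_of_leftInverse M _ hf measurable_fst (fun _ => rfl)]
    · simp only [hNU, excess, hinfo]
      intro h'
      apply h
      linarith
    · simp only [hNU, excess, hinfo]
      simp

lemma sStarZ_le_one : sStarZ P ≤ 1 := by
  refine (sStarZ_le_iff_source P (t := 1) zero_le_one).mpr fun 𝒰 𝒱 _ _ _ _ _ _ M _ hMs hM => ?_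
  rw [one_mul]
  exact sub_le_sub_right (excess_le_excess_id hM) _

end Key

/-! ### The variational formula. -/

section Variational

/-- The chain rule with the two coordinates exchanged; the first summand is the mutual information.
-/
lemma relInfo_eq_add_klDiv_snd {𝒲 𝒯 : Type*} [MeasurableSpace 𝒲] [StandardBorelSpace 𝒲] [Nonempty 𝒲]
    [MeasurableSpace 𝒯] (N : Measure (𝒲 × 𝒯)) [IsProbabilityMeasure N] (ρ : Measure 𝒯)
    [IsProbabilityMeasure ρ] :
    relInfo N ρ = klDiv N (N.fst.prod N.snd) + klDiv N.snd ρ := by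
  have : IsProbabilityMeasure (N.map Prod.swap) :=
    Measure.isProbabilityMeasure_map measurable_swap.aemeasurable
  have h1 : (N.map Prod.swap).fst = N.snd := by
    rw [Measure.fst, Measure.map_map measurable_fst measurable_swap]; rfl
  have h := klDiv_prod_eq_add_relInfo (N.map Prod.swap) ρ N.fst
  rw [h1, ← Measure.prod_swap, klDiv_map_of_leftInverse _ _ measurable_swap measurable_swap
    Prod.swap_swap] at h
  rw [relInfo, h, relInfo, h1, ← Measure.prod_swap, klDiv_map_of_leftInverse _ _ measurable_swap
    measurable_swap Prod.swap_swap, add_comm]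

variable {𝒳 𝒴 𝒵 : Type u}
  [MeasurableSpace 𝒳] [StandardBorelSpace 𝒳] [Nonempty 𝒳]
  [MeasurableSpace 𝒴] [StandardBorelSpace 𝒴] [Nonempty 𝒴]
  [MeasurableSpace 𝒵] [StandardBorelSpace 𝒵] [Nonempty 𝒵]

/-- The case of `excess_map_fst_le` in which U lives on one point: informations of U then become
output divergences. -/
lemma divExcess_snd_le_excess_id {𝒱 : Type u} [MeasurableSpace 𝒱] [StandardBorelSpace 𝒱]
    [Nonempty 𝒱] {π : Measure 𝒳} [IsProbabilityMeasure π]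
    {K : Kernel 𝒳 𝒴} [IsMarkovKernel K] {L : Kernel 𝒳 𝒵} [IsMarkovKernel L]
    {M : Measure (𝒱 × 𝒳)} [IsProbabilityMeasure M] (hM : relInfo M π ≠ ∞) :
    divExcess π K L M.snd ≤ excess π Kernel.id L M := by
  let f : 𝒱 → PUnit.{u + 1} × 𝒱 := fun v => (PUnit.unit, v)
  have hf : Measurable f := by fun_prop
  have : IsProbabilityMeasure (M.map (Prod.map f id)) :=
    Measure.isProbabilityMeasure_map (by fun_prop)
  have h := excess_map_fst_le (K := K) (L := L) (π := π) (M := M.map (Prod.map f id))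
    (by rwa [relInfo_map_left_of_leftInverse M π hf measurable_snd (fun _ => rfl)])
  have h1 : (M.map (Prod.map f id)).map (fun p => (p.1.1, p.2))
      = (Measure.dirac PUnit.unit).prod M.snd := by
    rw [Measure.dirac_prod, Measure.snd, Measure.map_map (by fun_prop) (by fun_prop),
      Measure.map_map (by fun_prop) (by fun_prop)]
    rfl
  simp only [excess] at h
  rw [h1, info_dirac_prod, info_dirac_prod,
    info_map_left_of_leftInverse M hf measurable_snd (fun _ => rfl),
    info_map_left_of_leftInverse M hf measurable_snd (fun _ => rfl)] at h
  exact h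

variable (P : Measure (𝒳 × 𝒴 × 𝒵)) [IsProbabilityMeasure P]

lemma map_compProd_condKernel {𝒱 𝒯 𝒮 : Type*} [MeasurableSpace 𝒱] [MeasurableSpace 𝒯]
    [MeasurableSpace 𝒮] (η : Kernel 𝒳 𝒯) [IsMarkovKernel η]
    (Q : Measure (𝒱 × 𝒳)) [IsProbabilityMeasure Q] {g : 𝒯 → 𝒮} (hg : Measurable g) :
    (Q ⊗ₘ η.comap Prod.snd measurable_snd).map (fun ω => (ω.1.1, g ω.2))
      = through (η.map g) Q := by
  refine Measure.ext_of_lintegral _ fun f hf => ?_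
  rw [lintegral_map hf (by fun_prop), Measure.lintegral_compProd (by fun_prop),
    lintegral_through _ _ hf]
  refine lintegral_congr fun p => ?_
  rw [Kernel.lintegral_map _ hg _ (by fun_prop)]
  rfl

/-- At X, Y and Z, `relInfo` is an information of V plus a divergence of outputs. The divergence of
Z cancels everywhere and that of Y cancels in the numerator, which leaves the stated terms. -/
lemma variational_iff {𝒱 : Type u} [MeasurableSpace 𝒱] [StandardBorelSpace 𝒱] [Nonempty 𝒱]
    (Q : Measure (𝒱 × 𝒳)) [IsProbabilityMeasure Q] :
    let μ : Measure ((𝒱 × 𝒳) × (𝒴 × 𝒵)) := Q ⊗ₘ (P.condKernel.comap Prod.snd measurable_snd)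
    let V : (𝒱 × 𝒳) × (𝒴 × 𝒵) → 𝒱 := fun ω => ω.1.1
    let X : (𝒱 × 𝒳) × (𝒴 × 𝒵) → 𝒳 := fun ω => ω.1.2
    let Y : (𝒱 × 𝒳) × (𝒴 × 𝒵) → 𝒴 := fun ω => ω.2.1
    let Z : (𝒱 × 𝒳) × (𝒴 × 𝒵) → 𝒵 := fun ω => ω.2.2
    (relInfo Q (lawX P) ≠ ∞ ↔ mutualInfo μ V X ≠ ∞ ∧ mutualInfo μ V Y ≠ ∞ ∧
      mutualInfo μ V Z ≠ ∞ ∧ klDiv (μ.map X) (lawX P) ≠ ∞ ∧ klDiv (μ.map Y) (lawY P) ≠ ∞) ∧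
    (relInfo Q (lawX P) ≠ ∞ →
      excess (lawX P) (chanY P) (chanZ P) Q - divExcess (lawX P) (chanY P) (chanZ P) Q.snd
        = (mutualInfo μ V Y).toReal - (mutualInfo μ V Z).toReal ∧
      excess (lawX P) Kernel.id (chanZ P) Q - divExcess (lawX P) (chanY P) (chanZ P) Q.snd
        = (mutualInfo μ V X).toReal - (mutualInfo μ V Z).toReal
          + (klDiv (μ.map X) (lawX P)).toReal - (klDiv (μ.map Y) (lawY P)).toReal) := by
  intro μ V X Y Z
  have hVX : μ.map (fun ω => (V ω, X ω)) = Q := Measure.fst_compProd _ _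
  have hVY : μ.map (fun ω => (V ω, Y ω)) = through (chanY P) Q :=
    map_compProd_condKernel P.condKernel Q measurable_fst
  have hVZ : μ.map (fun ω => (V ω, Z ω)) = through (chanZ P) Q :=
    map_compProd_condKernel P.condKernel Q measurable_snd
  have key : ∀ {𝒯 : Type u} [MeasurableSpace 𝒯] (T : (𝒱 × 𝒳) × (𝒴 × 𝒵) → 𝒯) (_ : Measurable T)
      (N : Measure (𝒱 × 𝒯)) [IsProbabilityMeasure N] (_ : μ.map (fun ω => (V ω, T ω)) = N)
      (ρ : Measure 𝒯) [IsProbabilityMeasure ρ],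
      N.snd = μ.map T ∧ relInfo N ρ = mutualInfo μ V T + klDiv (μ.map T) ρ := by
    intro 𝒯 _ T hT N _ hN ρ _
    have h1 : N.snd = μ.map T := by
      rw [← hN, Measure.snd_map_prodMk (by fun_prop)]
    refine ⟨h1, ?_⟩
    have h2 : N.fst = μ.map V := by
      rw [← hN, Measure.fst_map_prodMk hT]
    rw [relInfo_eq_add_klDiv_snd, h1, h2, mutualInfo, hN]
  obtain ⟨sX, rX⟩ := key X (by fun_prop) _ hVX (lawX P)
  obtain ⟨sY, rY⟩ := key Y (by fun_prop) _ hVY (chanY P ∘ₘ lawX P)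
  obtain ⟨sZ, rZ⟩ := key Z (by fun_prop) _ hVZ (chanZ P ∘ₘ lawX P)
  rw [snd_through] at sY sZ
  rw [lawY_eq]
  have hYX := relInfo_through_le Q (lawX P) (chanY P)
  have hZX := relInfo_through_le Q (lawX P) (chanZ P)
  rw [rX, rY] at hYX
  rw [rX, rZ] at hZX
  have hfin : relInfo Q (lawX P) ≠ ∞ → mutualInfo μ V X ≠ ∞ ∧ mutualInfo μ V Y ≠ ∞ ∧
      mutualInfo μ V Z ≠ ∞ ∧ klDiv (μ.map X) (lawX P) ≠ ∞ ∧
      klDiv (μ.map Y) (chanY P ∘ₘ lawX P) ≠ ∞ := by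
    intro h
    rw [rX] at h
    have h1 := ENNReal.add_ne_top.mp h
    have h2 := ENNReal.add_ne_top.mp (hYX.trans_lt h.lt_top).ne
    have h3 := ENNReal.add_ne_top.mp (hZX.trans_lt h.lt_top).ne
    exact ⟨h1.1, h2.1, h3.1, h1.2, h2.2⟩
  refine ⟨⟨hfin, fun h => by rw [rX]; exact ENNReal.add_ne_top.mpr ⟨h.1, h.2.2.2.1⟩⟩, fun h => ?_⟩
  obtain ⟨h1, h2, h3, h4, h5⟩ := hfin h
  rw [rX] at h
  have h6 := (ENNReal.add_ne_top.mp (hZX.trans_lt h.lt_top).ne).2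
  simp only [excess, divExcess, info_id]
  simp only [info, outDiv, rX, rY, rZ, sY, sZ]
  rw [ENNReal.toReal_add h1 h4, ENNReal.toReal_add h2 h5, ENNReal.toReal_add h3 h6]
  constructor <;> ring

lemma mem_variationalRatios_iff {r : ℝ} :
    r ∈ variationalRatios P ↔
      ∃ (𝒱 : Type u) (_ : MeasurableSpace 𝒱) (_ : StandardBorelSpace 𝒱) (_ : Nonempty 𝒱)
        (Q : Measure (𝒱 × 𝒳)) (_ : IsProbabilityMeasure Q),
      relInfo Q (lawX P) ≠ ∞ ∧
      excess (lawX P) Kernel.id (chanZ P) Q - divExcess (lawX P) (chanY P) (chanZ P) Q.snd ≠ 0 ∧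
      r = (excess (lawX P) (chanY P) (chanZ P) Q - divExcess (lawX P) (chanY P) (chanZ P) Q.snd)
        / (excess (lawX P) Kernel.id (chanZ P) Q
          - divExcess (lawX P) (chanY P) (chanZ P) Q.snd) := by
  constructor
  · rintro ⟨𝒱, _, _, _, Q, _, h1, h2, h3, h4, h5, h6, h7⟩
    obtain ⟨hiff, heq⟩ := variational_iff P Q
    have hfin := hiff.mpr ⟨h1, h2, h3, h4, h5⟩
    obtain ⟨e1, e2⟩ := heq hfin
    refine ⟨𝒱, inferInstance, inferInstance, inferInstance, Q, inferInstance, hfin, ?_, ?_⟩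
    · rw [e2]; exact h6
    · rw [e1, e2]; exact h7
  · rintro ⟨𝒱, _, _, _, Q, _, hfin, h6, h7⟩
    obtain ⟨hiff, heq⟩ := variational_iff P Q
    obtain ⟨h1, h2, h3, h4, h5⟩ := hiff.mp hfin
    obtain ⟨e1, e2⟩ := heq hfin
    rw [e2] at h6
    rw [e1, e2] at h7
    exact ⟨𝒱, inferInstance, inferInstance, inferInstance, Q, inferInstance, h1, h2, h3, h4, h5,
      h6, h7⟩

lemma supOrZero_variationalRatios_le_iff {t : ℝ} (ht : 0 ≤ t) :
    supOrZero (variationalRatios P) ≤ t ↔ VariationalBound t (lawX P) (chanY P) (chanZ P) := by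
  rw [supOrZero_le_iff ht]
  constructor
  · intro h 𝒱 _ _ _ M _ hM
    rw [le_mul_iff_div_le (sub_nonneg.mpr (divExcess_snd_le_excess_id hM))
      (sub_le_sub_right (excess_le_excess_id hM) _)]
    exact fun hne => h _ ((mem_variationalRatios_iff P).mpr ⟨𝒱, inferInstance, inferInstance,
      inferInstance, M, inferInstance, hM, hne, rfl⟩)
  · intro h r hr
    obtain ⟨𝒱, _, _, _, M, _, hM, hne, rfl⟩ := (mem_variationalRatios_iff P).mp hr
    exact (le_mul_iff_div_le (sub_nonneg.mpr (divExcess_snd_le_excess_id hM))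
      (sub_le_sub_right (excess_le_excess_id hM) _)).mp (h 𝒱 M hM) hne

lemma supOrZero_variationalRatios_nonneg : 0 ≤ supOrZero (variationalRatios P) := by
  refine supOrZero_nonneg ?_
  rintro ⟨r, hr⟩
  obtain ⟨𝒱, _, _, _, M, _, hM, hne, hr'⟩ := (mem_variationalRatios_iff P).mp hr
  by_cases h : info (lawX P) Kernel.id M = info (lawX P) (chanY P) M
  · refine ⟨r, hr, ?_⟩
    have e : excess (lawX P) (chanY P) (chanZ P) M = excess (lawX P) Kernel.id (chanZ P) M := by
      rw [excess, excess, h]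
    rw [hr', e, div_self hne]
    exact zero_le_one
  · obtain ⟨ν, _, ζ, _, rfl⟩ : ∃ (ν : Measure 𝒱) (_ : IsProbabilityMeasure ν) (ζ : Kernel 𝒱 𝒳)
        (_ : IsMarkovKernel ζ), M = ν ⊗ₘ ζ :=
      ⟨M.fst, inferInstance, M.condKernel, inferInstance, (M.disintegrate _).symm⟩
    -- A deterministic V gives numerator 0. If every fiber input had equal divergence at X and at Y,
    -- averaging over v would contradict the assumption that the two informations differ.
    obtain ⟨v, hv, hne'⟩ : ∃ v, klDiv (ζ v) (lawX P) ≠ ∞ ∧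
        outDiv (lawX P) Kernel.id (ζ v) ≠ outDiv (lawX P) (chanY P) (ζ v) := by
      by_contra! hcon
      apply h
      rw [(integral_outDiv_compProd (K := chanY P) hM).2,
        (integral_outDiv_compProd (K := Kernel.id) hM).2]
      rw [relInfo_compProd] at hM
      refine integral_congr_ae ?_
      filter_upwards [ae_lt_top (measurable_klDiv_kernel ζ (Kernel.const 𝒱 (lawX P))) hM] with v hv
      exact hcon v hv.ne
    refine ⟨0, (mem_variationalRatios_iff P).mpr ⟨PUnit, inferInstance, inferInstance,
      inferInstance, (Measure.dirac PUnit.unit).prod (ζ v), inferInstance, ?_, ?_, ?_⟩, le_rfl⟩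
    · rwa [relInfo_dirac_prod]
    · simp only [excess, info_dirac_prod, divExcess, Measure.snd_prod]
      intro h'
      apply hne'
      linarith
    · simp [excess, info_dirac_prod, divExcess]

lemma sStarZ_eq_supOrZero_variationalRatios : sStarZ P = supOrZero (variationalRatios P) :=
  eq_of_forall_real_le_iff (sStarZ_nonneg P) (supOrZero_variationalRatios_nonneg P) fun _ ht => by
    rw [sStarZ_le_iff_variational P ht, supOrZero_variationalRatios_le_iff P ht]

end Variational

/-! ### Two independent sources and the sum identity. -/

section TwoSources

variable {𝒲 𝒲' 𝒳₁ 𝒳₂ 𝒴₁ 𝒴₂ 𝒵₁ 𝒵₂ : Type*} [MeasurableSpace 𝒲] [MeasurableSpace 𝒲']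
  [MeasurableSpace 𝒳₁] [MeasurableSpace 𝒳₂]
  [MeasurableSpace 𝒴₁] [MeasurableSpace 𝒴₂] [MeasurableSpace 𝒵₁] [MeasurableSpace 𝒵₂]

/-- The law of `((W, Y₁), X₂)` when `(W, (X₁, X₂))` has law `M` and `Y₁` is the output of `K` for the
input `X₁`. -/
noncomputable def sideRight (K : Kernel 𝒳₁ 𝒴₁) (M : Measure (𝒲 × (𝒳₁ × 𝒳₂))) :
    Measure ((𝒲 × 𝒴₁) × 𝒳₂) :=
  (through (K ∥ₖ Kernel.id) M).map fun p => ((p.1, p.2.1), p.2.2)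

/-- The law of `((W, Y₂), X₁)` when `(W, (X₁, X₂))` has law `M` and `Y₂` is the output of `K` for the
input `X₂`. -/
noncomputable def sideLeft (K : Kernel 𝒳₂ 𝒴₂) (M : Measure (𝒲 × (𝒳₁ × 𝒳₂))) :
    Measure ((𝒲 × 𝒴₂) × 𝒳₁) :=
  (through (Kernel.id ∥ₖ K) M).map fun p => ((p.1, p.2.2), p.2.1)

variable (K₁ : Kernel 𝒳₁ 𝒴₁) [IsMarkovKernel K₁] (K₂ : Kernel 𝒳₂ 𝒴₂) [IsMarkovKernel K₂]
  (L₁ : Kernel 𝒳₁ 𝒵₁) [IsMarkovKernel L₁] (L₂ : Kernel 𝒳₂ 𝒵₂) [IsMarkovKernel L₂]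
  (π₁ : Measure 𝒳₁) [IsProbabilityMeasure π₁] (π₂ : Measure 𝒳₂) [IsProbabilityMeasure π₂]
  (M : Measure (𝒲 × (𝒳₁ × 𝒳₂))) [IsProbabilityMeasure M]

instance : IsProbabilityMeasure (sideRight K₁ M) :=
  Measure.isProbabilityMeasure_map (by fun_prop)

instance : IsProbabilityMeasure (sideLeft K₂ M) :=
  Measure.isProbabilityMeasure_map (by fun_prop)

lemma lintegral_sideRight {f : (𝒲 × 𝒴₁) × 𝒳₂ → ℝ≥0∞} (hf : Measurable f) :
    ∫⁻ q, f q ∂(sideRight K₁ M) = ∫⁻ p, ∫⁻ y, f ((p.1, y), p.2.2) ∂K₁ p.2.1 ∂M := by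
  rw [sideRight, lintegral_map hf (by fun_prop), lintegral_through _ _ (by fun_prop)]
  refine lintegral_congr fun p => ?_
  rw [Kernel.lintegral_parallelComp _ (by fun_prop)]
  refine lintegral_congr fun y => ?_
  rw [Kernel.id_apply, lintegral_dirac' _ (by fun_prop)]

lemma lintegral_sideLeft {f : (𝒲 × 𝒴₂) × 𝒳₁ → ℝ≥0∞} (hf : Measurable f) :
    ∫⁻ q, f q ∂(sideLeft K₂ M) = ∫⁻ p, ∫⁻ y, f ((p.1, y), p.2.1) ∂K₂ p.2.2 ∂M := by
  rw [sideLeft, lintegral_map hf (by fun_prop), lintegral_through _ _ (by fun_prop)]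
  refine lintegral_congr fun p => ?_
  rw [Kernel.lintegral_parallelComp_symm _ (by fun_prop)]
  refine lintegral_congr fun y => ?_
  rw [Kernel.id_apply, lintegral_dirac' _ (by fun_prop)]

lemma parallelComp_comp_prod_measure :
    (K₁ ∥ₖ K₂) ∘ₘ (π₁.prod π₂) = (K₁ ∘ₘ π₁).prod (K₂ ∘ₘ π₂) := by
  refine Measure.ext_of_lintegral _ fun f hf => ?_
  rw [Measure.lintegral_bind (by fun_prop) (by fun_prop),
    lintegral_prod _ (Measurable.aemeasurable (by fun_prop)),
    lintegral_prod _ hf.aemeasurable, Measure.lintegral_bind (by fun_prop) (by fun_prop)]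
  refine lintegral_congr fun x₁ => ?_
  simp_rw [Kernel.lintegral_parallelComp _ hf]
  rw [lintegral_lintegral_swap (Measurable.aemeasurable (by unfold Function.uncurry; fun_prop))]
  refine lintegral_congr fun y₁ => ?_
  rw [Measure.lintegral_bind (by fun_prop) (by fun_prop)]

/-- The chain rule in the order Y₁, Y₂; the first output becomes side information for the second
source. The companion lemma uses the opposite order. -/
lemma relInfo_parallel_right [StandardBorelSpace 𝒴₂] [Nonempty 𝒴₂] :
    relInfo (through (K₁ ∥ₖ K₂) M) ((K₁ ∥ₖ K₂) ∘ₘ (π₁.prod π₂))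
      = relInfo (through K₁ (M.map fun p => (p.1, p.2.1))) (K₁ ∘ₘ π₁)
        + relInfo (through K₂ (sideRight K₁ M)) (K₂ ∘ₘ π₂) := by
  rw [parallelComp_comp_prod_measure, relInfo_prod]
  congr 2
  · refine Measure.ext_of_lintegral _ fun f hf => ?_
    rw [lintegral_map hf (by fun_prop), lintegral_through _ _ (by fun_prop),
      lintegral_through _ _ hf, lintegral_map (by fun_prop) (by fun_prop)]
    refine lintegral_congr fun p => ?_
    rw [Kernel.lintegral_parallelComp _ (by fun_prop)]
    simp
  · refine Measure.ext_of_lintegral _ fun f hf => ?_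
    rw [lintegral_map hf (by fun_prop), lintegral_through _ _ (by fun_prop),
      lintegral_through _ _ hf, lintegral_sideRight _ _ (by fun_prop)]
    refine lintegral_congr fun p => ?_
    rw [Kernel.lintegral_parallelComp _ (by fun_prop)]

lemma relInfo_parallel_left [StandardBorelSpace 𝒴₁] [Nonempty 𝒴₁] :
    relInfo (through (K₁ ∥ₖ K₂) M) ((K₁ ∥ₖ K₂) ∘ₘ (π₁.prod π₂))
      = relInfo (through K₂ (M.map fun p => (p.1, p.2.2))) (K₂ ∘ₘ π₂)
        + relInfo (through K₁ (sideLeft K₂ M)) (K₁ ∘ₘ π₁) := by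
  rw [parallelComp_comp_prod_measure, relInfo_prod_swap]
  congr 2
  · refine Measure.ext_of_lintegral _ fun f hf => ?_
    rw [lintegral_map hf (by fun_prop), lintegral_through _ _ (by fun_prop),
      lintegral_through _ _ hf, lintegral_map (by fun_prop) (by fun_prop)]
    refine lintegral_congr fun p => ?_
    rw [Kernel.lintegral_parallelComp_symm _ (by fun_prop)]
    simp
  · refine Measure.ext_of_lintegral _ fun f hf => ?_
    rw [lintegral_map hf (by fun_prop), lintegral_through _ _ (by fun_prop),
      lintegral_through _ _ hf, lintegral_sideLeft _ _ (by fun_prop)]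
    refine lintegral_congr fun p => ?_
    rw [Kernel.lintegral_parallelComp_symm _ (by fun_prop)]

variable {K₁ K₂ L₁ L₂ π₁ π₂ M}

lemma info_parallel_right [StandardBorelSpace 𝒴₂] [Nonempty 𝒴₂]
    (hM : relInfo M (π₁.prod π₂) ≠ ∞) :
    info (π₁.prod π₂) (K₁ ∥ₖ K₂) M
      = info π₁ K₁ (M.map fun p => (p.1, p.2.1)) + info π₂ K₂ (sideRight K₁ M) := by
  have h := relInfo_through_ne_top (K := K₁ ∥ₖ K₂) hM
  rw [relInfo_parallel_right] at h
  rw [info, relInfo_parallel_right, ENNReal.toReal_add (ENNReal.add_ne_top.mp h).1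
    (ENNReal.add_ne_top.mp h).2]
  rfl

lemma info_parallel_left [StandardBorelSpace 𝒴₁] [Nonempty 𝒴₁]
    (hM : relInfo M (π₁.prod π₂) ≠ ∞) :
    info (π₁.prod π₂) (K₁ ∥ₖ K₂) M
      = info π₂ K₂ (M.map fun p => (p.1, p.2.2)) + info π₁ K₁ (sideLeft K₂ M) := by
  have h := relInfo_through_ne_top (K := K₁ ∥ₖ K₂) hM
  rw [relInfo_parallel_left] at h
  rw [info, relInfo_parallel_left, ENNReal.toReal_add (ENNReal.add_ne_top.mp h).1
    (ENNReal.add_ne_top.mp h).2]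
  rfl

/-- Csiszár's sum identity. -/
lemma excess_parallel [StandardBorelSpace 𝒴₁] [Nonempty 𝒴₁] [StandardBorelSpace 𝒴₂] [Nonempty 𝒴₂]
    [StandardBorelSpace 𝒵₁] [Nonempty 𝒵₁] [StandardBorelSpace 𝒵₂] [Nonempty 𝒵₂]
    (hM : relInfo M (π₁.prod π₂) ≠ ∞) :
    excess (π₁.prod π₂) (K₁ ∥ₖ K₂) (L₁ ∥ₖ L₂) M
      = excess π₁ K₁ L₁ (sideLeft L₂ M) + excess π₂ K₂ L₂ (sideRight K₁ M) := by
  -- The mixed channel K₁ ∥ L₂, expanded in both orders, is the term through which the two sides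
  -- telescope.
  have h1 := info_parallel_right (K₁ := K₁) (K₂ := L₂) hM
  rw [info_parallel_left hM] at h1
  simp only [excess]
  rw [info_parallel_right hM, info_parallel_left (K₁ := L₁) hM]
  linarith

lemma sideRight_eq_comp : sideRight K₁ M
    = ((Kernel.id ∥ₖ K₁ : Kernel (𝒲 × 𝒳₁) (𝒲 × 𝒴₁)) ∥ₖ Kernel.id) ∘ₘ sideRight Kernel.id M := by
  refine Measure.ext_of_lintegral _ fun f hf => ?_
  rw [lintegral_sideRight _ _ hf, lintegral_comp_left _ _ hf, lintegral_sideRight _ _ (by fun_prop)]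
  refine lintegral_congr fun p => ?_
  rw [Kernel.id_apply, lintegral_dirac' _ (by fun_prop),
    Kernel.lintegral_parallelComp _ (by fun_prop), Kernel.id_apply,
    lintegral_dirac' _ (by fun_prop)]

section

variable [StandardBorelSpace 𝒲] [Nonempty 𝒲] [StandardBorelSpace 𝒳₁] [Nonempty 𝒳₁]
  [StandardBorelSpace 𝒳₂] [Nonempty 𝒳₂]

lemma relInfo_sideRight_id_ne_top (hM : relInfo M (π₁.prod π₂) ≠ ∞) :
    relInfo (sideRight Kernel.id M) π₂ ≠ ∞ := by
  have h := relInfo_parallel_right Kernel.id Kernel.id π₁ π₂ M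
  rw [Kernel.id_parallelComp_id, through_id, through_id, through_id, Measure.id_comp,
    Measure.id_comp, Measure.id_comp] at h
  rw [h] at hM
  exact (ENNReal.add_ne_top.mp hM).2

lemma relInfo_sideRight_ne_top (hM : relInfo M (π₁.prod π₂) ≠ ∞) :
    relInfo (sideRight K₁ M) π₂ ≠ ∞ := by
  rw [sideRight_eq_comp]
  exact ((relInfo_comp_left_le _ _ _).trans_lt (relInfo_sideRight_id_ne_top hM).lt_top).ne

lemma relInfo_sideLeft_ne_top (hM : relInfo M (π₁.prod π₂) ≠ ∞) :
    relInfo (sideLeft K₂ M) π₁ ≠ ∞ := by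
  have h := relInfo_through_ne_top (K := Kernel.id ∥ₖ K₂) hM
  rw [relInfo_parallel_left, through_id, Measure.id_comp] at h
  exact (ENNReal.add_ne_top.mp h).2

/-- Side information Y₁ is obtained from side information X₁ by a channel, and processing the
auxiliary variable reduces the loss from X₂ to Z₂. -/
lemma excess_id_sideRight_le (hM : relInfo M (π₁.prod π₂) ≠ ∞) :
    excess π₂ Kernel.id L₂ (sideRight K₁ M) ≤ excess π₂ Kernel.id L₂ (sideRight Kernel.id M) := by
  have hR := relInfo_sideRight_id_ne_top hM
  have hR' := relInfo_sideRight_ne_top (K₁ := K₁) hM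
  have h := relInfo_through_comp_left_add_le (sideRight Kernel.id M) π₂ L₂
    (Kernel.id ∥ₖ K₁ : Kernel (𝒲 × 𝒳₁) (𝒲 × 𝒴₁))
  rw [← sideRight_eq_comp] at h
  have h' := ENNReal.toReal_mono (ENNReal.add_ne_top.mpr ⟨hR, relInfo_through_ne_top hR'⟩) h
  rw [ENNReal.toReal_add (relInfo_through_ne_top hR) hR',
    ENNReal.toReal_add hR (relInfo_through_ne_top hR')] at h'
  simp only [excess, info_id]
  simp only [info]
  linarith

/-- The sum identity for identity channels has X₁ itself as side information in the second term;
degrading it to Y₁ only lowers that term. This matches the side information in the numerators. -/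
lemma le_excess_id_parallel [StandardBorelSpace 𝒵₁] [Nonempty 𝒵₁] [StandardBorelSpace 𝒵₂]
    [Nonempty 𝒵₂] (hM : relInfo M (π₁.prod π₂) ≠ ∞) :
    excess π₁ Kernel.id L₁ (sideLeft L₂ M) + excess π₂ Kernel.id L₂ (sideRight K₁ M)
      ≤ excess (π₁.prod π₂) Kernel.id (L₁ ∥ₖ L₂) M := by
  have h := excess_parallel (K₁ := Kernel.id) (K₂ := Kernel.id) (L₁ := L₁) (L₂ := L₂) hM
  rw [Kernel.id_parallelComp_id] at h
  rw [h]
  exact add_le_add_right (excess_id_sideRight_le hM) _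

end

end TwoSources

/-! ### Bounds for a pair of sources and for its components. -/

section TwoSourceBound

variable {𝒳₁ 𝒳₂ 𝒴₁ 𝒴₂ 𝒵₁ 𝒵₂ : Type u}
  [MeasurableSpace 𝒳₁] [StandardBorelSpace 𝒳₁] [Nonempty 𝒳₁]
  [MeasurableSpace 𝒳₂] [StandardBorelSpace 𝒳₂] [Nonempty 𝒳₂]
  [MeasurableSpace 𝒴₁] [StandardBorelSpace 𝒴₁] [Nonempty 𝒴₁]
  [MeasurableSpace 𝒴₂] [StandardBorelSpace 𝒴₂] [Nonempty 𝒴₂]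
  [MeasurableSpace 𝒵₁] [StandardBorelSpace 𝒵₁] [Nonempty 𝒵₁]
  [MeasurableSpace 𝒵₂] [StandardBorelSpace 𝒵₂] [Nonempty 𝒵₂]
  {K₁ : Kernel 𝒳₁ 𝒴₁} [IsMarkovKernel K₁] {K₂ : Kernel 𝒳₂ 𝒴₂} [IsMarkovKernel K₂]
  {L₁ : Kernel 𝒳₁ 𝒵₁} [IsMarkovKernel L₁] {L₂ : Kernel 𝒳₂ 𝒵₂} [IsMarkovKernel L₂]
  {π₁ : Measure 𝒳₁} [IsProbabilityMeasure π₁] {π₂ : Measure 𝒳₂} [IsProbabilityMeasure π₂] {t : ℝ}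

/-- The side observation S becomes a part of U, the pair being regrouped as ((U, S), V). -/
lemma KeyBound.regroup {𝒳 𝒴 𝒵 𝒰 𝒱 𝒮 : Type u}
    [MeasurableSpace 𝒳] [StandardBorelSpace 𝒳] [Nonempty 𝒳]
    [MeasurableSpace 𝒴] [StandardBorelSpace 𝒴] [Nonempty 𝒴]
    [MeasurableSpace 𝒵] [StandardBorelSpace 𝒵] [Nonempty 𝒵]
    [MeasurableSpace 𝒰] [StandardBorelSpace 𝒰] [Nonempty 𝒰]
    [MeasurableSpace 𝒱] [StandardBorelSpace 𝒱] [Nonempty 𝒱]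
    [MeasurableSpace 𝒮] [StandardBorelSpace 𝒮] [Nonempty 𝒮]
    {K : Kernel 𝒳 𝒴} [IsMarkovKernel K] {L : Kernel 𝒳 𝒵} [IsMarkovKernel L]
    {π : Measure 𝒳} [IsProbabilityMeasure π] (h : KeyBound t π K L)
    {M : Measure (((𝒰 × 𝒱) × 𝒮) × 𝒳)} [IsProbabilityMeasure M] (hM : relInfo M π ≠ ∞) :
    excess π K L M - excess π K L (M.map fun p => ((p.1.1.1, p.1.2), p.2))
      ≤ t * (excess π Kernel.id L M
        - excess π K L (M.map fun p => ((p.1.1.1, p.1.2), p.2))) := by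
  let f : (𝒰 × 𝒱) × 𝒮 → (𝒰 × 𝒮) × 𝒱 := fun p => ((p.1.1, p.2), p.1.2)
  let g : (𝒰 × 𝒮) × 𝒱 → (𝒰 × 𝒱) × 𝒮 := fun p => ((p.1.1, p.2), p.1.2)
  have hf : Measurable f := by fun_prop
  have hg : Measurable g := by fun_prop
  have hgf : Function.LeftInverse g f := fun _ => rfl
  have : IsProbabilityMeasure (M.map (Prod.map f id)) :=
    Measure.isProbabilityMeasure_map (by fun_prop)
  have h1 := h (𝒰 × 𝒮) 𝒱 (M.map (Prod.map f id))
    (by rwa [relInfo_map_left_of_leftInverse M π hf hg hgf])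
  rw [Measure.map_map (by fun_prop) (by fun_prop)] at h1
  change excess π K L (M.map (Prod.map f id))
      - excess π K L (M.map fun p => ((p.1.1.1, p.1.2), p.2)) ≤ t * (excess π Kernel.id L
      (M.map (Prod.map f id)) - excess π K L (M.map fun p => ((p.1.1.1, p.1.2), p.2))) at h1
  have e : ∀ {𝒯 : Type u} [MeasurableSpace 𝒯] [StandardBorelSpace 𝒯] [Nonempty 𝒯] (H : Kernel 𝒳 𝒯)
      [IsMarkovKernel H], info π H (M.map (Prod.map f id)) = info π H M := fun H _ =>
    info_map_left_of_leftInverse M hf hg hgf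
  simp only [excess, e] at h1 ⊢
  exact h1

/-- The sum identity holds for (U, V) and for U with the same side channels, so numerators add up
exactly, while denominators are superadditive; the two component bounds are then summed. -/
lemma KeyBound.parallel (ht : 0 ≤ t) (h₁ : KeyBound t π₁ K₁ L₁) (h₂ : KeyBound t π₂ K₂ L₂) :
    KeyBound t (π₁.prod π₂) (K₁ ∥ₖ K₂) (L₁ ∥ₖ L₂) := by
  intro 𝒰 𝒱 _ _ _ _ _ _ M _ hM
  have : IsProbabilityMeasure (M.map fun p => (p.1.1, p.2)) :=
    Measure.isProbabilityMeasure_map (by fun_prop)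
  have hM' := relInfo_map_fst_ne_top hM
  have e₁ : sideLeft L₂ (M.map fun p => (p.1.1, p.2))
      = (sideLeft L₂ M).map fun p => ((p.1.1.1, p.1.2), p.2) := by
    refine Measure.ext_of_lintegral _ fun f hf => ?_
    rw [lintegral_sideLeft _ _ hf, lintegral_map hf (by fun_prop),
      lintegral_sideLeft _ _ (by fun_prop), lintegral_map (by fun_prop) (by fun_prop)]
  have e₂ : sideRight K₁ (M.map fun p => (p.1.1, p.2))
      = (sideRight K₁ M).map fun p => ((p.1.1.1, p.1.2), p.2) := by
    refine Measure.ext_of_lintegral _ fun f hf => ?_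
    rw [lintegral_sideRight _ _ hf, lintegral_map hf (by fun_prop),
      lintegral_sideRight _ _ (by fun_prop), lintegral_map (by fun_prop) (by fun_prop)]
  have b₁ := h₁.regroup (relInfo_sideLeft_ne_top (K₂ := L₂) hM)
  have b₂ := h₂.regroup (relInfo_sideRight_ne_top (K₁ := K₁) hM)
  have b₃ := mul_le_mul_of_nonneg_left
    (le_excess_id_parallel (K₁ := K₁) (L₁ := L₁) (L₂ := L₂) hM) ht
  rw [excess_parallel hM, excess_parallel hM', e₁, e₂]
  linarith

section Lift

variable {𝒲 𝒴 : Type u} [MeasurableSpace 𝒲] [MeasurableSpace 𝒴]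

/-- Adjoins to a law of `(W, X₁)` an independent `X₂` with law `π₂`. -/
noncomputable def liftLeft (π₂ : Measure 𝒳₂) (M : Measure (𝒲 × 𝒳₁)) :
    Measure (𝒲 × (𝒳₁ × 𝒳₂)) :=
  (M.prod π₂).map fun p => (p.1.1, (p.1.2, p.2))

instance (M : Measure (𝒲 × 𝒳₁)) [IsProbabilityMeasure M] : IsProbabilityMeasure (liftLeft π₂ M) :=
  Measure.isProbabilityMeasure_map (by fun_prop)

/-- In the chain rule the independent X₂ contributes the divergence of a product law from itself,
which is 0. -/
lemma relInfo_liftLeft (M : Measure (𝒲 × 𝒳₁)) [IsProbabilityMeasure M] :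
    relInfo (through (K₁ ∥ₖ K₂) (liftLeft π₂ M)) ((K₁ ∥ₖ K₂) ∘ₘ (π₁.prod π₂))
      = relInfo (through K₁ M) (K₁ ∘ₘ π₁) := by
  have h1 : (liftLeft π₂ M).map (fun p => (p.1, p.2.1)) = M := by
    rw [liftLeft, Measure.map_map (by fun_prop) (by fun_prop)]
    exact Measure.fst_prod
  have h2 : sideRight K₁ (liftLeft π₂ M) = (through K₁ M).prod π₂ := by
    refine Measure.ext_of_lintegral _ fun f hf => ?_
    rw [lintegral_sideRight _ _ hf, liftLeft, lintegral_map (by fun_prop) (by fun_prop),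
      lintegral_prod _ (Measurable.aemeasurable (by fun_prop)), lintegral_prod _ hf.aemeasurable,
      lintegral_through _ _ (by fun_prop)]
    refine lintegral_congr fun p => ?_
    exact lintegral_lintegral_swap (μ := π₂) (ν := K₁ p.2) (f := fun x y => f ((p.1, y), x))
      (by fun_prop)
  rw [relInfo_parallel_right, h1, h2, through_prod, relInfo, relInfo, Measure.fst_prod, klDiv_self,
    add_zero]

lemma KeyBound.of_parallel_left (h : KeyBound t (π₁.prod π₂) (K₁ ∥ₖ K₂) (L₁ ∥ₖ L₂)) :
    KeyBound t π₁ K₁ L₁ := by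
  intro 𝒰 𝒱 _ _ _ _ _ _ M _ hM
  have : IsProbabilityMeasure (M.map fun p => (p.1.1, p.2)) :=
    Measure.isProbabilityMeasure_map (by fun_prop)
  have e : (liftLeft π₂ M).map (fun p => (p.1.1, p.2)) = liftLeft π₂ (M.map fun p => (p.1.1, p.2)) := by
    refine Measure.ext_of_lintegral _ fun f hf => ?_
    rw [lintegral_map hf (by fun_prop), liftLeft, liftLeft, lintegral_map (by fun_prop) (by fun_prop),
      lintegral_map (by fun_prop) (by fun_prop),
      lintegral_prod _ (Measurable.aemeasurable (by fun_prop)),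
      lintegral_prod _ (Measurable.aemeasurable (by fun_prop)),
      lintegral_map (by fun_prop) (by fun_prop)]
  have e2 : ∀ {𝒲 : Type u} [MeasurableSpace 𝒲] (N : Measure (𝒲 × 𝒳₁)) [IsProbabilityMeasure N],
      relInfo (liftLeft π₂ N) (π₁.prod π₂) = relInfo N π₁ := by
    intro 𝒲 _ N _
    have := relInfo_liftLeft (K₁ := Kernel.id) (K₂ := Kernel.id) (π₁ := π₁) (π₂ := π₂) N
    rwa [Kernel.id_parallelComp_id, through_id, through_id, Measure.id_comp, Measure.id_comp] at this
  have b := h 𝒰 𝒱 (liftLeft π₂ M) (by rwa [e2])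
  rw [e] at b
  simp only [excess, info_id, e2] at b ⊢
  simpa only [info, relInfo_liftLeft] using b

end Lift

end TwoSourceBound

/-! ### Invariance under relabelling of the alphabets. -/

section Transport

variable {𝒳 𝒴 𝒵 𝒳' 𝒴' 𝒵' : Type u}
  [MeasurableSpace 𝒳] [StandardBorelSpace 𝒳] [Nonempty 𝒳]
  [MeasurableSpace 𝒴] [StandardBorelSpace 𝒴] [Nonempty 𝒴]
  [MeasurableSpace 𝒵] [StandardBorelSpace 𝒵] [Nonempty 𝒵]
  [MeasurableSpace 𝒳'] [StandardBorelSpace 𝒳'] [Nonempty 𝒳']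
  [MeasurableSpace 𝒴'] [StandardBorelSpace 𝒴'] [Nonempty 𝒴']
  [MeasurableSpace 𝒵'] [StandardBorelSpace 𝒵'] [Nonempty 𝒵']
  {π : Measure 𝒳} [IsProbabilityMeasure π] {π' : Measure 𝒳'} [IsProbabilityMeasure π']
  {K : Kernel 𝒳 𝒴} [IsMarkovKernel K] {K' : Kernel 𝒳' 𝒴'} [IsMarkovKernel K']
  {L : Kernel 𝒳 𝒵} [IsMarkovKernel L] {L' : Kernel 𝒳' 𝒵'} [IsMarkovKernel L']

lemma eq_map_of_compProd_eq_map {e : 𝒳 → 𝒳'} {e' : 𝒴 → 𝒴'} (he : Measurable e) (he' : Measurable e')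
    (hK : π' ⊗ₘ K' = (π ⊗ₘ K).map (Prod.map e e')) : π' = π.map e := by
  rw [← Measure.fst_compProd π' K', hK]
  conv_rhs => rw [← Measure.fst_compProd π K]
  rw [Measure.fst, Measure.fst, Measure.map_map (by fun_prop) (by fun_prop),
    Measure.map_map (by fun_prop) (by fun_prop)]
  rfl

/-- The joint laws determine the channels only almost everywhere; absolute continuity of the
X-marginal of M makes that enough, and isomorphisms preserve divergence. -/
lemma relInfo_transport (e : 𝒳 ≃ᵐ 𝒳') (e' : 𝒴 ≃ᵐ 𝒴')
    (hK : π' ⊗ₘ K' = (π ⊗ₘ K).map (Prod.map e e')) {𝒲 : Type*} [MeasurableSpace 𝒲]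
    (M : Measure (𝒲 × 𝒳)) [IsProbabilityMeasure M] (hM : M.snd ≪ π) :
    relInfo (through K' (M.map (Prod.map id e))) (K' ∘ₘ π') = relInfo (through K M) (K ∘ₘ π) := by
  have hπ : π' = π.map e := eq_map_of_compProd_eq_map e.measurable e'.measurable hK
  have hKπ : K' ∘ₘ π' = (K ∘ₘ π).map e' := by
    rw [← Measure.snd_compProd π' K', hK, ← Measure.snd_compProd π K, Measure.snd, Measure.snd,
      Measure.map_map (by fun_prop) (by fun_prop), Measure.map_map (by fun_prop) (by fun_prop)]
    rfl
  have hae : K'.comap e e.measurable =ᵐ[π] K.map e' := by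
    refine Kernel.ae_eq_of_compProd_eq ?_
    have h1 : (π' ⊗ₘ K').map (Prod.map e.symm id) = π ⊗ₘ K'.comap e e.measurable := by
      refine Measure.ext_of_lintegral _ fun f hf => ?_
      rw [lintegral_map hf (by fun_prop), Measure.lintegral_compProd (by fun_prop),
        Measure.lintegral_compProd hf, hπ, lintegral_map (by fun_prop) (by fun_prop)]
      simp
    rw [← h1, hK, Measure.map_map (by fun_prop) (by fun_prop), Measure.compProd_map e'.measurable]
    congr 1
    ext p <;> simp
  have h2 : through K' (M.map (Prod.map id e)) = (through K M).map (Prod.map id e') := by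
    have h3 : through K' (M.map (Prod.map id e)) = through (K'.comap e e.measurable) M := by
      refine Measure.ext_of_lintegral _ fun f hf => ?_
      rw [lintegral_through _ _ hf, lintegral_through _ _ hf,
        lintegral_map (by fun_prop) (by fun_prop)]
      rfl
    rw [h3, through_congr hae hM]
    refine Measure.ext_of_lintegral _ fun f hf => ?_
    rw [lintegral_through _ _ hf, lintegral_map hf (by fun_prop),
      lintegral_through _ _ (by fun_prop)]
    refine lintegral_congr fun p => ?_
    rw [Kernel.lintegral_map _ (by fun_prop) _ (by fun_prop)]
    rfl
  rw [h2, hKπ, relInfo_map_right_of_leftInverse _ _ e'.measurable e'.symm.measurable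
    e'.symm_apply_apply]

/-- The bound sees only the laws of (X, Y) and (X, Z), up to isomorphisms of the alphabets. This
serves to permute factors, to split off a coordinate, and to change the joint law of Y and Z. -/
lemma KeyBound.transport {t : ℝ} (h : KeyBound t π' K' L') (e : 𝒳 ≃ᵐ 𝒳') (eY : 𝒴 ≃ᵐ 𝒴')
    (eZ : 𝒵 ≃ᵐ 𝒵') (hK : π' ⊗ₘ K' = (π ⊗ₘ K).map (Prod.map e eY))
    (hL : π' ⊗ₘ L' = (π ⊗ₘ L).map (Prod.map e eZ)) : KeyBound t π K L := by
  intro 𝒰 𝒱 _ _ _ _ _ _ M _ hM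
  have : IsProbabilityMeasure (M.map fun p => (p.1.1, p.2)) :=
    Measure.isProbabilityMeasure_map (by fun_prop)
  have hM' := relInfo_map_fst_ne_top hM
  have hπ : π' = π.map e := eq_map_of_compProd_eq_map e.measurable eY.measurable hK
  have hI : relInfo (M.map (Prod.map id e)) π' = relInfo M π := by
    rw [hπ, relInfo_map_right_of_leftInverse _ _ e.measurable e.symm.measurable e.symm_apply_apply]
  have : IsProbabilityMeasure (M.map (Prod.map id e)) :=
    Measure.isProbabilityMeasure_map (by fun_prop)
  have b := h 𝒰 𝒱 (M.map (Prod.map id e)) (by rwa [hI])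
  have e1 : (M.map (Prod.map id e)).map (fun p => (p.1.1, p.2))
      = (M.map fun p => (p.1.1, p.2)).map (Prod.map id e) := by
    rw [Measure.map_map (by fun_prop) (by fun_prop), Measure.map_map (by fun_prop) (by fun_prop)]
    rfl
  have s1 := snd_absolutelyContinuous_of_relInfo_ne_top hM
  have s2 := snd_absolutelyContinuous_of_relInfo_ne_top hM'
  rw [e1] at b
  simp only [excess, info_id, hI] at b ⊢
  simpa only [info, relInfo_transport e eY hK _ s1,
    relInfo_transport e eZ hL _ s1, relInfo_transport e eY hK _ s2,
    relInfo_transport e eZ hL _ s2] using b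

end Transport

section TwoSourceIff

lemma prod_compProd_parallelComp {𝒳₁ 𝒳₂ 𝒴₁ 𝒴₂ : Type*} [MeasurableSpace 𝒳₁] [MeasurableSpace 𝒳₂]
    [MeasurableSpace 𝒴₁] [MeasurableSpace 𝒴₂] (π₁ : Measure 𝒳₁) [IsProbabilityMeasure π₁]
    (π₂ : Measure 𝒳₂) [IsProbabilityMeasure π₂] (K₁ : Kernel 𝒳₁ 𝒴₁) [IsMarkovKernel K₁]
    (K₂ : Kernel 𝒳₂ 𝒴₂) [IsMarkovKernel K₂] :
    (π₁.prod π₂) ⊗ₘ (K₁ ∥ₖ K₂)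
      = ((π₁ ⊗ₘ K₁).prod (π₂ ⊗ₘ K₂)).map fun p => ((p.1.1, p.2.1), (p.1.2, p.2.2)) := by
  refine Measure.ext_of_lintegral _ fun f hf => ?_
  rw [lintegral_map hf (by fun_prop), lintegral_prod _ (Measurable.aemeasurable (by fun_prop)),
    Measure.lintegral_compProd hf, lintegral_prod _ (Measurable.aemeasurable (by fun_prop)),
    Measure.lintegral_compProd (by fun_prop)]
  refine lintegral_congr fun x₁ => ?_
  have hpar : ∀ x₂, ∫⁻ y, f ((x₁, x₂), y) ∂(K₁ ∥ₖ K₂) (x₁, x₂)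
      = ∫⁻ y₁, ∫⁻ y₂, f ((x₁, x₂), (y₁, y₂)) ∂K₂ x₂ ∂K₁ x₁ := fun x₂ =>
    Kernel.lintegral_parallelComp (x₁, x₂) (by fun_prop)
  simp_rw [hpar]
  rw [lintegral_lintegral_swap (Measurable.aemeasurable (by unfold Function.uncurry; fun_prop))]
  refine lintegral_congr fun y₁ => ?_
  rw [Measure.lintegral_compProd (by fun_prop)]

variable {𝒳₁ 𝒳₂ 𝒴₁ 𝒴₂ 𝒵₁ 𝒵₂ : Type u}
  [MeasurableSpace 𝒳₁] [StandardBorelSpace 𝒳₁] [Nonempty 𝒳₁]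
  [MeasurableSpace 𝒳₂] [StandardBorelSpace 𝒳₂] [Nonempty 𝒳₂]
  [MeasurableSpace 𝒴₁] [StandardBorelSpace 𝒴₁] [Nonempty 𝒴₁]
  [MeasurableSpace 𝒴₂] [StandardBorelSpace 𝒴₂] [Nonempty 𝒴₂]
  [MeasurableSpace 𝒵₁] [StandardBorelSpace 𝒵₁] [Nonempty 𝒵₁]
  [MeasurableSpace 𝒵₂] [StandardBorelSpace 𝒵₂] [Nonempty 𝒵₂]
  {K₁ : Kernel 𝒳₁ 𝒴₁} [IsMarkovKernel K₁] {K₂ : Kernel 𝒳₂ 𝒴₂} [IsMarkovKernel K₂]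
  {L₁ : Kernel 𝒳₁ 𝒵₁} [IsMarkovKernel L₁] {L₂ : Kernel 𝒳₂ 𝒵₂} [IsMarkovKernel L₂]
  {π₁ : Measure 𝒳₁} [IsProbabilityMeasure π₁] {π₂ : Measure 𝒳₂} [IsProbabilityMeasure π₂] {t : ℝ}

lemma KeyBound.parallel_swap (h : KeyBound t (π₁.prod π₂) (K₁ ∥ₖ K₂) (L₁ ∥ₖ L₂)) :
    KeyBound t (π₂.prod π₁) (K₂ ∥ₖ K₁) (L₂ ∥ₖ L₁) := by
  refine h.transport MeasurableEquiv.prodComm MeasurableEquiv.prodComm MeasurableEquiv.prodComm ?_ ?_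
  all_goals
    rw [prod_compProd_parallelComp, prod_compProd_parallelComp,
      Measure.map_map (by fun_prop) (by fun_prop), ← Measure.prod_swap,
      Measure.map_map (by fun_prop) (by fun_prop)]
    rfl

lemma keyBound_parallel_iff (ht : 0 ≤ t) :
    KeyBound t (π₁.prod π₂) (K₁ ∥ₖ K₂) (L₁ ∥ₖ L₂)
      ↔ KeyBound t π₁ K₁ L₁ ∧ KeyBound t π₂ K₂ L₂ :=
  ⟨fun h => ⟨h.of_parallel_left, h.parallel_swap.of_parallel_left⟩, fun h => h.1.parallel ht h.2⟩

end TwoSourceIff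

/-! ### Tensorization for finitely many factors. -/

section FinitelyMany

lemma relInfo_eq_zero_of_unique {𝒲 𝒯 : Type*} [MeasurableSpace 𝒲] [MeasurableSpace 𝒯] [Unique 𝒯]
    (N : Measure (𝒲 × 𝒯)) [IsProbabilityMeasure N] (ρ : Measure 𝒯) [IsProbabilityMeasure ρ] :
    relInfo N ρ = 0 := by
  have h : N.fst.prod ρ = N := by
    refine Measure.ext_of_lintegral _ fun f hf => ?_
    rw [lintegral_prod _ hf.aemeasurable, Measure.fst, lintegral_map (by fun_prop) (by fun_prop)]
    refine lintegral_congr fun p => ?_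
    have : ∀ y : 𝒯, f (p.1, y) = f p := fun y => by rw [Subsingleton.elim y p.2]
    simp [this]
  rw [relInfo, h, klDiv_self]

/-- Rearranges a family of pairs into a pair of families. -/
def unzip {ι : Type*} {𝒳 𝒴 : ι → Type*} (f : ∀ i, 𝒳 i × 𝒴 i) : (∀ i, 𝒳 i) × (∀ i, 𝒴 i) :=
  (fun i => (f i).1, fun i => (f i).2)

@[fun_prop]
lemma measurable_unzip {ι : Type*} {𝒳 𝒴 : ι → Type*} [∀ i, MeasurableSpace (𝒳 i)]
    [∀ i, MeasurableSpace (𝒴 i)] : Measurable (unzip : (∀ i, 𝒳 i × 𝒴 i) → _) := by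
  unfold unzip
  fun_prop

lemma eq_map_unzip {ι : Type*} {𝒳 𝒴 : ι → Type*} [∀ i, MeasurableSpace (𝒳 i)]
    [∀ i, MeasurableSpace (𝒴 i)] {J : Measure ((∀ i, 𝒳 i) × (∀ i, 𝒴 i))}
    {ν : Measure (∀ i, 𝒳 i × 𝒴 i)} (h : J.map (fun p i => (p.1 i, p.2 i)) = ν) :
    J = ν.map unzip := by
  rw [← h, Measure.map_map (by fun_prop) (by fun_prop)]
  exact Measure.map_id.symm

lemma fst_map_unzip {ι : Type*} [Fintype ι] {𝒳 𝒴 : ι → Type*} [∀ i, MeasurableSpace (𝒳 i)]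
    [∀ i, MeasurableSpace (𝒴 i)] (π : ∀ i, Measure (𝒳 i)) [∀ i, IsProbabilityMeasure (π i)]
    (K : ∀ i, Kernel (𝒳 i) (𝒴 i)) [∀ i, IsMarkovKernel (K i)] :
    ((Measure.pi fun i => π i ⊗ₘ K i).map unzip).fst = Measure.pi π := by
  rw [Measure.fst, Measure.map_map (by fun_prop) (by fun_prop)]
  have h := Measure.pi_map_pi (μ := fun i => π i ⊗ₘ K i) (f := fun i => Prod.fst)
    (hμ := fun i => by
      have : IsProbabilityMeasure ((π i ⊗ₘ K i).map Prod.fst) :=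
        Measure.isProbabilityMeasure_map (by fun_prop)
      infer_instance) (fun i => by fun_prop)
  have h2 : ∀ i, (π i ⊗ₘ K i).map Prod.fst = π i := fun i => Measure.fst_compProd _ _
  simp only [h2] at h
  exact h

lemma map_piFinSuccAbove_compProd {n : ℕ} {𝒳 𝒴 : Fin (n + 1) → Type u}
    [∀ i, MeasurableSpace (𝒳 i)] [∀ i, MeasurableSpace (𝒴 i)]
    (π : Measure (∀ i, 𝒳 i)) [IsProbabilityMeasure π] (K : Kernel (∀ i, 𝒳 i) (∀ i, 𝒴 i))
    [IsMarkovKernel K] (πi : ∀ i, Measure (𝒳 i)) [∀ i, IsProbabilityMeasure (πi i)]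
    (Ki : ∀ i, Kernel (𝒳 i) (𝒴 i)) [∀ i, IsMarkovKernel (Ki i)]
    (h : (π ⊗ₘ K).map (fun p i => (p.1 i, p.2 i)) = Measure.pi fun i => πi i ⊗ₘ Ki i)
    (π' : Measure (∀ j, 𝒳 (Fin.succAbove 0 j))) [IsProbabilityMeasure π']
    (K' : Kernel (∀ j, 𝒳 (Fin.succAbove 0 j)) (∀ j, 𝒴 (Fin.succAbove 0 j))) [IsMarkovKernel K']
    (h' : π' ⊗ₘ K' = (Measure.pi fun j => πi (Fin.succAbove 0 j) ⊗ₘ Ki (Fin.succAbove 0 j)).map unzip) :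
    ((πi 0).prod π') ⊗ₘ (Ki 0 ∥ₖ K')
      = (π ⊗ₘ K).map (Prod.map (MeasurableEquiv.piFinSuccAbove 𝒳 0)
          (MeasurableEquiv.piFinSuccAbove 𝒴 0)) := by
  have hp := (measurePreserving_piFinSuccAbove (fun i => πi i ⊗ₘ Ki i) 0).map_eq
  have h1 : (πi 0 ⊗ₘ Ki 0).prod (π' ⊗ₘ K')
      = (Measure.pi fun i => πi i ⊗ₘ Ki i).map
        (Prod.map id unzip ∘ MeasurableEquiv.piFinSuccAbove (fun i => 𝒳 i × 𝒴 i) 0) := by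
    rw [← Measure.map_map (by fun_prop) (by fun_prop), hp, ← Measure.map_prod_map _ _ measurable_id
      measurable_unzip, Measure.map_id, h']
  rw [prod_compProd_parallelComp, h1, eq_map_unzip h, Measure.map_map (by fun_prop) (by fun_prop),
    Measure.map_map (by fun_prop) (by fun_prop)]
  rfl

lemma keyBound_pi_iff {t : ℝ} (ht : 0 ≤ t) : ∀ (n : ℕ) (𝒳 𝒴 𝒵 : Fin n → Type u)
    [∀ i, MeasurableSpace (𝒳 i)] [∀ i, StandardBorelSpace (𝒳 i)] [∀ i, Nonempty (𝒳 i)]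
    [∀ i, MeasurableSpace (𝒴 i)] [∀ i, StandardBorelSpace (𝒴 i)] [∀ i, Nonempty (𝒴 i)]
    [∀ i, MeasurableSpace (𝒵 i)] [∀ i, StandardBorelSpace (𝒵 i)] [∀ i, Nonempty (𝒵 i)]
    (π : Measure (∀ i, 𝒳 i)) [IsProbabilityMeasure π]
    (K : Kernel (∀ i, 𝒳 i) (∀ i, 𝒴 i)) [IsMarkovKernel K]
    (L : Kernel (∀ i, 𝒳 i) (∀ i, 𝒵 i)) [IsMarkovKernel L]
    (πi : ∀ i, Measure (𝒳 i)) [∀ i, IsProbabilityMeasure (πi i)]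
    (Ki : ∀ i, Kernel (𝒳 i) (𝒴 i)) [∀ i, IsMarkovKernel (Ki i)]
    (Li : ∀ i, Kernel (𝒳 i) (𝒵 i)) [∀ i, IsMarkovKernel (Li i)]
    (_ : (π ⊗ₘ K).map (fun p i => (p.1 i, p.2 i)) = Measure.pi fun i => πi i ⊗ₘ Ki i)
    (_ : (π ⊗ₘ L).map (fun p i => (p.1 i, p.2 i)) = Measure.pi fun i => πi i ⊗ₘ Li i),
    KeyBound t π K L ↔ ∀ i, KeyBound t (πi i) (Ki i) (Li i) := by
  intro n
  induction n with
  | zero =>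
    intro 𝒳 𝒴 𝒵 _ _ _ _ _ _ _ _ _ π _ K _ L _ πi _ Ki _ Li _ _ _
    -- The empty product alphabets are one-point spaces, on which all informations vanish.
    refine ⟨fun _ i => i.elim0, fun _ 𝒰 𝒱 _ _ _ _ _ _ M _ _ => ?_⟩
    have : IsProbabilityMeasure (M.map fun p => (p.1.1, p.2)) :=
      Measure.isProbabilityMeasure_map (by fun_prop)
    simp [excess, info, relInfo_eq_zero_of_unique]
  | succ n ih =>
    intro 𝒳 𝒴 𝒵 _ _ _ _ _ _ _ _ _ π _ K _ L _ πi _ Ki _ Li _ hK hL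
    -- The joint law of the inputs and outputs of the remaining factors; its conditional kernel
    -- serves as their product channel.
    let A := (Measure.pi fun j => πi (Fin.succAbove 0 j) ⊗ₘ Ki (Fin.succAbove 0 j)).map unzip
    let B := (Measure.pi fun j => πi (Fin.succAbove 0 j) ⊗ₘ Li (Fin.succAbove 0 j)).map unzip
    let πt := Measure.pi fun j => πi (Fin.succAbove 0 j)
    have hAp : IsProbabilityMeasure A := Measure.isProbabilityMeasure_map (by fun_prop)
    have hBp : IsProbabilityMeasure B := Measure.isProbabilityMeasure_map (by fun_prop)
    have hA1 : A.fst = πt := fst_map_unzip _ _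
    have hB1 : B.fst = πt := fst_map_unzip _ _
    have hA : πt ⊗ₘ A.condKernel = A := by rw [← hA1, A.disintegrate]
    have hB : πt ⊗ₘ B.condKernel = B := by rw [← hB1, B.disintegrate]
    have zipA : (πt ⊗ₘ A.condKernel).map (fun p i => (p.1 i, p.2 i))
        = Measure.pi fun j => πi (Fin.succAbove 0 j) ⊗ₘ Ki (Fin.succAbove 0 j) := by
      rw [hA, Measure.map_map (by fun_prop) (by fun_prop)]
      exact Measure.map_id
    have zipB : (πt ⊗ₘ B.condKernel).map (fun p i => (p.1 i, p.2 i))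
        = Measure.pi fun j => πi (Fin.succAbove 0 j) ⊗ₘ Li (Fin.succAbove 0 j) := by
      rw [hB, Measure.map_map (by fun_prop) (by fun_prop)]
      exact Measure.map_id
    have tail := ih _ _ _ πt A.condKernel B.condKernel _ _ _ zipA zipB
    have eK := map_piFinSuccAbove_compProd π K πi Ki hK πt A.condKernel hA
    have eL := map_piFinSuccAbove_compProd π L πi Li hL πt B.condKernel hB
    rw [Fin.forall_iff_succAbove 0, ← tail, ← keyBound_parallel_iff ht]
    constructor
    · intro h
      refine h.transport (MeasurableEquiv.piFinSuccAbove 𝒳 0).symm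
        (MeasurableEquiv.piFinSuccAbove 𝒴 0).symm (MeasurableEquiv.piFinSuccAbove 𝒵 0).symm ?_ ?_
      · rw [eK, Measure.map_map (by fun_prop) (by fun_prop), Prod.map_comp_map,
          MeasurableEquiv.symm_comp_self, MeasurableEquiv.symm_comp_self, Prod.map_id, Measure.map_id]
      · rw [eL, Measure.map_map (by fun_prop) (by fun_prop), Prod.map_comp_map,
          MeasurableEquiv.symm_comp_self, MeasurableEquiv.symm_comp_self, Prod.map_id, Measure.map_id]
    · exact fun h => h.transport _ _ _ eK eL

lemma sStarZ_productSource {n : ℕ} [NeZero n] {𝒳 𝒴 𝒵 : Fin n → Type u}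
    [∀ i, MeasurableSpace (𝒳 i)] [∀ i, StandardBorelSpace (𝒳 i)] [∀ i, Nonempty (𝒳 i)]
    [∀ i, MeasurableSpace (𝒴 i)] [∀ i, StandardBorelSpace (𝒴 i)] [∀ i, Nonempty (𝒴 i)]
    [∀ i, MeasurableSpace (𝒵 i)] [∀ i, StandardBorelSpace (𝒵 i)] [∀ i, Nonempty (𝒵 i)]
    (P : Measure ((∀ i, 𝒳 i) × (∀ i, 𝒴 i) × (∀ i, 𝒵 i))) [IsProbabilityMeasure P]
    (hP : IsProductSource P) :
    sStarZ P = Finset.univ.sup' Finset.univ_nonempty (fun i => sStarZ (component P i)) := by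
  have hc : ∀ i, IsProbabilityMeasure (component P i) := fun i =>
    Measure.isProbabilityMeasure_map (by fun_prop)
  refine eq_of_forall_real_le_iff (sStarZ_nonneg P)
    (Finset.le_sup'_of_le _ (Finset.mem_univ 0) (sStarZ_nonneg _)) fun t ht => ?_
  rw [Finset.sup'_le_iff, sStarZ_le_iff_key P ht]
  simp only [Finset.mem_univ, true_imp_iff, sStarZ_le_iff_key _ ht]
  refine keyBound_pi_iff ht n 𝒳 𝒴 𝒵 _ _ _ _ _ _ ?_ ?_
  · simp only [← lawXY_eq]
    rw [← hP.1, lawXY, Measure.map_map (by fun_prop) (by fun_prop)]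
    rfl
  · simp only [← lawXZ_eq]
    rw [← hP.2, lawXZ, Measure.map_map (by fun_prop) (by fun_prop)]
    rfl

end FinitelyMany

/-! ### Degraded sources and the inequality between divergences. -/

section Degraded

variable {𝒳 𝒴 𝒵 : Type u}
  [MeasurableSpace 𝒳] [StandardBorelSpace 𝒳] [Nonempty 𝒳]
  [MeasurableSpace 𝒴] [StandardBorelSpace 𝒴] [Nonempty 𝒴]
  [MeasurableSpace 𝒵] [StandardBorelSpace 𝒵] [Nonempty 𝒵]

section Kernels

variable {π : Measure 𝒳} [IsProbabilityMeasure π]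
  {K : Kernel 𝒳 𝒴} [IsMarkovKernel K] {L : Kernel 𝒳 𝒵} [IsMarkovKernel L] {t : ℝ}

lemma excess_id_nonneg {𝒲 : Type*} [MeasurableSpace 𝒲] {M : Measure (𝒲 × 𝒳)}
    [IsProbabilityMeasure M] (hM : relInfo M π ≠ ∞) : 0 ≤ excess π Kernel.id L M :=
  sub_nonneg.mpr (info_le_info_id hM)

lemma divExcess_id_nonneg {Q : Measure 𝒳} [IsProbabilityMeasure Q] (hQ : klDiv Q π ≠ ∞) :
    0 ≤ divExcess π Kernel.id L Q :=
  sub_nonneg.mpr (outDiv_le_outDiv_id hQ)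

lemma divExcess_le_divExcess_id {Q : Measure 𝒳} [IsProbabilityMeasure Q] (hQ : klDiv Q π ≠ ∞) :
    divExcess π K L Q ≤ divExcess π Kernel.id L Q :=
  sub_le_sub_right (outDiv_le_outDiv_id hQ) _

/-- Data processing through T; an almost everywhere factorization suffices because finite divergence
forces Q ≪ π. -/
lemma divExcess_nonneg_of_comp_ae_eq (T : Kernel 𝒴 𝒵) [IsMarkovKernel T] (hT : T ∘ₖ K =ᵐ[π] L)
    {Q : Measure 𝒳} [IsProbabilityMeasure Q] (hQ : klDiv Q π ≠ ∞) : 0 ≤ divExcess π K L Q := by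
  have h : ∀ ρ : Measure 𝒳, ρ ≪ π → L ∘ₘ ρ = T ∘ₘ (K ∘ₘ ρ) := fun ρ hρ => by
    rw [Measure.comp_assoc]
    exact (Measure.bind_congr_right (hρ.ae_le hT)).symm
  rw [divExcess, sub_nonneg, outDiv, outDiv, h Q (klDiv_ne_top_iff.mp hQ).1,
    h π Measure.AbsolutelyContinuous.rfl]
  exact ENNReal.toReal_mono (klDiv_comp_ne_top hQ) (klDiv_comp_right_le _ _ _)

end Kernels

variable (P : Measure (𝒳 × 𝒴 × 𝒵)) [IsProbabilityMeasure P] {t : ℝ}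

/-- One direction specializes to trivial U and perturbs; the other is `DivergenceBound.keyBound`,
which needs t ≤ 1. Larger t are covered by the universal bound 1. -/
lemma sStarZ_le_iff_divergence (ht : 0 ≤ t)
    (hP : ∀ (Q : Measure 𝒳) [IsProbabilityMeasure Q], klDiv Q (lawX P) ≠ ∞ →
      0 ≤ divExcess (lawX P) (chanY P) (chanZ P) Q) :
    sStarZ P ≤ t ↔ DivergenceBound t (lawX P) (chanY P) (chanZ P) := by
  refine ⟨fun h => ((sStarZ_le_iff_variational P ht).mp h).infoBound.divergenceBound ht,
    fun h => ?_⟩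
  rcases le_total t 1 with h1 | h1
  · exact (sStarZ_le_iff_key P ht).mpr (h.keyBound h1 hP)
  · exact (sStarZ_le_one P).trans (by exact_mod_cast h1)

lemma sStarZ_le_iff_info (ht : 0 ≤ t)
    (hP : ∀ (Q : Measure 𝒳) [IsProbabilityMeasure Q], klDiv Q (lawX P) ≠ ∞ →
      0 ≤ divExcess (lawX P) (chanY P) (chanZ P) Q) :
    sStarZ P ≤ t ↔ InfoBound t (lawX P) (chanY P) (chanZ P) :=
  ⟨fun h => ((sStarZ_le_iff_variational P ht).mp h).infoBound,
    fun h => (sStarZ_le_iff_divergence P ht hP).mpr (h.divergenceBound ht)⟩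

lemma map_compProd_eq_comp {𝒯 𝒮 : Type*} [MeasurableSpace 𝒯] [MeasurableSpace 𝒮] (Q : Measure 𝒳)
    [IsProbabilityMeasure Q] (η : Kernel 𝒳 𝒯) [IsMarkovKernel η] {g : 𝒯 → 𝒮} (hg : Measurable g) :
    (Q ⊗ₘ η).map (fun ω => g ω.2) = (η.map g) ∘ₘ Q := by
  rw [← Measure.map_comp _ _ hg, ← Measure.snd_compProd, Measure.snd,
    Measure.map_map hg measurable_snd]
  rfl

lemma mem_divergenceRatios_iff {r : ℝ} :
    r ∈ divergenceRatios P ↔ ∃ (Q : Measure 𝒳) (_ : IsProbabilityMeasure Q),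
      klDiv Q (lawX P) ≠ ∞ ∧ divExcess (lawX P) Kernel.id (chanZ P) Q ≠ 0 ∧
      r = divExcess (lawX P) (chanY P) (chanZ P) Q / divExcess (lawX P) Kernel.id (chanZ P) Q := by
  have hY : ∀ (Q : Measure 𝒳) [IsProbabilityMeasure Q],
      lawY (Q ⊗ₘ P.condKernel) = chanY P ∘ₘ Q := fun Q _ =>
    map_compProd_eq_comp Q P.condKernel measurable_fst
  have hZ : ∀ (Q : Measure 𝒳) [IsProbabilityMeasure Q],
      lawZ (Q ⊗ₘ P.condKernel) = chanZ P ∘ₘ Q := fun Q _ =>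
    map_compProd_eq_comp Q P.condKernel measurable_snd
  simp only [divergenceRatios, Set.mem_ofPred_eq, divExcess, outDiv_id]
  simp only [outDiv, lawY_eq P, lawZ_eq P]
  constructor
  · rintro ⟨Q, _, h1, -, -, h4, h5⟩
    rw [hY, hZ] at h5
    rw [hZ] at h4
    exact ⟨Q, inferInstance, h1, h4, h5⟩
  · rintro ⟨Q, _, h1, h4, h5⟩
    refine ⟨Q, inferInstance, h1, ?_, ?_, ?_, ?_⟩
    · rw [hY]; exact klDiv_comp_ne_top h1
    · rw [hZ]; exact klDiv_comp_ne_top h1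
    · rw [hZ]; exact h4
    · rw [hY, hZ]; exact h5

lemma supOrZero_divergenceRatios_le_iff (ht : 0 ≤ t) :
    supOrZero (divergenceRatios P) ≤ t ↔ DivergenceBound t (lawX P) (chanY P) (chanZ P) := by
  rw [supOrZero_le_iff ht]
  constructor
  · intro h Q _ hQ
    rw [le_mul_iff_div_le (divExcess_id_nonneg hQ) (divExcess_le_divExcess_id hQ)]
    exact fun hne => h _ ((mem_divergenceRatios_iff P).mpr ⟨Q, inferInstance, hQ, hne, rfl⟩)
  · intro h r hr
    obtain ⟨Q, _, hQ, hne, rfl⟩ := (mem_divergenceRatios_iff P).mp hr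
    exact (le_mul_iff_div_le (divExcess_id_nonneg hQ) (divExcess_le_divExcess_id hQ)).mp (h Q hQ) hne

lemma sStarZ_eq_supOrZero_divergenceRatios
    (hP : ∀ (Q : Measure 𝒳) [IsProbabilityMeasure Q], klDiv Q (lawX P) ≠ ∞ →
      0 ≤ divExcess (lawX P) (chanY P) (chanZ P) Q) :
    sStarZ P = supOrZero (divergenceRatios P) := by
  refine eq_of_forall_real_le_iff (sStarZ_nonneg P) (supOrZero_nonneg fun ⟨r, hr⟩ => ?_)
    fun t ht => by
      rw [sStarZ_le_iff_divergence P ht hP, supOrZero_divergenceRatios_le_iff P ht]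
  refine ⟨r, hr, ?_⟩
  obtain ⟨Q, _, hQ, -, rfl⟩ := (mem_divergenceRatios_iff P).mp hr
  exact div_nonneg (hP Q hQ) (divExcess_id_nonneg hQ)

/-- `s^*_Z(X;Y)` depends only on the laws of `(X, Y)` and of `(X, Z)`. -/
lemma sStarZ_congr {P P' : Measure (𝒳 × 𝒴 × 𝒵)} [IsProbabilityMeasure P] [IsProbabilityMeasure P']
    (hY : lawXY P' = lawXY P) (hZ : lawXZ P' = lawXZ P) : sStarZ P = sStarZ P' := by
  refine eq_of_forall_real_le_iff (sStarZ_nonneg P) (sStarZ_nonneg P') fun t ht => ?_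
  rw [sStarZ_le_iff_key P ht, sStarZ_le_iff_key P' ht]
  constructor
  · intro h
    refine h.transport (MeasurableEquiv.refl _) (MeasurableEquiv.refl _) (MeasurableEquiv.refl _)
      ?_ ?_
    · rw [← lawXY_eq, ← lawXY_eq, hY]; exact Measure.map_id.symm
    · rw [← lawXZ_eq, ← lawXZ_eq, hZ]; exact Measure.map_id.symm
  · intro h
    refine h.transport (MeasurableEquiv.refl _) (MeasurableEquiv.refl _) (MeasurableEquiv.refl _)
      ?_ ?_
    · rw [← lawXY_eq, ← lawXY_eq, hY]; exact Measure.map_id.symm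
    · rw [← lawXZ_eq, ← lawXZ_eq, hZ]; exact Measure.map_id.symm

/-- T is the conditional law of Z given Y: by conditional independence, X plays no role in
generating Z once Y is known. -/
lemma IsDegradedVersion.eq_map_compProd {P P' : Measure (𝒳 × 𝒴 × 𝒵)} [IsProbabilityMeasure P']
    (h : IsDegradedVersion P P') :
    ∃ (T : Kernel 𝒴 𝒵) (_ : IsMarkovKernel T),
      P' = ((lawX P' ⊗ₘ chanY P') ⊗ₘ T.comap Prod.snd measurable_snd).map
        fun p => (p.1.1, (p.1.2, p.2)) := by
  have hX : Measurable fun ω : 𝒳 × 𝒴 × 𝒵 => ω.1 := by fun_prop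
  have hY : Measurable fun ω : 𝒳 × 𝒴 × 𝒵 => ω.2.1 := by fun_prop
  have hZ : Measurable fun ω : 𝒳 × 𝒴 × 𝒵 => ω.2.2 := by fun_prop
  have h1 := (condIndepFun_iff_map_prod_eq_prod_condDistrib_prod_condDistrib hX hZ hY).mp h.2.2
  refine ⟨condDistrib (fun ω : 𝒳 × 𝒴 × 𝒵 => ω.2.2) (fun ω => ω.2.1) P', inferInstance, ?_⟩
  set T := condDistrib (fun ω : 𝒳 × 𝒴 × 𝒵 => ω.2.2) (fun ω => ω.2.1) P'
  have h2 := compProd_map_condDistrib (mβ := inferInstance) (μ := P')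
    (X := fun ω : 𝒳 × 𝒴 × 𝒵 => ω.2.1) hX.aemeasurable
  set S := condDistrib (fun ω : 𝒳 × 𝒴 × 𝒵 => ω.1) (fun ω => ω.2.1) P'
  have h3 : (lawX P' ⊗ₘ chanY P') = (P'.map (fun ω => (ω.2.1, ω.1))).map Prod.swap := by
    rw [← lawXY_eq, Measure.map_map (by fun_prop) (by fun_prop)]
    rfl
  have h4 : P' = (P'.map fun ω => (ω.2.1, ω.1, ω.2.2)).map fun q => (q.2.1, (q.1, q.2.2)) := by
    rw [Measure.map_map (by fun_prop) (by fun_prop)]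
    exact Measure.map_id.symm
  rw [h3, ← h2]
  conv_lhs => rw [h4, h1]
  refine Measure.ext_of_lintegral _ fun f hf => ?_
  rw [lintegral_map hf (by fun_prop), lintegral_map hf (by fun_prop),
    Measure.lintegral_compProd (by fun_prop), lintegral_map (by fun_prop) (by fun_prop),
    Measure.lintegral_compProd (by fun_prop),
    Measure.lintegral_bind (by fun_prop) (by fun_prop)]
  refine lintegral_congr fun y => ?_
  rw [Kernel.lintegral_prod _ _ _ (by fun_prop), Kernel.id_apply, lintegral_dirac' _ (by fun_prop),
    Kernel.lintegral_prod _ _ _ (by fun_prop)]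
  rfl

/-- Stochastic degradedness: the channel to `Z` factors through the channel to `Y`. -/
lemma IsDegradedVersion.exists_kernel {P P' : Measure (𝒳 × 𝒴 × 𝒵)} [IsProbabilityMeasure P]
    [IsProbabilityMeasure P'] (h : IsDegradedVersion P P') :
    ∃ (T : Kernel 𝒴 𝒵) (_ : IsMarkovKernel T), T ∘ₖ chanY P =ᵐ[lawX P] chanZ P ∧
      P' = ((lawX P' ⊗ₘ chanY P') ⊗ₘ T.comap Prod.snd measurable_snd).map
        fun p => (p.1.1, (p.1.2, p.2)) := by
  obtain ⟨T, _, hT⟩ := h.eq_map_compProd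
  refine ⟨T, inferInstance, Kernel.ae_eq_of_compProd_eq ?_, hT⟩
  rw [← lawXZ_eq, ← h.2.1, lawXZ, hT, ← lawXY_eq, h.1, lawXY_eq,
    Measure.map_map (by fun_prop) (by fun_prop)]
  refine Measure.ext_of_lintegral _ fun f hf => ?_
  rw [lintegral_map hf (by fun_prop), Measure.lintegral_compProd hf,
    Measure.lintegral_compProd (by fun_prop), Measure.lintegral_compProd (by fun_prop)]
  refine lintegral_congr fun x => ?_
  rw [Kernel.lintegral_comp _ _ _ (by fun_prop)]
  rfl

end Degraded

/-! ### Finite-valued approximation of the auxiliary variable. -/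

section Quantization

open Classical in
/-- The finite-valued map that tells which of the first `n` sets of a generating sequence contain a
point. -/
noncomputable def quantize (𝒰 : Type u) [MeasurableSpace 𝒰] [MeasurableSpace.CountablyGenerated 𝒰]
    (n : ℕ) (x : 𝒰) : Fin n → ULift.{u} Bool :=
  fun i => if x ∈ MeasurableSpace.natGeneratingSequence 𝒰 i then ⟨true⟩ else ⟨false⟩

variable {𝒰 : Type u} [MeasurableSpace 𝒰] [MeasurableSpace.CountablyGenerated 𝒰]

@[fun_prop]
lemma measurable_quantize (n : ℕ) : Measurable (quantize 𝒰 n) := by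
  classical
  refine measurable_pi_iff.mpr fun i => ?_
  exact Measurable.ite (MeasurableSpace.measurableSet_natGeneratingSequence _) measurable_const
    measurable_const

lemma monotone_comap_quantize {𝒜 ℬ : Type*} [MeasurableSpace 𝒜] [MeasurableSpace ℬ] :
    Monotone fun n => MeasurableSpace.comap
      (fun p : 𝒜 × (𝒰 × ℬ) => (p.1, (quantize 𝒰 n p.2.1, p.2.2))) inferInstance := by
  intro m n hmn
  let r : 𝒜 × ((Fin n → ULift.{u} Bool) × ℬ) → 𝒜 × ((Fin m → ULift.{u} Bool) × ℬ) :=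
    fun q => (q.1, (fun i => q.2.1 (Fin.castLE hmn i), q.2.2))
  have hr : Measurable r := by fun_prop
  have h : (fun p : 𝒜 × (𝒰 × ℬ) => (p.1, (quantize 𝒰 m p.2.1, p.2.2)))
      = r ∘ fun p : 𝒜 × (𝒰 × ℬ) => (p.1, (quantize 𝒰 n p.2.1, p.2.2)) := rfl
  simp only
  rw [h, ← MeasurableSpace.comap_comp]
  exact MeasurableSpace.comap_mono hr.comap_le

lemma iSup_comap_quantize {𝒜 ℬ : Type*} [MeasurableSpace 𝒜] [MeasurableSpace ℬ] :
    ⨆ n, MeasurableSpace.comap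
      (fun p : 𝒜 × (𝒰 × ℬ) => (p.1, (quantize 𝒰 n p.2.1, p.2.2))) inferInstance
      = (inferInstance : MeasurableSpace (𝒜 × (𝒰 × ℬ))) := by
  refine le_antisymm (iSup_le fun n => Measurable.comap_le (by fun_prop)) ?_
  set m := ⨆ n, MeasurableSpace.comap
      (fun p : 𝒜 × (𝒰 × ℬ) => (p.1, (quantize 𝒰 n p.2.1, p.2.2))) inferInstance with hm
  have hg : ∀ n, Measurable[m] fun p : 𝒜 × (𝒰 × ℬ) => (p.1, (quantize 𝒰 n p.2.1, p.2.2)) :=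
    fun n => Measurable.of_comap_le (le_iSup (fun n => MeasurableSpace.comap
      (fun p : 𝒜 × (𝒰 × ℬ) => (p.1, (quantize 𝒰 n p.2.1, p.2.2))) inferInstance) n)
  -- Level 0 carries no bits but already both outer coordinates.
  have h1 : Measurable[m] fun p : 𝒜 × (𝒰 × ℬ) => p.1 :=
    (show Measurable fun q : 𝒜 × ((Fin 0 → ULift.{u} Bool) × ℬ) => q.1 by fun_prop).comp (hg 0)
  have h3 : Measurable[m] fun p : 𝒜 × (𝒰 × ℬ) => p.2.2 :=
    (show Measurable fun q : 𝒜 × ((Fin 0 → ULift.{u} Bool) × ℬ) => q.2.2 by fun_prop).comp (hg 0)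
  have h2 : Measurable[m] fun p : 𝒜 × (𝒰 × ℬ) => p.2.1 := by
    have : Measurable[m, MeasurableSpace.generateFrom
        (Set.range (MeasurableSpace.natGeneratingSequence 𝒰))]
        fun p : 𝒜 × (𝒰 × ℬ) => p.2.1 := by
      refine @measurable_generateFrom _ _ m _ _ ?_
      rintro _ ⟨i, rfl⟩
      -- Membership in the i-th generating set is the last bit at level i + 1.
      have hi : Measurable[m] fun p : 𝒜 × (𝒰 × ℬ) => quantize 𝒰 (i + 1) p.2.1 (Fin.last i) :=
        (show Measurable fun q : 𝒜 × ((Fin (i + 1) → ULift.{u} Bool) × ℬ) => q.2.1 (Fin.last i) by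
          fun_prop).comp (hg (i + 1))
      convert hi (measurableSet_singleton (⟨true⟩ : ULift.{u} Bool)) using 1
      ext p
      simp [quantize]
    rwa [MeasurableSpace.generateFrom_natGeneratingSequence] at this
  have hid : Measurable[m, Prod.instMeasurableSpace] (id : 𝒜 × (𝒰 × ℬ) → 𝒜 × (𝒰 × ℬ)) :=
    h1.prodMk (h2.prodMk h3)
  have h := hid.comap_le
  rwa [MeasurableSpace.comap_id] at h

/-- On an atom w of positive mass the conditional law of X is at most the marginal divided by that
mass, so its density is bounded; atoms of mass zero do not count. -/
lemma relInfo_ne_top_of_fintype {𝒲 𝒳 : Type*} [MeasurableSpace 𝒲] [MeasurableSpace 𝒳] [Fintype 𝒲]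
    [MeasurableSingletonClass 𝒲] [StandardBorelSpace 𝒳] [Nonempty 𝒳] (N : Measure (𝒲 × 𝒳))
    [IsProbabilityMeasure N] : relInfo N N.snd ≠ ∞ := by
  obtain ⟨ν, _, ζ, _, rfl⟩ : ∃ (ν : Measure 𝒲) (_ : IsProbabilityMeasure ν) (ζ : Kernel 𝒲 𝒳)
      (_ : IsMarkovKernel ζ), N = ν ⊗ₘ ζ :=
    ⟨N.fst, inferInstance, N.condKernel, inferInstance, (N.disintegrate _).symm⟩
  rw [relInfo_compProd, lintegral_fintype]
  refine ENNReal.sum_ne_top.mpr fun w _ => ?_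
  by_cases hw : ν {w} = 0
  · simp [hw]
  refine ENNReal.mul_ne_top (klDiv_ne_top_of_le_smul (ENNReal.inv_ne_top.mpr hw) ?_)
    (measure_ne_top _ _)
  refine Measure.le_iff.mpr fun s hs => ?_
  rw [Measure.snd_compProd, Measure.smul_apply, Measure.bind_apply hs (by fun_prop),
    lintegral_fintype, smul_eq_mul]
  calc ζ w s = (ν {w})⁻¹ * (ζ w s * ν {w}) := by
        rw [mul_comm (ζ w s), ← mul_assoc, ENNReal.inv_mul_cancel hw (measure_ne_top _ _), one_mul]
    _ ≤ _ := by
      gcongr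
      exact Finset.single_le_sum (f := fun w => ζ w s * ν {w}) (fun _ _ => zero_le)
        (Finset.mem_univ w)

end Quantization

/-! ### Markov chains and quantized conditional information. -/

section MarkovChains

variable {𝒜 𝒜' ℬ 𝒞 : Type*} [MeasurableSpace 𝒜] [MeasurableSpace 𝒜'] [MeasurableSpace ℬ]
  [MeasurableSpace 𝒞]

/-- Adjoining a variable generated from the first one is undone by forgetting it, so data processing
applies in both directions. -/
lemma relInfo_comp_left_id (N : Measure (ℬ × 𝒜)) [IsProbabilityMeasure N] (ρ : Measure 𝒜)
    [IsProbabilityMeasure ρ] (T : Kernel ℬ 𝒞) [IsMarkovKernel T] :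
    relInfo (((T ×ₖ Kernel.id) ∥ₖ Kernel.id) ∘ₘ N) ρ = relInfo N ρ := by
  refine le_antisymm (relInfo_comp_left_le _ _ _) ?_
  have h : (((T ×ₖ Kernel.id) ∥ₖ Kernel.id) ∘ₘ N).map (Prod.map Prod.snd id) = N := by
    refine Measure.ext_of_lintegral _ fun f hf => ?_
    rw [lintegral_map hf (by fun_prop), lintegral_comp_left _ _ (by fun_prop)]
    refine lintegral_congr fun p => ?_
    rw [Kernel.lintegral_prod _ _ _ (by fun_prop)]
    simp [lintegral_dirac' _ (show Measurable fun b => f (b, p.2) by fun_prop), Kernel.id_apply]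
  conv_lhs => rw [← h]
  exact relInfo_map_left_le _ _ measurable_snd

lemma comp_left_map_right (N : Measure (ℬ × 𝒜)) [IsProbabilityMeasure N] (T : Kernel ℬ 𝒞)
    [IsMarkovKernel T] {f : 𝒜 → 𝒜'} (hf : Measurable f) :
    ((T ∥ₖ Kernel.id) ∘ₘ N).map (Prod.map id f) = (T ∥ₖ Kernel.id) ∘ₘ (N.map (Prod.map id f)) := by
  refine Measure.ext_of_lintegral _ fun g hg => ?_
  rw [lintegral_map hg (by fun_prop), lintegral_comp_left _ _ (by fun_prop),
    lintegral_comp_left _ _ hg, lintegral_map (by fun_prop) (by fun_prop)]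
  rfl

variable [StandardBorelSpace 𝒜] [Nonempty 𝒜] [StandardBorelSpace ℬ] [Nonempty ℬ]
  {Ω : Type*} [MeasurableSpace Ω] {μ : Measure Ω} [IsProbabilityMeasure μ]
  {A : Ω → 𝒜} {B : Ω → ℬ} {C : Ω → 𝒞}

/-- The chain rule for a Markov chain `A - B - C`. -/
lemma mutualInfo_eq_add_condMutualInfo (hA : Measurable A) (hB : Measurable B) (hC : Measurable C)
    (T : Kernel ℬ 𝒞) [IsMarkovKernel T]
    (hT : μ.map (fun ω => ((C ω, B ω), A ω))
      = ((T ×ₖ Kernel.id) ∥ₖ Kernel.id) ∘ₘ μ.map fun ω => (B ω, A ω)) :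
    mutualInfo μ A B = mutualInfo μ A C + condMutualInfo μ A B C := by
  have : IsProbabilityMeasure (μ.map A) := Measure.isProbabilityMeasure_map hA.aemeasurable
  have : IsProbabilityMeasure (μ.map fun ω => (B ω, A ω)) :=
    Measure.isProbabilityMeasure_map (hB.prodMk hA).aemeasurable
  -- Since C is generated from B, the pair (C, B) informs about A exactly as much as B does.
  have h := relInfo_eq_add_condMutualInfo (μ := μ) hB hA hC (μ.map A)
  rw [hT, relInfo_comp_left_id, ← mutualInfo_eq_relInfo hA, ← mutualInfo_eq_relInfo hA] at h
  rw [mutualInfo_comm hA hB, mutualInfo_comm hA hC, condMutualInfo_comm hA hB hC, h]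

/-- Replacing A by a function of A pushes forward its conditional law, hence the conditionally
independent reference law as well. -/
lemma condMutualInfo_comp_left [StandardBorelSpace 𝒜'] [Nonempty 𝒜'] (hA : Measurable A)
    (hB : Measurable B) (hC : Measurable C) {f : 𝒜 → 𝒜'} (hf : Measurable f) :
    condMutualInfo μ (fun ω => f (A ω)) B C
      = klDiv ((μ.map fun ω => (C ω, (A ω, B ω))).map fun p => (p.1, (f p.2.1, p.2.2)))
        (((μ.map C) ⊗ₘ ((condDistrib A C μ) ×ₖ (condDistrib B C μ))).map
          fun p => (p.1, (f p.2.1, p.2.2))) := by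
  rw [condMutualInfo, Measure.map_map (by fun_prop) (by fun_prop)]
  congr 1
  have h1 : (μ.map C) ⊗ₘ ((condDistrib (fun ω => f (A ω)) C μ) ×ₖ (condDistrib B C μ))
      = (μ.map C) ⊗ₘ (((condDistrib A C μ).map f) ×ₖ (condDistrib B C μ)) := by
    refine Measure.compProd_congr ?_
    filter_upwards [condDistrib_comp C hA.aemeasurable hf] with c hc
    rw [Kernel.prod_apply, Kernel.prod_apply, ← hc]
    rfl
  rw [h1]
  refine Measure.ext_of_lintegral _ fun g hg => ?_
  rw [lintegral_map hg (by fun_prop), Measure.lintegral_compProd hg,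
    Measure.lintegral_compProd (by fun_prop)]
  refine lintegral_congr fun c => ?_
  rw [Kernel.lintegral_prod _ _ _ (by fun_prop), Kernel.lintegral_prod _ _ _ (by fun_prop),
    Kernel.lintegral_map _ hf _ (by fun_prop)]

lemma condMutualInfo_comp_left_le [StandardBorelSpace 𝒜'] [Nonempty 𝒜'] (hA : Measurable A)
    (hB : Measurable B) (hC : Measurable C) {f : 𝒜 → 𝒜'} (hf : Measurable f) :
    condMutualInfo μ (fun ω => f (A ω)) B C ≤ condMutualInfo μ A B C := by
  have : IsProbabilityMeasure (μ.map C) := Measure.isProbabilityMeasure_map hC.aemeasurable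
  rw [condMutualInfo_comp_left hA hB hC hf]
  exact klDiv_map_le _ _ (by fun_prop)

/-- Lower semicontinuity along refining quantizations; finiteness enters through the absolute
continuity it provides. -/
lemma condMutualInfo_le_of_forall_quantize {𝒰 : Type u} [MeasurableSpace 𝒰] [StandardBorelSpace 𝒰]
    [Nonempty 𝒰] {U : Ω → 𝒰} (hU : Measurable U) (hB : Measurable B) (hC : Measurable C)
    (hfin : condMutualInfo μ U B C ≠ ∞) {c : ℝ≥0∞}
    (hc : ∀ n, condMutualInfo μ (fun ω => quantize 𝒰 n (U ω)) B C ≤ c) :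
    condMutualInfo μ U B C ≤ c := by
  have : IsProbabilityMeasure (μ.map C) := Measure.isProbabilityMeasure_map hC.aemeasurable
  refine klDiv_le_of_forall_map_le (klDiv_ne_top_iff.mp hfin).1
    (g := fun n p => (p.1, (quantize 𝒰 n p.2.1, p.2.2))) (fun n => by fun_prop)
    monotone_comap_quantize iSup_comap_quantize fun n => ?_
  rw [← condMutualInfo_comp_left hU hB hC (measurable_quantize n)]
  exact hc n

end MarkovChains

/-! ### Conditional informations for degraded sources. -/

section CondInfo

variable {𝒳 𝒴 𝒵 : Type u}
  [MeasurableSpace 𝒳] [StandardBorelSpace 𝒳] [Nonempty 𝒳]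
  [MeasurableSpace 𝒴] [StandardBorelSpace 𝒴] [Nonempty 𝒴]
  [MeasurableSpace 𝒵] [StandardBorelSpace 𝒵] [Nonempty 𝒵]

/-- `U - X - (Y, Z)` and `U - Y - Z` are Markov chains, the channels from `X` to `Y`, from `X` to `Z`
and from `Y` to `Z` being `K`, `L` and `T`. -/
structure IsDegradedChain {𝒰 Ω : Type*} [MeasurableSpace 𝒰] [MeasurableSpace Ω] (K : Kernel 𝒳 𝒴)
    (L : Kernel 𝒳 𝒵) (T : Kernel 𝒴 𝒵) (μ : Measure Ω) (U : Ω → 𝒰) (X : Ω → 𝒳) (Y : Ω → 𝒴)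
    (Z : Ω → 𝒵) : Prop where
  measurable_U : Measurable U
  measurable_X : Measurable X
  measurable_Y : Measurable Y
  measurable_Z : Measurable Z
  law_UY : μ.map (fun ω => (U ω, Y ω)) = through K (μ.map fun ω => (U ω, X ω))
  law_UZ : μ.map (fun ω => (U ω, Z ω)) = through L (μ.map fun ω => (U ω, X ω))
  law_ZXU : μ.map (fun ω => ((Z ω, X ω), U ω))
    = ((L ×ₖ Kernel.id) ∥ₖ Kernel.id) ∘ₘ μ.map fun ω => (X ω, U ω)
  law_ZYU : μ.map (fun ω => ((Z ω, Y ω), U ω))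
    = ((T ×ₖ Kernel.id) ∥ₖ Kernel.id) ∘ₘ μ.map fun ω => (Y ω, U ω)

namespace IsDegradedChain

variable {𝒰 𝒰' Ω : Type*} [MeasurableSpace 𝒰] [MeasurableSpace 𝒰'] [MeasurableSpace Ω]
  {K : Kernel 𝒳 𝒴} [IsMarkovKernel K] {L : Kernel 𝒳 𝒵} [IsMarkovKernel L]
  {T : Kernel 𝒴 𝒵} [IsMarkovKernel T] {μ : Measure Ω} [IsProbabilityMeasure μ]
  {U : Ω → 𝒰} {X : Ω → 𝒳} {Y : Ω → 𝒴} {Z : Ω → 𝒵}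

lemma comp (h : IsDegradedChain K L T μ U X Y Z) {f : 𝒰 → 𝒰'} (hf : Measurable f) :
    IsDegradedChain K L T μ (fun ω => f (U ω)) X Y Z := by
  have hU := h.measurable_U
  have hX := h.measurable_X
  have hY := h.measurable_Y
  have hZ := h.measurable_Z
  have hp : ∀ {𝒯 : Type u} [MeasurableSpace 𝒯] {S : Ω → 𝒯} (_ : Measurable S),
      μ.map (fun ω => (f (U ω), S ω)) = (μ.map fun ω => (U ω, S ω)).map (Prod.map f id) := by
    intro 𝒯 _ S hS
    rw [Measure.map_map (by fun_prop) (by fun_prop)]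
    rfl
  have hq : ∀ {𝒯 : Type u} [MeasurableSpace 𝒯] {S : Ω → 𝒯} (_ : Measurable S),
      μ.map (fun ω => (S ω, f (U ω))) = (μ.map fun ω => (S ω, U ω)).map (Prod.map id f) := by
    intro 𝒯 _ S hS
    rw [Measure.map_map (by fun_prop) (by fun_prop)]
    rfl
  have pX : IsProbabilityMeasure (μ.map fun ω => (X ω, U ω)) :=
    Measure.isProbabilityMeasure_map (hX.prodMk hU).aemeasurable
  have pY : IsProbabilityMeasure (μ.map fun ω => (Y ω, U ω)) :=
    Measure.isProbabilityMeasure_map (hY.prodMk hU).aemeasurable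
  refine ⟨hf.comp hU, hX, hY, hZ, ?_, ?_, ?_, ?_⟩
  · rw [hp hY, hp hX, h.law_UY, through_map_left _ _ hf]
  · rw [hp hZ, hp hX, h.law_UZ, through_map_left _ _ hf]
  · rw [hq (hZ.prodMk hX), hq hX, h.law_ZXU, comp_left_map_right _ _ hf]
  · rw [hq (hZ.prodMk hY), hq hY, h.law_ZYU, comp_left_map_right _ _ hf]

variable [StandardBorelSpace 𝒰] [Nonempty 𝒰]

lemma mutualInfo_X (h : IsDegradedChain K L T μ U X Y Z) :
    mutualInfo μ U X = mutualInfo μ U Z + condMutualInfo μ U X Z :=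
  mutualInfo_eq_add_condMutualInfo h.measurable_U h.measurable_X h.measurable_Z L h.law_ZXU

lemma mutualInfo_Y (h : IsDegradedChain K L T μ U X Y Z) :
    mutualInfo μ U Y = mutualInfo μ U Z + condMutualInfo μ U Y Z :=
  mutualInfo_eq_add_condMutualInfo h.measurable_U h.measurable_Y h.measurable_Z T h.law_ZYU

/-- Along the chains U - X - Z and U - Y - Z the difference of two informations is a conditional
information. Finiteness of I(U;X) makes the subtraction of I(U;Z) legitimate. -/
lemma excess_eq (h : IsDegradedChain K L T μ U X Y Z) (hfin : mutualInfo μ U X ≠ ∞) :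
    relInfo (μ.map fun ω => (U ω, X ω)) (μ.map X) ≠ ∞ ∧
    condMutualInfo μ U X Z ≠ ∞ ∧ condMutualInfo μ U Y Z ≠ ∞ ∧
    excess (μ.map X) K L (μ.map fun ω => (U ω, X ω)) = (condMutualInfo μ U Y Z).toReal ∧
    excess (μ.map X) Kernel.id L (μ.map fun ω => (U ω, X ω))
      = (condMutualInfo μ U X Z).toReal := by
  have hU := h.measurable_U
  have hX := h.measurable_X
  have hY := h.measurable_Y
  have hZ := h.measurable_Z
  have pM : IsProbabilityMeasure (μ.map fun ω => (U ω, X ω)) :=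
    Measure.isProbabilityMeasure_map (hU.prodMk hX).aemeasurable
  have pX : IsProbabilityMeasure (μ.map X) := Measure.isProbabilityMeasure_map hX.aemeasurable
  have sM : (μ.map fun ω => (U ω, X ω)).snd = μ.map X := Measure.snd_map_prodMk hU
  have sY : K ∘ₘ μ.map X = μ.map Y := by
    rw [← sM, ← snd_through, ← h.law_UY, Measure.snd_map_prodMk hU]
  have sZ : L ∘ₘ μ.map X = μ.map Z := by
    rw [← sM, ← snd_through, ← h.law_UZ, Measure.snd_map_prodMk hU]
  have rX : relInfo (μ.map fun ω => (U ω, X ω)) (μ.map X) = mutualInfo μ U X :=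
    (mutualInfo_eq_relInfo hX).symm
  have rY : relInfo (through K (μ.map fun ω => (U ω, X ω))) (K ∘ₘ μ.map X) = mutualInfo μ U Y := by
    rw [← h.law_UY, sY, mutualInfo_eq_relInfo hY]
  have rZ : relInfo (through L (μ.map fun ω => (U ω, X ω))) (L ∘ₘ μ.map X) = mutualInfo μ U Z := by
    rw [← h.law_UZ, sZ, mutualInfo_eq_relInfo hZ]
  have hfin' := hfin
  rw [h.mutualInfo_X] at hfin'
  obtain ⟨h1, h2⟩ := ENNReal.add_ne_top.mp hfin'
  have hfinY : mutualInfo μ U Y ≠ ∞ := by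
    rw [← rY]
    exact relInfo_through_ne_top (by rwa [rX])
  rw [h.mutualInfo_Y] at hfinY
  have h3 := (ENNReal.add_ne_top.mp hfinY).2
  refine ⟨by rwa [rX], h2, h3, ?_, ?_⟩
  · rw [excess, info, info, rY, rZ, h.mutualInfo_Y, ENNReal.toReal_add h1 h3]
    ring
  · rw [excess, info_id, info, rX, rZ, h.mutualInfo_X, ENNReal.toReal_add h1 h2]
    ring

end IsDegradedChain

/-- I(U;X) may be infinite although the conditional informations are finite. A quantized U has
finite I(U;X), so the bound applies to it; quantization does not increase the right side, and the
left side is recovered in the limit. -/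
lemma IsDegradedChain.condMutualInfo_le {𝒰 : Type u} {Ω : Type*} [MeasurableSpace 𝒰]
    [StandardBorelSpace 𝒰] [Nonempty 𝒰] [MeasurableSpace Ω]
    {K : Kernel 𝒳 𝒴} [IsMarkovKernel K] {L : Kernel 𝒳 𝒵} [IsMarkovKernel L]
    {T : Kernel 𝒴 𝒵} [IsMarkovKernel T] {μ : Measure Ω} [IsProbabilityMeasure μ]
    {U : Ω → 𝒰} {X : Ω → 𝒳} {Y : Ω → 𝒴} {Z : Ω → 𝒵}
    (h : IsDegradedChain K L T μ U X Y Z) {t : ℝ} (ht : 0 ≤ t) (hb : InfoBound t (μ.map X) K L)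
    (hX : condMutualInfo μ U X Z ≠ ∞) (hY : condMutualInfo μ U Y Z ≠ ∞) :
    (condMutualInfo μ U Y Z).toReal ≤ t * (condMutualInfo μ U X Z).toReal := by
  have key : ∀ n, condMutualInfo μ (fun ω => quantize 𝒰 n (U ω)) Y Z
      ≤ ENNReal.ofReal (t * (condMutualInfo μ U X Z).toReal) := by
    intro n
    have hn := h.comp (measurable_quantize n)
    have pM : IsProbabilityMeasure (μ.map fun ω => (quantize 𝒰 n (U ω), X ω)) :=
      Measure.isProbabilityMeasure_map (hn.measurable_U.prodMk h.measurable_X).aemeasurable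
    have sM : (μ.map fun ω => (quantize 𝒰 n (U ω), X ω)).snd = μ.map X :=
      Measure.snd_map_prodMk hn.measurable_U
    have hfin : mutualInfo μ (fun ω => quantize 𝒰 n (U ω)) X ≠ ∞ := by
      rw [mutualInfo_eq_relInfo h.measurable_X, ← sM]
      exact relInfo_ne_top_of_fintype _
    obtain ⟨hr, hX', hY', e1, e2⟩ := hn.excess_eq hfin
    have hb' := hb _ _ sM hr
    rw [e1, e2] at hb'
    rw [← ENNReal.ofReal_toReal hY']
    refine ENNReal.ofReal_le_ofReal (hb'.trans (mul_le_mul_of_nonneg_left ?_ ht))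
    exact ENNReal.toReal_mono hX (condMutualInfo_comp_left_le h.measurable_U h.measurable_X
      h.measurable_Z (measurable_quantize n))
  have := condMutualInfo_le_of_forall_quantize h.measurable_U h.measurable_Y h.measurable_Z hY key
  exact ENNReal.toReal_le_of_le_ofReal (mul_nonneg ht ENNReal.toReal_nonneg) this

variable (P : Measure (𝒳 × 𝒴 × 𝒵)) [IsProbabilityMeasure P]

lemma isDegradedChain_markov {𝒰 : Type u} [MeasurableSpace 𝒰] (T : Kernel 𝒴 𝒵) [IsMarkovKernel T]
    (hT : P = ((lawX P ⊗ₘ chanY P) ⊗ₘ T.comap Prod.snd measurable_snd).map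
        fun p => (p.1.1, (p.1.2, p.2))) (κ : Kernel 𝒳 𝒰) [IsMarkovKernel κ] :
    IsDegradedChain (chanY P) (chanZ P) T (P ⊗ₘ κ.comap Prod.fst measurable_fst)
      (fun ω => ω.2) (fun ω => ω.1.1) (fun ω => ω.1.2.1) (fun ω => ω.1.2.2) := by
  refine ⟨by fun_prop, by fun_prop, by fun_prop, by fun_prop, ?_, ?_, ?_, ?_⟩
  · rw [markov_map_input]
    exact markov_map_output P κ measurable_fst
  · rw [markov_map_input]
    exact markov_map_output P κ measurable_snd
  · refine Measure.ext_of_lintegral _ fun f hf => ?_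
    rw [lintegral_map hf (by fun_prop), lintegral_markov _ _ (by fun_prop),
      lintegral_comp_left _ _ hf, lintegral_map (by fun_prop) (by fun_prop),
      lintegral_markov _ _ (by fun_prop)]
    refine lintegral_congr fun x => ?_
    simp only [lintegral_const, measure_univ, mul_one]
    rw [lintegral_lintegral_swap (Measurable.aemeasurable (by fun_prop))]
    refine lintegral_congr fun w => ?_
    rw [Kernel.lintegral_prod _ _ _ (by fun_prop), chanZ,
      Kernel.lintegral_map _ measurable_snd _ (by fun_prop)]
    refine lintegral_congr fun s => ?_
    rw [Kernel.id_apply, lintegral_dirac' _ (by fun_prop)]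
  · refine Measure.ext_of_lintegral _ fun f hf => ?_
    have hP : ∀ {g : 𝒳 × 𝒴 × 𝒵 → ℝ≥0∞}, Measurable g →
        ∫⁻ ω, g ω ∂P = ∫⁻ p, ∫⁻ z, g (p.1, (p.2, z)) ∂T p.2 ∂(lawX P ⊗ₘ chanY P) := by
      intro g hg
      conv_lhs => rw [hT]
      rw [lintegral_map hg (by fun_prop), Measure.lintegral_compProd (by fun_prop)]
      rfl
    rw [lintegral_map hf (by fun_prop), lintegral_comp_left _ _ hf,
      lintegral_map (by fun_prop) (by fun_prop), Measure.lintegral_compProd (by fun_prop),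
      Measure.lintegral_compProd (by fun_prop), hP (by fun_prop), hP (by fun_prop)]
    refine lintegral_congr fun p => ?_
    simp only [lintegral_const, measure_univ, mul_one, Kernel.comap_apply]
    rw [lintegral_lintegral_swap (Measurable.aemeasurable (by fun_prop))]
    refine lintegral_congr fun w => ?_
    rw [Kernel.lintegral_prod _ _ _ (by fun_prop)]
    refine lintegral_congr fun s => ?_
    rw [Kernel.id_apply, lintegral_dirac' _ (by fun_prop)]

lemma supOrZero_condInfoRatios_le_iff {t : ℝ} (ht : 0 ≤ t) (T : Kernel 𝒴 𝒵) [IsMarkovKernel T]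
    (hT : P = ((lawX P ⊗ₘ chanY P) ⊗ₘ T.comap Prod.snd measurable_snd).map
        fun p => (p.1.1, (p.1.2, p.2))) :
    supOrZero (condInfoRatios P) ≤ t ↔ InfoBound t (lawX P) (chanY P) (chanZ P) := by
  have hX : ∀ {𝒰 : Type u} [MeasurableSpace 𝒰] (κ : Kernel 𝒳 𝒰) [IsMarkovKernel κ],
      (P ⊗ₘ κ.comap Prod.fst measurable_fst).map (fun ω => ω.1.1) = lawX P := by
    intro 𝒰 _ κ _
    conv_rhs => rw [lawX, ← Measure.fst_compProd P (κ.comap Prod.fst measurable_fst), Measure.fst,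
      Measure.map_map (by fun_prop) (by fun_prop)]
    rfl
  rw [supOrZero_le_iff ht]
  constructor
  · intro h 𝒰 _ _ _ M _ hMs hM
    obtain ⟨κ, _, hκ⟩ := exists_markov_kernel (M := M)
    rw [hMs] at hκ
    have hc := isDegradedChain_markov P T hT κ
    have hM' : (P ⊗ₘ κ.comap Prod.fst measurable_fst).map (fun ω => (ω.2, ω.1.1)) = M :=
      (markov_map_input P κ).trans hκ.symm
    have hfin : mutualInfo (P ⊗ₘ κ.comap Prod.fst measurable_fst) (fun ω => ω.2) (fun ω => ω.1.1)
        ≠ ∞ := by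
      rwa [mutualInfo_eq_relInfo (by fun_prop), hM', hX]
    obtain ⟨-, h1, h2, e1, e2⟩ := hc.excess_eq hfin
    rw [hM', hX] at e1 e2
    rw [le_mul_iff_div_le (excess_id_nonneg hM) (excess_le_excess_id hM), e1, e2]
    exact fun hne => h _ ⟨𝒰, inferInstance, inferInstance, inferInstance, κ, inferInstance, h1, h2,
      fun h0 => hne (by rw [h0, ENNReal.toReal_zero]), rfl⟩
  · rintro h r ⟨𝒰, _, _, _, κ, _, h1, h2, h3, rfl⟩
    have hc := isDegradedChain_markov P T hT κ
    rw [div_le_iff₀ (ENNReal.toReal_pos h3 h1)]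
    exact hc.condMutualInfo_le ht (by rwa [hX]) h1 h2

lemma sStarZ_eq_of_isDegradedVersion {P P' : Measure (𝒳 × 𝒴 × 𝒵)} [IsProbabilityMeasure P]
    [IsProbabilityMeasure P'] (h : IsDegradedVersion P P') :
    sStarZ P = supOrZero (condInfoRatios P') ∧ sStarZ P = supOrZero (divergenceRatios P) := by
  constructor
  -- The constant is the same for both laws because their (X, Y) and (X, Z) marginals agree, and the
  -- second law is a degraded version of itself.
  · have h' : IsDegradedVersion P' P' := ⟨rfl, rfl, h.2.2⟩
    obtain ⟨T, _, hT, hP⟩ := h'.exists_kernel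
    rw [sStarZ_congr h.1 h.2.1]
    refine eq_of_forall_real_le_iff (sStarZ_nonneg P') (supOrZero_nonneg fun ⟨r, hr⟩ => ⟨r, hr, ?_⟩)
      fun t ht => ?_
    · obtain ⟨𝒰, _, _, _, κ, _, -, -, -, rfl⟩ := hr
      exact div_nonneg ENNReal.toReal_nonneg ENNReal.toReal_nonneg
    · rw [supOrZero_condInfoRatios_le_iff P' ht T hP]
      exact sStarZ_le_iff_info P' ht fun Q _ hQ => divExcess_nonneg_of_comp_ae_eq T hT hQ
  · obtain ⟨T, _, hT, -⟩ := h.exists_kernel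
    exact sStarZ_eq_supOrZero_divergenceRatios P
      fun Q _ hQ => divExcess_nonneg_of_comp_ae_eq T hT hQ

end CondInfo

/-! ### The strong data processing constant of two variables. -/

section Sdpi

variable {𝒳 𝒴 : Type u} [MeasurableSpace 𝒳] [StandardBorelSpace 𝒳] [Nonempty 𝒳]
  [MeasurableSpace 𝒴] [StandardBorelSpace 𝒴] [Nonempty 𝒴]

/-- The strong data processing inequality with constant `t` for the channel `K`. -/
def SdpiBound (t : ℝ) (π : Measure 𝒳) (K : Kernel 𝒳 𝒴) : Prop :=
  ∀ (Q : Measure 𝒳) [IsProbabilityMeasure Q], klDiv Q π ≠ ∞ →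
    outDiv π K Q ≤ t * (klDiv Q π).toReal

lemma outDiv_congr {π : Measure 𝒳} {K K' : Kernel 𝒳 𝒴} (h : K =ᵐ[π] K') {Q : Measure 𝒳}
    (hQ : Q ≪ π) : outDiv π K Q = outDiv π K' Q := by
  rw [outDiv, outDiv, Measure.bind_congr_right h, Measure.bind_congr_right (hQ.ae_le h)]

lemma SdpiBound.congr {t : ℝ} {π : Measure 𝒳} {K K' : Kernel 𝒳 𝒴} (h : K =ᵐ[π] K')
    (hb : SdpiBound t π K) : SdpiBound t π K' := fun Q _ hQ => by
  rw [← outDiv_congr h (klDiv_ne_top_iff.mp hQ).1]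
  exact hb Q hQ

variable (P : Measure (𝒳 × 𝒴)) [IsProbabilityMeasure P] {t : ℝ}

lemma snd_eq_condKernel_comp_fst : P.snd = P.condKernel ∘ₘ P.fst := by
  conv_lhs => rw [← P.disintegrate P.condKernel, Measure.snd_compProd]

lemma sStar_le_iff (ht : 0 ≤ t) : sStar P ≤ t ↔ SdpiBound t P.fst P.condKernel := by
  have hs := snd_eq_condKernel_comp_fst P
  rw [sStar, supOrZero_le_iff ht]
  constructor
  · intro h Q _ hQ
    have hK : outDiv P.fst P.condKernel Q ≤ (klDiv Q P.fst).toReal := by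
      rw [← outDiv_id]; exact outDiv_le_outDiv_id hQ
    refine (le_mul_iff_div_le ENNReal.toReal_nonneg hK).mpr fun hne => ?_
    refine h _ ⟨Q, inferInstance, ?_, hQ, ?_, ?_⟩
    · rintro rfl
      simp [klDiv_self] at hne
    · rw [Measure.snd_compProd, hs]
      exact klDiv_comp_ne_top hQ
    · rw [Measure.snd_compProd, hs]
      rfl
  · rintro h r ⟨Q, _, hne, hQ, -, rfl⟩
    have h0 : 0 < (klDiv Q P.fst).toReal := by
      refine ENNReal.toReal_pos ?_ hQ
      rwa [Ne, klDiv_eq_zero_iff]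
    rw [div_le_iff₀ h0, Measure.snd_compProd, hs]
    exact h Q hQ

lemma sStar_nonneg : 0 ≤ sStar P := by
  refine supOrZero_nonneg fun ⟨r, hr⟩ => ⟨r, hr, ?_⟩
  obtain ⟨Q, _, -, -, -, rfl⟩ := hr
  exact div_nonneg ENNReal.toReal_nonneg ENNReal.toReal_nonneg

lemma supOrZero_sdpiInfoRatios_nonneg : 0 ≤ supOrZero (sdpiInfoRatios P) := by
  refine supOrZero_nonneg fun ⟨r, hr⟩ => ⟨r, hr, ?_⟩
  obtain ⟨𝒰, _, _, _, κ, _, -, -, -, rfl⟩ := hr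
  exact div_nonneg ENNReal.toReal_nonneg ENNReal.toReal_nonneg

lemma mutualInfo_markov {𝒰 : Type u} [MeasurableSpace 𝒰] (κ : Kernel 𝒳 𝒰) [IsMarkovKernel κ] :
    mutualInfo (P ⊗ₘ κ.comap Prod.fst measurable_fst) (fun ω => ω.2) (fun ω => ω.1.1)
      = relInfo ((P.fst ⊗ₘ κ).map Prod.swap) P.fst ∧
    mutualInfo (P ⊗ₘ κ.comap Prod.fst measurable_fst) (fun ω => ω.2) (fun ω => ω.1.2)
      = relInfo (through P.condKernel ((P.fst ⊗ₘ κ).map Prod.swap)) (P.condKernel ∘ₘ P.fst) := by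
  have h2 := markov_map_output P κ (g := id) measurable_id
  rw [Kernel.map_id] at h2
  have e1 := congrArg Measure.snd (markov_map_input P κ)
  have e2 := congrArg Measure.snd h2
  rw [snd_through, snd_map_swap_compProd, Measure.snd_map_prodMk (by fun_prop)] at e2
  rw [snd_map_swap_compProd, Measure.snd_map_prodMk (by fun_prop)] at e1
  constructor
  · rw [mutualInfo_eq_relInfo (by fun_prop), markov_map_input, e1]
  · rw [mutualInfo_eq_relInfo (by fun_prop)]
    exact congrArg₂ relInfo h2 e2

lemma supOrZero_sdpiInfoRatios_le_iff (ht : 0 ≤ t) :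
    supOrZero (sdpiInfoRatios P) ≤ t ↔
      ∀ (𝒰 : Type u) [MeasurableSpace 𝒰] [StandardBorelSpace 𝒰] [Nonempty 𝒰]
        (M : Measure (𝒰 × 𝒳)) [IsProbabilityMeasure M], M.snd = P.fst → relInfo M P.fst ≠ ∞ →
        info P.fst P.condKernel M ≤ t * info P.fst Kernel.id M := by
  rw [supOrZero_le_iff ht]
  constructor
  · intro h 𝒰 _ _ _ M _ hMs hM
    refine (le_mul_iff_div_le info_nonneg (info_le_info_id hM)).mpr fun hne => ?_
    obtain ⟨κ, _, hκ⟩ := exists_markov_kernel (M := M)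
    rw [hMs] at hκ
    obtain ⟨e1, e2⟩ := mutualInfo_markov P κ
    rw [← hκ] at e1 e2
    refine h _ ⟨𝒰, inferInstance, inferInstance, inferInstance, κ, inferInstance, ?_, ?_, ?_, ?_⟩
    · rwa [e1]
    · rw [e2]; exact relInfo_through_ne_top hM
    · intro h0
      rw [e1] at h0
      rw [info_id, h0] at hne
      exact hne ENNReal.toReal_zero
    · rw [e1, e2, info_id]
      rfl
  · rintro h r ⟨𝒰, _, _, _, κ, _, h1, -, h3, rfl⟩
    obtain ⟨e1, e2⟩ := mutualInfo_markov P κ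
    rw [e1] at h1 h3
    have : IsProbabilityMeasure ((P.fst ⊗ₘ κ).map Prod.swap) :=
      Measure.isProbabilityMeasure_map (by fun_prop)
    have hb := h 𝒰 ((P.fst ⊗ₘ κ).map Prod.swap) (snd_map_swap_compProd κ P.fst) h1
    rw [info_id, info, ← e1, ← e2] at hb
    rw [← e1] at h1 h3
    exact (div_le_iff₀ (ENNReal.toReal_pos h3 h1)).mpr hb

end Sdpi

/-! ### Constant Z. -/

section Constant

variable {𝒳 𝒴 𝒵 : Type u}
  [MeasurableSpace 𝒳] [StandardBorelSpace 𝒳] [Nonempty 𝒳]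
  [MeasurableSpace 𝒴] [StandardBorelSpace 𝒴] [Nonempty 𝒴]
  [MeasurableSpace 𝒵] [StandardBorelSpace 𝒵] [Nonempty 𝒵]
  (P : Measure (𝒳 × 𝒴 × 𝒵)) [IsProbabilityMeasure P]

lemma info_of_ae_eq_const {𝒲 : Type*} [MeasurableSpace 𝒲] {π : Measure 𝒳} [IsProbabilityMeasure π]
    {L : Kernel 𝒳 𝒵} [IsMarkovKernel L] {ν : Measure 𝒵} [IsProbabilityMeasure ν]
    (h : L =ᵐ[π] Kernel.const 𝒳 ν) {M : Measure (𝒲 × 𝒳)} [IsProbabilityMeasure M]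
    (hM : M.snd ≪ π) : info π L M = 0 := by
  have h1 : through L M = M.fst.prod ν := by
    rw [through_congr h hM]
    refine Measure.ext_of_lintegral _ fun f hf => ?_
    rw [lintegral_through _ _ hf, lintegral_prod _ hf.aemeasurable, Measure.fst,
      lintegral_map (by fun_prop) (by fun_prop)]
    rfl
  have h2 : L ∘ₘ π = ν := by
    rw [Measure.bind_congr_right h, Measure.const_comp]
    simp
  rw [info, relInfo, fst_through, h1, h2, klDiv_self, ENNReal.toReal_zero]

lemma outDiv_of_ae_eq_const {π : Measure 𝒳} [IsProbabilityMeasure π]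
    {L : Kernel 𝒳 𝒵} {ν : Measure 𝒵} [IsProbabilityMeasure ν]
    (h : L =ᵐ[π] Kernel.const 𝒳 ν) {Q : Measure 𝒳} [IsProbabilityMeasure Q]
    (hQ : Q ≪ π) : outDiv π L Q = 0 := by
  rw [outDiv_congr h hQ, outDiv, Measure.const_comp, Measure.const_comp]
  simp [klDiv_self]

lemma chanZ_ae_eq_const {c : 𝒵} (hc : ∀ᵐ ω ∂P, ω.2.2 = c) :
    chanZ P =ᵐ[lawX P] Kernel.const 𝒳 (Measure.dirac c) := by
  refine Kernel.ae_eq_of_compProd_eq ?_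
  rw [← lawXZ_eq, Measure.compProd_const, Measure.prod_dirac, lawXZ, lawX,
    Measure.map_map (by fun_prop) (by fun_prop)]
  refine Measure.map_congr ?_
  filter_upwards [hc] with ω hω
  simp [hω]

lemma condKernel_lawXY_ae_eq : (lawXY P).condKernel =ᵐ[lawX P] chanY P := by
  have hp : IsProbabilityMeasure (lawXY P) := Measure.isProbabilityMeasure_map (by fun_prop)
  have h : (lawXY P).fst = lawX P := by rw [lawXY_eq, Measure.fst_compProd]
  refine Kernel.ae_eq_of_compProd_eq ?_
  rw [← h, Measure.disintegrate, h, lawXY_eq]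

/-- The channel to Z is almost everywhere constant, so every term in Z vanishes. The nonnegativity
needed for the degraded case is then trivial, and the divergence and information bounds become the
two classical ones. -/
lemma sStarZ_eq_of_ae_eq_const {c : 𝒵} (hc : ∀ᵐ ω ∂P, ω.2.2 = c) :
    sStarZ P = sStar (lawXY P) ∧ sStarZ P = supOrZero (sdpiInfoRatios (lawXY P)) := by
  have hp : IsProbabilityMeasure (lawXY P) := Measure.isProbabilityMeasure_map (by fun_prop)
  have hf : (lawXY P).fst = lawX P := by rw [lawXY_eq, Measure.fst_compProd]
  have hL := chanZ_ae_eq_const P hc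
  have hK := condKernel_lawXY_ae_eq P
  have hdeg : ∀ (Q : Measure 𝒳) [IsProbabilityMeasure Q], klDiv Q (lawX P) ≠ ∞ →
      0 ≤ divExcess (lawX P) (chanY P) (chanZ P) Q := fun Q _ hQ => by
    rw [divExcess, outDiv_of_ae_eq_const hL (klDiv_ne_top_iff.mp hQ).1, sub_zero]
    exact outDiv_nonneg
  constructor
  · refine eq_of_forall_real_le_iff (sStarZ_nonneg P) (sStar_nonneg _) fun t ht => ?_
    rw [sStarZ_le_iff_divergence P ht hdeg, sStar_le_iff _ ht, hf]
    refine forall_congr' fun Q => forall_congr' fun _ => forall_congr' fun hQ => ?_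
    have hQ' := (klDiv_ne_top_iff.mp hQ).1
    rw [divExcess, divExcess, outDiv_of_ae_eq_const hL hQ', sub_zero, sub_zero, outDiv_id,
      outDiv_congr hK hQ']
  · refine eq_of_forall_real_le_iff (sStarZ_nonneg P) (supOrZero_sdpiInfoRatios_nonneg _)
      fun t ht => ?_
    rw [sStarZ_le_iff_info P ht hdeg, supOrZero_sdpiInfoRatios_le_iff _ ht, hf]
    refine forall_congr' fun 𝒰 => forall_congr' fun _ => forall_congr' fun _ =>
      forall_congr' fun _ => forall_congr' fun M => forall_congr' fun _ =>
      forall_congr' fun hMs => forall_congr' fun hM => ?_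
    have hM' := snd_absolutelyContinuous_of_relInfo_ne_top hM
    rw [excess, excess, info_of_ae_eq_const hL hM', sub_zero, sub_zero]
    have : info (lawX P) (lawXY P).condKernel M = info (lawX P) (chanY P) M := by
      rw [info, info, through_congr hK hM', Measure.bind_congr_right hK]
    rw [this]

end Constant

/-! ### A countable family of test inputs for strong data processing. -/

section Limits

open Filter Topology

section Tilting

variable {𝒳 : Type u} [MeasurableSpace 𝒳] [MeasurableSpace.CountablyGenerated 𝒳]

lemma monotone_comap_quantize_self :
    Monotone fun n => MeasurableSpace.comap (quantize 𝒳 n) inferInstance := by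
  intro m n hmn
  let r : (Fin n → ULift.{u} Bool) → (Fin m → ULift.{u} Bool) := fun q i => q (Fin.castLE hmn i)
  have hr : Measurable r := by fun_prop
  have h : quantize 𝒳 m = r ∘ quantize 𝒳 n := rfl
  simp only
  rw [h, ← MeasurableSpace.comap_comp]
  exact MeasurableSpace.comap_mono hr.comap_le

lemma iSup_comap_quantize_self :
    ⨆ n, MeasurableSpace.comap (quantize 𝒳 n) inferInstance
      = (inferInstance : MeasurableSpace 𝒳) := by
  refine le_antisymm (iSup_le fun n => (measurable_quantize n).comap_le) ?_
  refine (MeasurableSpace.generateFrom_natGeneratingSequence 𝒳).symm.le.trans ?_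
  refine MeasurableSpace.generateFrom_le ?_
  rintro _ ⟨i, rfl⟩
  refine le_iSup (fun n => MeasurableSpace.comap (quantize 𝒳 n) inferInstance) (i + 1) _
    ⟨{w | w (Fin.last i) = ⟨true⟩}, ?_, ?_⟩
  · exact measurableSet_eq_fun (by fun_prop) (by fun_prop)
  · ext p
    simp [quantize]

/-- Codes for a countable family of densities: functions of finitely many bits. -/
abbrev TiltCode := Σ n : ℕ, ((Fin n → ULift.{u} Bool) → ℕ)

/-- The function that a code stands for. -/
noncomputable def tiltFun (𝒳 : Type u) [MeasurableSpace 𝒳] [MeasurableSpace.CountablyGenerated 𝒳]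
    (d : TiltCode.{u}) (x : 𝒳) : ℝ≥0∞ :=
  1 + (d.2 (quantize 𝒳 d.1 x) : ℝ≥0∞)

@[fun_prop]
lemma measurable_tiltFun (d : TiltCode.{u}) : Measurable (tiltFun 𝒳 d) := by
  have : Measurable fun w => (d.2 w : ℝ≥0∞) := measurable_of_finite _
  exact measurable_const.add (this.comp (measurable_quantize _))

lemma tiltFun_le (d : TiltCode.{u}) (x : 𝒳) : tiltFun 𝒳 d x ≤ ((1 + ∑ w, d.2 w : ℕ) : ℝ≥0∞) := by
  rw [tiltFun, Nat.cast_add, Nat.cast_one]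
  gcongr
  exact Finset.single_le_sum (f := d.2) (fun _ _ => Nat.zero_le _) (Finset.mem_univ _)

/-- The summand 1 in `tiltFun` keeps the normalizer away from 0 for every π, so a code defines a
probability law whatever the reference law is. -/
lemma one_le_lintegral_tiltFun (d : TiltCode.{u}) (π : Measure 𝒳) [IsProbabilityMeasure π] :
    1 ≤ ∫⁻ x, tiltFun 𝒳 d x ∂π := by
  calc (1 : ℝ≥0∞) = ∫⁻ _, 1 ∂π := by simp
    _ ≤ _ := lintegral_mono fun x => le_self_add

lemma lintegral_tiltFun_ne_top (d : TiltCode.{u}) (π : Measure 𝒳) [IsProbabilityMeasure π] :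
    ∫⁻ x, tiltFun 𝒳 d x ∂π ≠ ∞ := by
  refine ((lintegral_mono fun x => tiltFun_le d x).trans_lt ?_).ne
  simp [-Nat.cast_add]

/-- The law whose density with respect to `π` is proportional to `tiltFun`. -/
noncomputable def tilt (d : TiltCode.{u}) (π : Measure 𝒳) : Measure 𝒳 :=
  π.withDensity fun x => tiltFun 𝒳 d x / ∫⁻ x, tiltFun 𝒳 d x ∂π

instance (d : TiltCode.{u}) (π : Measure 𝒳) [IsProbabilityMeasure π] :
    IsProbabilityMeasure (tilt d π) := by
  constructor
  rw [tilt, withDensity_apply _ MeasurableSet.univ, Measure.restrict_univ]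
  simp_rw [div_eq_mul_inv]
  rw [lintegral_mul_const _ (by fun_prop)]
  exact ENNReal.mul_inv_cancel (zero_lt_one.trans_le (one_le_lintegral_tiltFun d π)).ne'
    (lintegral_tiltFun_ne_top d π)

/-- The constant depends on the code and not on π, so one bound serves all fibers of a kernel. -/
lemma tilt_le (d : TiltCode.{u}) (π : Measure 𝒳) [IsProbabilityMeasure π] :
    tilt d π ≤ ((1 + ∑ w, d.2 w : ℕ) : ℝ≥0∞) • π := by
  rw [← withDensity_const]
  refine withDensity_mono (ae_of_all _ fun x => ?_)
  refine (ENNReal.div_le_of_le_mul ?_)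
  exact (tiltFun_le d x).trans (le_mul_of_one_le_right' (one_le_lintegral_tiltFun d π))

end Tilting

section Density

variable {𝒳 : Type u} [MeasurableSpace 𝒳] [StandardBorelSpace 𝒳] [Nonempty 𝒳]

/-- A law with bounded density is a limit of laws given by codes. -/
lemma exists_tilt_tendsto {π Q : Measure 𝒳} [IsProbabilityMeasure π] [IsProbabilityMeasure Q]
    {C : ℝ} (hC : 1 ≤ C) (hQ : Q ≤ ENNReal.ofReal C • π) :
    ∃ d : ℕ → TiltCode.{u}, ∀ {𝒴 : Type u} [MeasurableSpace 𝒴] [StandardBorelSpace 𝒴] [Nonempty 𝒴]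
      (K : Kernel 𝒳 𝒴) [IsMarkovKernel K],
      Tendsto (fun n => outDiv π K (tilt (d n) π)) atTop (𝓝 (outDiv π K Q)) := by
  let g := Q.rnDeriv π
  have hgm : Measurable g := Measure.measurable_rnDeriv Q π
  have hQg : π.withDensity g = Q :=
    Measure.withDensity_rnDeriv_eq Q π (absolutelyContinuous_of_le_smul hQ)
  have hgC : ∀ᵐ x ∂π, g x ≤ ENNReal.ofReal C := rnDeriv_le_of_le_smul hQ
  have hg1 : ∫⁻ x, g x ∂π = 1 := by
    have := congrArg (fun m : Measure 𝒳 => m Set.univ) hQg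
    simpa using this
  let f : 𝒳 → ℝ := fun x => (g x).toReal
  have hf : Integrable f π := Measure.integrable_toReal_rnDeriv
  let ℱ : Filtration ℕ (inferInstance : MeasurableSpace 𝒳) :=
    ⟨fun n => MeasurableSpace.comap (quantize 𝒳 n) inferInstance, monotone_comap_quantize_self,
      fun n => (measurable_quantize n).comap_le⟩
  have hsm : StronglyMeasurable[⨆ n, ℱ n] f := by
    have : ⨆ n, ℱ n = (inferInstance : MeasurableSpace 𝒳) := iSup_comap_quantize_self
    rw [this]
    exact hgm.ennreal_toReal.stronglyMeasurable
  have hconv := hf.tendsto_ae_condExp hsm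
  -- The conditional expectation on the first n bits is a function of these bits, hence of finitely
  -- many values, and converges to the density as a martingale.
  have hfac : ∀ n, ∃ h : (Fin n → ULift.{u} Bool) → ℝ, π[f | ℱ n] = h ∘ quantize 𝒳 n :=
    fun n => (StronglyMeasurable.exists_eq_measurable_comp
      (stronglyMeasurable_condExp (m := ℱ n) (μ := π) (f := f))).imp fun _ h => h.2
  choose h hfac using hfac
  have hnonneg : ∀ n, ∀ᵐ x ∂π, 0 ≤ (π[f | ℱ n]) x := fun n =>
    condExp_nonneg (ae_of_all _ fun x => ENNReal.toReal_nonneg)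
  have hleC : ∀ n, ∀ᵐ x ∂π, (π[f | ℱ n]) x ≤ C := by
    intro n
    have := condExp_mono (m := ℱ n) (g := fun _ => C) hf (integrable_const C) (by
      filter_upwards [hgC] with x hx
      exact ENNReal.toReal_le_of_le_ofReal (by linarith) hx)
    rw [condExp_const (ℱ.le n)] at this
    exact this
  -- The conditional expectation is rounded to a multiple of 2^(-n); the common factor 2^n
  -- disappears in the normalization.
  let d : ℕ → TiltCode.{u} := fun n => ⟨n, fun w => ⌊2 ^ n * h n w⌋₊⟩
  let r : ℕ → 𝒳 → ℝ := fun n x => (1 + (⌊2 ^ n * (π[f | ℱ n]) x⌋₊ : ℝ)) / 2 ^ n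
  have hdr : ∀ n x, tiltFun 𝒳 (d n) x = 2 ^ n * ENNReal.ofReal (r n x) := by
    intro n x
    have h1 : (2 : ℝ≥0∞) ^ n = ENNReal.ofReal (2 ^ n) := by
      rw [ENNReal.ofReal_pow (by norm_num)]; simp
    rw [h1, ← ENNReal.ofReal_mul (by positivity)]
    simp only [r]
    rw [mul_div_cancel₀ _ (by positivity), ENNReal.ofReal_add (by norm_num) (by positivity),
      ENNReal.ofReal_one, ENNReal.ofReal_natCast, hfac n]
    rfl
  have hlow : ∀ n x, (π[f | ℱ n]) x ≤ r n x := by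
    intro n x
    rw [le_div_iff₀ (by positivity), mul_comm]
    have := (Nat.lt_floor_add_one (2 ^ n * (π[f | ℱ n]) x)).le
    linarith
  have hup : ∀ n x, 0 ≤ (π[f | ℱ n]) x → r n x ≤ (π[f | ℱ n]) x + (1 / 2) ^ n := by
    intro n x hx
    have := Nat.floor_le (a := 2 ^ n * (π[f | ℱ n]) x) (by positivity)
    rw [div_le_iff₀ (by positivity), add_mul, ← mul_pow]
    norm_num
    linarith
  have hlim : ∀ᵐ x ∂π, Tendsto (fun n => r n x) atTop (𝓝 (f x)) := by
    filter_upwards [hconv, ae_all_iff.mpr hnonneg] with x hx h0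
    refine tendsto_of_tendsto_of_tendsto_of_le_of_le hx ?_ (fun n => hlow n x)
      (fun n => hup n x (h0 n))
    simpa using hx.add (tendsto_pow_atTop_nhds_zero_of_lt_one (r := (1 / 2 : ℝ)) (by norm_num)
      (by norm_num))
  have hrC : ∀ n, ∀ᵐ x ∂π, r n x ≤ C + 1 := by
    intro n
    filter_upwards [hnonneg n, hleC n] with x h0 h1
    have : ((1 : ℝ) / 2) ^ n ≤ 1 := pow_le_one₀ (by norm_num) (by norm_num)
    linarith [hup n x h0]
  have hrm : ∀ n, Measurable (r n) := by
    intro n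
    have : Measurable (π[f | ℱ n]) := stronglyMeasurable_condExp.measurable.mono (ℱ.le n) le_rfl
    fun_prop
  let I : ℕ → ℝ≥0∞ := fun n => ∫⁻ x, ENNReal.ofReal (r n x) ∂π
  have hlimE : ∀ᵐ x ∂π, Tendsto (fun n => ENNReal.ofReal (r n x)) atTop (𝓝 (g x)) := by
    filter_upwards [hlim, hgC] with x hx hgx
    have := ENNReal.tendsto_ofReal hx
    rwa [ENNReal.ofReal_toReal (hgx.trans_lt ENNReal.ofReal_lt_top).ne] at this
  have hI : Tendsto I atTop (𝓝 1) := by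
    rw [← hg1]
    refine tendsto_lintegral_of_dominated_convergence (fun _ => ENNReal.ofReal (C + 1))
      (fun n => (hrm n).ennreal_ofReal) (fun n => ?_) (by simp) hlimE
    filter_upwards [hrC n] with x hx
    exact ENNReal.ofReal_le_ofReal hx
  -- The added 1 makes the rounded density at least the conditional expectation, whose integral is
  -- 1; normalizing therefore only lowers it and keeps the bound C + 1.
  have hI1 : ∀ n, 1 ≤ I n := by
    intro n
    calc (1 : ℝ≥0∞) = ENNReal.ofReal (∫ x, f x ∂π) := by
          rw [integral_toReal hgm.aemeasurable
            (hgC.mono fun x hx => hx.trans_lt ENNReal.ofReal_lt_top), hg1]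
          simp
      _ = ENNReal.ofReal (∫ x, (π[f | ℱ n]) x ∂π) := by rw [integral_condExp (ℱ.le n)]
      _ = ∫⁻ x, ENNReal.ofReal ((π[f | ℱ n]) x) ∂π :=
          ofReal_integral_eq_lintegral_ofReal integrable_condExp (hnonneg n)
      _ ≤ I n := lintegral_mono fun x => ENNReal.ofReal_le_ofReal (hlow n x)
  have hdens : ∀ n x, tiltFun 𝒳 (d n) x / ∫⁻ x, tiltFun 𝒳 (d n) x ∂π
      = ENNReal.ofReal (r n x) / I n := by
    intro n x
    simp_rw [hdr n]
    rw [lintegral_const_mul _ (hrm n).ennreal_ofReal]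
    exact ENNReal.mul_div_mul_left _ _ (by positivity) (by simp)
  refine ⟨d, fun K _ => ?_⟩
  have hQfin : klDiv (π.withDensity g) π ≠ ∞ := by
    rw [hQg]; exact klDiv_ne_top_of_le_smul ENNReal.ofReal_ne_top hQ
  have hT := tendsto_klDiv_comp_withDensity π K (g := g)
    (f := fun n x => tiltFun 𝒳 (d n) x / ∫⁻ x, tiltFun 𝒳 (d n) x ∂π) hgm (fun n => by fun_prop)
    (by rw [hg1]; simp) (C := C + 1) (by linarith)
    (fun n => by
      filter_upwards [hrC n] with x hx
      rw [hdens]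
      calc ENNReal.ofReal (r n x) / I n ≤ ENNReal.ofReal (r n x) :=
            ENNReal.div_le_of_le_mul (le_mul_of_one_le_right' (hI1 n))
        _ ≤ ENNReal.ofReal (C + 1) := ENNReal.ofReal_le_ofReal hx
        _ ≤ _ := le_mul_of_one_le_right' le_add_self)
    (by
      filter_upwards [hlimE] with x hx
      simp_rw [hdens]
      have := ENNReal.Tendsto.div hx (Or.inr one_ne_zero) hI (Or.inl ENNReal.one_ne_top)
      simpa using this) hQfin
  rw [hQg] at hT
  have hQfin' : klDiv (K ∘ₘ Q) (K ∘ₘ π) ≠ ∞ := by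
    rw [hQg] at hQfin
    exact klDiv_comp_ne_top hQfin
  exact (ENNReal.tendsto_toReal hQfin').comp hT

/-- The strong data processing inequality has to be checked for countably many inputs only. -/
lemma sdpiBound_of_forall_tilt {𝒴 : Type u} [MeasurableSpace 𝒴] [StandardBorelSpace 𝒴] [Nonempty 𝒴]
    {t : ℝ} {π : Measure 𝒳} [IsProbabilityMeasure π] {K : Kernel 𝒳 𝒴} [IsMarkovKernel K]
    (h : ∀ d : TiltCode.{u}, outDiv π K (tilt d π) ≤ t * (klDiv (tilt d π) π).toReal) :
    SdpiBound t π K := by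
  -- Bounded densities are limits of tilts; general inputs are then limits of bounded ones, by
  -- truncation with a trivial V.
  have key : ∀ (Q : Measure 𝒳) [IsProbabilityMeasure Q] (C : ℝ), 1 ≤ C →
      Q ≤ ENNReal.ofReal C • π → outDiv π K Q ≤ t * outDiv π Kernel.id Q := by
    intro Q _ C hC hQ
    obtain ⟨d, hd⟩ := exists_tilt_tendsto hC hQ
    refine le_of_tendsto_of_tendsto' (hd K) ((hd Kernel.id).const_mul t) fun n => ?_
    rw [outDiv_id]
    exact h (d n)
  intro Q _ hQ
  obtain ⟨N, hN, C, hC, hNC, -, hlim⟩ := exists_truncation (𝒱 := PUnit.{u + 1})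
    (M := (Measure.dirac PUnit.unit).prod Q) (π := π) (by rwa [relInfo_dirac_prod])
  have l1 := (hlim K).2
  have l2 := (hlim (Kernel.id : Kernel 𝒳 𝒳)).2
  rw [Measure.snd_prod] at l1 l2
  rw [← outDiv_id]
  exact le_of_tendsto_of_tendsto' l1 (l2.const_mul t) fun n => key _ (C n) (hC n) (hNC n)

end Density

end Limits

/-! ### Side information: averaged and fiberwise inequalities. -/

section SideInformation

variable {𝒳 𝒴 𝒵 : Type u}
  [MeasurableSpace 𝒳] [StandardBorelSpace 𝒳] [Nonempty 𝒳]
  [MeasurableSpace 𝒴] [StandardBorelSpace 𝒴] [Nonempty 𝒴]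
  [MeasurableSpace 𝒵] [StandardBorelSpace 𝒵] [Nonempty 𝒵]

/-- The output laws of the channels `B (z, ·)` for the inputs `ξ z`. -/
noncomputable def fiberOut (B : Kernel (𝒵 × 𝒳) 𝒴) (ξ : Kernel 𝒵 𝒳) : Kernel 𝒵 𝒴 := (ξ ⊗ₖ B).snd

/-- The channel `B (z, ·)` with side information: the input `(x, z)` gives the output `(y, z)`. -/
noncomputable def sideChan (B : Kernel (𝒵 × 𝒳) 𝒴) : Kernel (𝒳 × 𝒵) (𝒴 × 𝒵) :=
  (B.comap Prod.swap measurable_swap) ×ₖ Kernel.deterministic Prod.snd measurable_snd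

/-- The channel that outputs the side information only. -/
noncomputable def sideOut : Kernel (𝒳 × 𝒵) 𝒵 := Kernel.deterministic Prod.snd measurable_snd

instance : IsMarkovKernel (sideOut : Kernel (𝒳 × 𝒵) 𝒵) := by unfold sideOut; infer_instance

variable (σ q : Measure 𝒵) [IsProbabilityMeasure σ] [IsProbabilityMeasure q]
  (α ξ : Kernel 𝒵 𝒳) [IsMarkovKernel α] [IsMarkovKernel ξ]
  (B : Kernel (𝒵 × 𝒳) 𝒴) [IsMarkovKernel B]

instance : IsMarkovKernel (fiberOut B ξ) := by unfold fiberOut; infer_instance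

instance : IsMarkovKernel (sideChan B) := by unfold sideChan; infer_instance

lemma fiberOut_apply (z : 𝒵) : fiberOut B ξ z = B.sectR z ∘ₘ ξ z := by
  rw [fiberOut, Kernel.snd_apply, Kernel.compProd_apply_eq_compProd_sectR, ← Measure.snd,
    Measure.snd_compProd]

lemma lintegral_sideChan {f : 𝒴 × 𝒵 → ℝ≥0∞} (hf : Measurable f) (p : 𝒳 × 𝒵) :
    ∫⁻ y, f y ∂(sideChan B p) = ∫⁻ y, f (y, p.2) ∂B (p.2, p.1) := by
  rw [sideChan, Kernel.lintegral_prod _ _ _ hf]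
  refine lintegral_congr fun y => ?_
  rw [Kernel.deterministic_apply, lintegral_dirac' _ (by fun_prop)]

lemma sideChan_comp :
    sideChan B ∘ₘ ((q ⊗ₘ ξ).map Prod.swap) = (q ⊗ₘ fiberOut B ξ).map Prod.swap := by
  refine Measure.ext_of_lintegral _ fun f hf => ?_
  rw [Measure.lintegral_bind (by fun_prop) (by fun_prop), lintegral_map (by fun_prop) (by fun_prop),
    lintegral_map hf (by fun_prop), Measure.lintegral_compProd (by fun_prop),
    Measure.lintegral_compProd (by fun_prop)]
  refine lintegral_congr fun z => ?_
  rw [fiberOut_apply, Measure.lintegral_bind (by fun_prop) (by fun_prop)]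
  refine lintegral_congr fun x => ?_
  rw [lintegral_sideChan B hf]
  rfl

lemma sideOut_comp : sideOut ∘ₘ ((q ⊗ₘ ξ).map Prod.swap) = q := by
  rw [sideOut, Measure.deterministic_comp_eq_map, Measure.map_map (by fun_prop) (by fun_prop)]
  exact Measure.fst_compProd _ _

lemma klDiv_compProd_swap (β η : Kernel 𝒵 𝒳) [IsMarkovKernel β] [IsMarkovKernel η] :
    klDiv ((q ⊗ₘ η).map Prod.swap) ((σ ⊗ₘ β).map Prod.swap)
      = klDiv q σ + ∫⁻ z, klDiv (η z) (β z) ∂q := by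
  rw [klDiv_map_of_leftInverse _ _ measurable_swap measurable_swap Prod.swap_swap,
    klDiv_compProd_eq_add, klDiv_compProd_eq_lintegral]

variable {σ q α ξ B}

lemma lintegral_klDiv_fiberOut_le :
    ∫⁻ z, klDiv (fiberOut B ξ z) (fiberOut B α z) ∂q ≤ ∫⁻ z, klDiv (ξ z) (α z) ∂q := by
  refine lintegral_mono fun z => ?_
  rw [fiberOut_apply, fiberOut_apply]
  exact klDiv_comp_right_le _ _ _

/-- By the chain rule over z both divergences contain D(q ‖ σ), which is the divergence of the side
information itself and cancels. -/
lemma divExcess_side (h : klDiv ((q ⊗ₘ ξ).map Prod.swap) ((σ ⊗ₘ α).map Prod.swap) ≠ ∞) :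
    divExcess ((σ ⊗ₘ α).map Prod.swap) (sideChan B) sideOut ((q ⊗ₘ ξ).map Prod.swap)
      = (∫⁻ z, klDiv (fiberOut B ξ z) (fiberOut B α z) ∂q).toReal ∧
    divExcess ((σ ⊗ₘ α).map Prod.swap) Kernel.id sideOut ((q ⊗ₘ ξ).map Prod.swap)
      = (∫⁻ z, klDiv (ξ z) (α z) ∂q).toReal := by
  rw [klDiv_compProd_swap] at h
  obtain ⟨h0, h1⟩ := ENNReal.add_ne_top.mp h
  have h2 := (lintegral_klDiv_fiberOut_le (B := B).trans_lt h1.lt_top).ne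
  constructor
  · rw [divExcess, outDiv, outDiv, sideChan_comp, sideChan_comp, sideOut_comp, sideOut_comp,
      klDiv_compProd_swap, ENNReal.toReal_add h0 h2, add_sub_cancel_left]
  · rw [divExcess, outDiv, outDiv, Measure.id_comp, Measure.id_comp, sideOut_comp, sideOut_comp,
      klDiv_compProd_swap, ENNReal.toReal_add h0 h1, add_sub_cancel_left]

lemma exists_eq_map_swap (Q : Measure (𝒳 × 𝒵)) [IsProbabilityMeasure Q] :
    ∃ (q : Measure 𝒵) (_ : IsProbabilityMeasure q) (ξ : Kernel 𝒵 𝒳) (_ : IsMarkovKernel ξ),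
      Q = (q ⊗ₘ ξ).map Prod.swap := by
  have : IsProbabilityMeasure (Q.map Prod.swap) :=
    Measure.isProbabilityMeasure_map measurable_swap.aemeasurable
  refine ⟨(Q.map Prod.swap).fst, inferInstance, (Q.map Prod.swap).condKernel, inferInstance, ?_⟩
  rw [Measure.disintegrate, Measure.map_map measurable_swap measurable_swap]
  simp

/-- The kernel `z ↦ tilt d (α z)`. -/
noncomputable def tiltKernel (d : TiltCode.{u}) (α : Kernel 𝒵 𝒳) [IsMarkovKernel α] : Kernel 𝒵 𝒳 :=
  α.withDensity fun z x => tiltFun 𝒳 d x / ∫⁻ x, tiltFun 𝒳 d x ∂α z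

lemma tiltKernel_apply (d : TiltCode.{u}) (z : 𝒵) : tiltKernel d α z = tilt d (α z) := by
  rw [tiltKernel, Kernel.withDensity_apply _ (by unfold Function.uncurry; fun_prop)]
  rfl

instance (d : TiltCode.{u}) : IsMarkovKernel (tiltKernel d α) :=
  ⟨fun z => by rw [tiltKernel_apply]; infer_instance⟩

lemma compProd_le_smul {C : ℝ≥0∞} (h : ∀ z, ξ z ≤ C • α z) : σ ⊗ₘ ξ ≤ C • (σ ⊗ₘ α) := by
  refine Measure.le_iff.mpr fun s hs => ?_
  rw [Measure.smul_apply, Measure.compProd_apply hs, Measure.compProd_apply hs, smul_eq_mul,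
    ← lintegral_const_mul _ (Kernel.measurable_kernel_prodMk_left hs)]
  exact lintegral_mono fun z => by simpa using h z (Prod.mk z ⁻¹' s)

/-- The fiberwise inequality integrates to the averaged one. Conversely, the averaged inequality is
localized on sets of z for one test input at a time; the exceptional null set depends on the test
input, so countably many codes are used and `sdpiBound_of_forall_tilt` finishes. -/
lemma divergenceBound_side_iff {t : ℝ} (ht : 0 ≤ t) :
    DivergenceBound t ((σ ⊗ₘ α).map Prod.swap) (sideChan B) sideOut
      ↔ ∀ᵐ z ∂σ, SdpiBound t (α z) (B.sectR z) := by
  classical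
  constructor
  · intro h
    have key : ∀ d : TiltCode.{u}, ∀ᵐ z ∂σ,
        klDiv (fiberOut B (tiltKernel d α) z) (fiberOut B α z)
          ≤ ENNReal.ofReal t * klDiv (tiltKernel d α z) (α z) := by
      intro d
      refine ae_le_of_forall_setLIntegral_le_of_sigmaFinite (measurable_klDiv_kernel _ _)
        fun S hS _ => ?_
      -- Tilting only over S, with the law σ of z unchanged, makes all fibers outside S contribute
      -- 0.
      let η := Kernel.piecewise hS (tiltKernel d α) α
      have hη : ∀ z, η z ≤ ((1 + ∑ w, d.2 w : ℕ) : ℝ≥0∞) • α z := by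
        intro z
        simp only [η, Kernel.piecewise_apply]
        split_ifs
        · rw [tiltKernel_apply]; exact tilt_le d _
        · refine Measure.le_iff.mpr fun s _ => ?_
          rw [Measure.smul_apply, smul_eq_mul]
          exact le_mul_of_one_le_left' (by exact_mod_cast Nat.le_add_right 1 _)
      have hfin : klDiv ((σ ⊗ₘ η).map Prod.swap) ((σ ⊗ₘ α).map Prod.swap) ≠ ∞ := by
        rw [klDiv_map_of_leftInverse _ _ measurable_swap measurable_swap Prod.swap_swap]
        exact klDiv_ne_top_of_le_smul (ENNReal.natCast_ne_top _) (compProd_le_smul hη)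
      have : IsProbabilityMeasure ((σ ⊗ₘ η).map Prod.swap) :=
        Measure.isProbabilityMeasure_map (by fun_prop)
      have hb := h _ hfin
      obtain ⟨e1, e2⟩ := divExcess_side (B := B) hfin
      rw [e1, e2] at hb
      have i1 : ∫⁻ z, klDiv (fiberOut B η z) (fiberOut B α z) ∂σ
          = ∫⁻ z in S, klDiv (fiberOut B (tiltKernel d α) z) (fiberOut B α z) ∂σ := by
        rw [← lintegral_indicator hS]
        refine lintegral_congr fun z => ?_
        rw [fiberOut_apply]
        by_cases hz : z ∈ S
        · simp only [η, Kernel.piecewise_apply, if_pos hz, Set.indicator_of_mem hz, fiberOut_apply]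
        · simp only [η, Kernel.piecewise_apply, if_neg hz, Set.indicator_of_notMem hz,
            fiberOut_apply, klDiv_self]
      have i2 : ∫⁻ z, klDiv (η z) (α z) ∂σ
          = ∫⁻ z in S, klDiv (tiltKernel d α z) (α z) ∂σ := by
        rw [← lintegral_indicator hS]
        refine lintegral_congr fun z => ?_
        by_cases hz : z ∈ S
        · simp only [η, Kernel.piecewise_apply, if_pos hz, Set.indicator_of_mem hz]
        · simp only [η, Kernel.piecewise_apply, if_neg hz, Set.indicator_of_notMem hz, klDiv_self]
      rw [klDiv_compProd_swap] at hfin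
      have f2 := (ENNReal.add_ne_top.mp hfin).2
      have f1 := (lintegral_klDiv_fiberOut_le (B := B).trans_lt f2.lt_top).ne
      rw [lintegral_const_mul _ (measurable_klDiv_kernel _ _), ← i1, ← i2,
        ← ENNReal.ofReal_toReal f1, ← ENNReal.ofReal_toReal f2, ← ENNReal.ofReal_mul ht]
      exact ENNReal.ofReal_le_ofReal hb
    filter_upwards [ae_all_iff.mpr key] with z hz
    refine sdpiBound_of_forall_tilt fun d => ?_
    have h1 := hz d
    rw [fiberOut_apply, fiberOut_apply, tiltKernel_apply] at h1
    have hfin : klDiv (tilt d (α z)) (α z) ≠ ∞ :=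
      klDiv_ne_top_of_le_smul (ENNReal.natCast_ne_top _) (tilt_le d _)
    have h2 := ENNReal.toReal_mono (ENNReal.mul_ne_top ENNReal.ofReal_ne_top hfin) h1
    rwa [ENNReal.toReal_mul, ENNReal.toReal_ofReal ht] at h2
  · intro h Q _ hQ
    obtain ⟨q, _, ξ, _, rfl⟩ := exists_eq_map_swap Q
    obtain ⟨e1, e2⟩ := divExcess_side (B := B) hQ
    rw [e1, e2]
    rw [klDiv_compProd_swap] at hQ
    obtain ⟨h0, h1⟩ := ENNReal.add_ne_top.mp hQ
    have hq : q ≪ σ := (klDiv_ne_top_iff.mp h0).1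
    have hle : ∫⁻ z, klDiv (fiberOut B ξ z) (fiberOut B α z) ∂q
        ≤ ENNReal.ofReal t * ∫⁻ z, klDiv (ξ z) (α z) ∂q := by
      rw [← lintegral_const_mul _ (measurable_klDiv_kernel _ _)]
      refine lintegral_mono_ae ?_
      -- Finiteness of D(q ‖ σ) gives q ≪ σ, so the hypothesis for σ-almost every z holds q-almost
      -- everywhere.
      filter_upwards [hq.ae_le h, ae_lt_top (measurable_klDiv_kernel ξ α) h1] with z hz hfin
      have hb := hz (ξ z) hfin.ne
      rw [fiberOut_apply, fiberOut_apply, ← ENNReal.ofReal_toReal (klDiv_comp_ne_top hfin.ne),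
        ← ENNReal.ofReal_toReal hfin.ne, ← ENNReal.ofReal_mul ht]
      exact ENNReal.ofReal_le_ofReal hb
    have h2 := ENNReal.toReal_mono (ENNReal.mul_ne_top ENNReal.ofReal_ne_top h1) hle
    rwa [ENNReal.toReal_mul, ENNReal.toReal_ofReal ht] at h2

end SideInformation

/-! ### The source ((X', Z), (Y', Z), Z). -/

section SideInformationSource

variable {𝒳 𝒴 𝒵 : Type u}
  [MeasurableSpace 𝒳] [StandardBorelSpace 𝒳] [Nonempty 𝒳]
  [MeasurableSpace 𝒴] [StandardBorelSpace 𝒴] [Nonempty 𝒴]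
  [MeasurableSpace 𝒵] [StandardBorelSpace 𝒵] [Nonempty 𝒵]
  (P : Measure (𝒳 × 𝒴 × 𝒵)) [IsProbabilityMeasure P]

/-- The conditional law of `(X, Y)` given `Z`, as a kernel. -/
noncomputable def condKernelXY : Kernel 𝒵 (𝒳 × 𝒴) :=
  condDistrib (fun ω : 𝒳 × 𝒴 × 𝒵 => (ω.1, ω.2.1)) (fun ω => ω.2.2) P

instance : IsMarkovKernel (condKernelXY P) := by unfold condKernelXY; infer_instance

instance : IsProbabilityMeasure (lawZ P) := Measure.isProbabilityMeasure_map (by fun_prop)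

instance : IsProbabilityMeasure (withSideInfo P) := Measure.isProbabilityMeasure_map (by fun_prop)

lemma lintegral_eq_condKernelXY {f : 𝒳 × 𝒴 × 𝒵 → ℝ≥0∞} (hf : Measurable f) :
    ∫⁻ ω, f ω ∂P = ∫⁻ z, ∫⁻ x, ∫⁻ y, f (x, (y, z)) ∂(condKernelXY P).condKernel (z, x)
      ∂(condKernelXY P).fst z ∂lawZ P := by
  have h := compProd_map_condDistrib (mβ := inferInstance) (μ := P)
    (X := fun ω : 𝒳 × 𝒴 × 𝒵 => ω.2.2) (Y := fun ω : 𝒳 × 𝒴 × 𝒵 => (ω.1, ω.2.1))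
    (Measurable.aemeasurable (by fun_prop))
  have h1 : ∫⁻ ω, f ω ∂P = ∫⁻ p, f (p.2.1, (p.2.2, p.1))
      ∂(P.map fun ω => (ω.2.2, (ω.1, ω.2.1))) := by
    rw [lintegral_map (by fun_prop) (by fun_prop)]
  rw [h1, ← h, Measure.lintegral_compProd (by fun_prop)]
  refine lintegral_congr fun z => ?_
  change ∫⁻ p, f (p.1, (p.2, z)) ∂(condKernelXY P z) = _
  conv_lhs => rw [← (condKernelXY P).disintegrate (condKernelXY P).condKernel]
  rw [Kernel.lintegral_compProd _ _ _ (by fun_prop)]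

lemma lawX_withSideInfo :
    lawX (withSideInfo P) = (lawZ P ⊗ₘ (condKernelXY P).fst).map Prod.swap := by
  refine Measure.ext_of_lintegral _ fun f hf => ?_
  rw [lawX, withSideInfo, Measure.map_map (by fun_prop) (by fun_prop), lintegral_map hf (by fun_prop),
    lintegral_eq_condKernelXY P (by fun_prop), lintegral_map hf (by fun_prop),
    Measure.lintegral_compProd (by fun_prop)]
  simp

lemma chanY_withSideInfo :
    chanY (withSideInfo P) =ᵐ[lawX (withSideInfo P)] sideChan (condKernelXY P).condKernel := by
  refine Kernel.ae_eq_of_compProd_eq ?_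
  rw [← lawXY_eq]
  refine Measure.ext_of_lintegral _ fun f hf => ?_
  have h : lawXY (withSideInfo P) = P.map fun ω => ((ω.1, ω.2.2), (ω.2.1, ω.2.2)) := by
    rw [lawXY, withSideInfo, Measure.map_map (by fun_prop) (by fun_prop)]
    rfl
  rw [h, lintegral_map hf (by fun_prop), lintegral_eq_condKernelXY P (by fun_prop),
    Measure.lintegral_compProd hf, lawX_withSideInfo,
    lintegral_map (by fun_prop) (by fun_prop), Measure.lintegral_compProd (by fun_prop)]
  refine lintegral_congr fun z => lintegral_congr fun x => ?_
  rw [lintegral_sideChan _ (by fun_prop)]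
  rfl

lemma chanZ_withSideInfo : chanZ (withSideInfo P) =ᵐ[lawX (withSideInfo P)] sideOut := by
  refine Kernel.ae_eq_of_compProd_eq ?_
  rw [← lawXZ_eq, sideOut, Measure.compProd_deterministic, lawXZ, lawX,
    Measure.map_map (by fun_prop) (by fun_prop)]
  rw [withSideInfo, Measure.map_map (by fun_prop) (by fun_prop),
    Measure.map_map (by fun_prop) (by fun_prop)]
  rfl

/-- The jointly measurable conditional kernel, cut at z, is a version of the channel of the
conditional law at z; the bound does not depend on the version. -/
lemma sStar_condLawXY_le_iff {t : ℝ} (ht : 0 ≤ t) (z : 𝒵) :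
    sStar (condLawXY P z) ≤ t
      ↔ SdpiBound t ((condKernelXY P).fst z) ((condKernelXY P).condKernel.sectR z) := by
  rw [sStar_le_iff _ ht]
  have h1 : (condLawXY P z).fst = (condKernelXY P).fst z := (Kernel.fst_apply _ _).symm
  have h2 : (condKernelXY P).fst z ⊗ₘ (condKernelXY P).condKernel.sectR z = condLawXY P z := by
    rw [← Kernel.compProd_apply_eq_compProd_sectR, Kernel.disintegrate]
    rfl
  have h3 : (condLawXY P z).condKernel =ᵐ[(condKernelXY P).fst z]
      (condKernelXY P).condKernel.sectR z := by
    refine Kernel.ae_eq_of_compProd_eq ?_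
    rw [h2, ← h1, Measure.disintegrate]
  rw [h1]
  exact ⟨fun h => h.congr h3, fun h => h.congr h3.symm⟩

/-- The side information is a function of Y, so the divergence excess is an average of fiber
divergences and is nonnegative. The divergence criterion then applies, and it is equivalent to the
fiberwise bound for almost every z, which is a bound on the essential supremum. -/
lemma sStarZ_withSideInfo :
    sStarZ (withSideInfo P) = essSup (fun z => sStar (condLawXY P z)) (lawZ P) := by
  have hX := lawX_withSideInfo P
  have hY := chanY_withSideInfo P
  have hZ := chanZ_withSideInfo P
  have hdiv : ∀ (Q : Measure (𝒳 × 𝒵)) [IsProbabilityMeasure Q],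
      klDiv Q (lawX (withSideInfo P)) ≠ ∞ →
      divExcess (lawX (withSideInfo P)) (chanY (withSideInfo P)) (chanZ (withSideInfo P)) Q
        = divExcess (lawX (withSideInfo P)) (sideChan (condKernelXY P).condKernel) sideOut Q ∧
      divExcess (lawX (withSideInfo P)) Kernel.id (chanZ (withSideInfo P)) Q
        = divExcess (lawX (withSideInfo P)) Kernel.id sideOut Q := by
    intro Q _ hQ
    have hQ' := (klDiv_ne_top_iff.mp hQ).1
    simp only [divExcess, outDiv_congr hY hQ', outDiv_congr hZ hQ', and_self]
  have hdeg : ∀ (Q : Measure (𝒳 × 𝒵)) [IsProbabilityMeasure Q],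
      klDiv Q (lawX (withSideInfo P)) ≠ ∞ →
      0 ≤ divExcess (lawX (withSideInfo P)) (chanY (withSideInfo P)) (chanZ (withSideInfo P)) Q := by
    intro Q _ hQ
    rw [(hdiv Q hQ).1]
    obtain ⟨q, _, ξ, _, rfl⟩ := exists_eq_map_swap Q
    rw [hX] at hQ ⊢
    rw [(divExcess_side hQ).1]
    exact ENNReal.toReal_nonneg
  refine eq_of_forall_real_le_iff (sStarZ_nonneg _) ?_ fun t ht => ?_
  · rw [← essSup_const (μ := lawZ P) (0 : EReal) (IsProbabilityMeasure.ne_zero _)]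
    exact essSup_mono_ae (ae_of_all _ fun z => sStar_nonneg _)
  have h1 : essSup (fun z => sStar (condLawXY P z)) (lawZ P) ≤ t
      ↔ ∀ᵐ z ∂lawZ P, sStar (condLawXY P z) ≤ t :=
    ⟨fun h => (ae_le_essSup (f := fun z => sStar (condLawXY P z))).mono fun z hz => hz.trans h, fun h => essSup_le_of_ae_le _ h⟩
  rw [h1, sStarZ_le_iff_divergence _ ht hdeg]
  simp only [sStar_condLawXY_le_iff P ht]
  rw [← divergenceBound_side_iff ht, ← hX]
  refine forall_congr' fun Q => forall_congr' fun _ => forall_congr' fun hQ => ?_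
  rw [(hdiv Q hQ).1, (hdiv Q hQ).2]

end SideInformationSource

end KeyCapacity

theorem theorem4 :
    -- 1) range
    (∀ (𝒳 𝒴 𝒵 : Type u)
      [MeasurableSpace 𝒳] [StandardBorelSpace 𝒳] [Nonempty 𝒳]
      [MeasurableSpace 𝒴] [StandardBorelSpace 𝒴] [Nonempty 𝒴]
      [MeasurableSpace 𝒵] [StandardBorelSpace 𝒵] [Nonempty 𝒵]
      (P : Measure (𝒳 × 𝒴 × 𝒵)) [IsProbabilityMeasure P],
      0 ≤ sStarZ P ∧ sStarZ P ≤ 1) ∧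
    -- 2) tensorization
    (∀ (L : ℕ) [NeZero L] (𝒳 𝒴 𝒵 : Fin L → Type u)
      [∀ i, MeasurableSpace (𝒳 i)] [∀ i, StandardBorelSpace (𝒳 i)] [∀ i, Nonempty (𝒳 i)]
      [∀ i, MeasurableSpace (𝒴 i)] [∀ i, StandardBorelSpace (𝒴 i)] [∀ i, Nonempty (𝒴 i)]
      [∀ i, MeasurableSpace (𝒵 i)] [∀ i, StandardBorelSpace (𝒵 i)] [∀ i, Nonempty (𝒵 i)]
      (P : Measure ((∀ i, 𝒳 i) × (∀ i, 𝒴 i) × (∀ i, 𝒵 i))) [IsProbabilityMeasure P],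
      IsProductSource P →
      sStarZ P = Finset.univ.sup' Finset.univ_nonempty (fun i => sStarZ (component P i))) ∧
    -- 3) variational formula
    (∀ (𝒳 𝒴 𝒵 : Type u)
      [MeasurableSpace 𝒳] [StandardBorelSpace 𝒳] [Nonempty 𝒳]
      [MeasurableSpace 𝒴] [StandardBorelSpace 𝒴] [Nonempty 𝒴]
      [MeasurableSpace 𝒵] [StandardBorelSpace 𝒵] [Nonempty 𝒵]
      (P : Measure (𝒳 × 𝒴 × 𝒵)) [IsProbabilityMeasure P],
      sStarZ P = supOrZero (variationalRatios P)) ∧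
    -- 4) stochastically degraded sources
    (∀ (𝒳 𝒴 𝒵 : Type u)
      [MeasurableSpace 𝒳] [StandardBorelSpace 𝒳] [Nonempty 𝒳]
      [MeasurableSpace 𝒴] [StandardBorelSpace 𝒴] [Nonempty 𝒴]
      [MeasurableSpace 𝒵] [StandardBorelSpace 𝒵] [Nonempty 𝒵]
      (P P' : Measure (𝒳 × 𝒴 × 𝒵)) [IsProbabilityMeasure P] [IsProbabilityMeasure P'],
      IsDegradedVersion P P' →
      sStarZ P = supOrZero (condInfoRatios P') ∧
      sStarZ P = supOrZero (divergenceRatios P)) ∧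
    -- 5) `X = (X', Z)`, `Y = (Y', Z)`
    (∀ (𝒳 𝒴 𝒵 : Type u)
      [MeasurableSpace 𝒳] [StandardBorelSpace 𝒳] [Nonempty 𝒳]
      [MeasurableSpace 𝒴] [StandardBorelSpace 𝒴] [Nonempty 𝒴]
      [MeasurableSpace 𝒵] [StandardBorelSpace 𝒵] [Nonempty 𝒵]
      (P : Measure (𝒳 × 𝒴 × 𝒵)) [IsProbabilityMeasure P],
      sStarZ (withSideInfo P) = essSup (fun z => sStar (condLawXY P z)) (lawZ P)) ∧
    -- 6) constant `Z`
    (∀ (𝒳 𝒴 𝒵 : Type u)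
      [MeasurableSpace 𝒳] [StandardBorelSpace 𝒳] [Nonempty 𝒳]
      [MeasurableSpace 𝒴] [StandardBorelSpace 𝒴] [Nonempty 𝒴]
      [MeasurableSpace 𝒵] [StandardBorelSpace 𝒵] [Nonempty 𝒵]
      (P : Measure (𝒳 × 𝒴 × 𝒵)) [IsProbabilityMeasure P],
      (∃ c : 𝒵, ∀ᵐ ω ∂P, ω.2.2 = c) →
      sStarZ P = sStar (lawXY P) ∧
      sStarZ P = supOrZero (sdpiInfoRatios (lawXY P))) := by
  refine ⟨?_, ?_, ?_, ?_, ?_, ?_⟩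
  · intro 𝒳 𝒴 𝒵 _ _ _ _ _ _ _ _ _ P _
    exact ⟨sStarZ_nonneg P, sStarZ_le_one P⟩
  · intro L _ 𝒳 𝒴 𝒵 _ _ _ _ _ _ _ _ _ P _ hP
    exact sStarZ_productSource P hP
  · intro 𝒳 𝒴 𝒵 _ _ _ _ _ _ _ _ _ P _
    exact sStarZ_eq_supOrZero_variationalRatios P
  · intro 𝒳 𝒴 𝒵 _ _ _ _ _ _ _ _ _ P P' _ _ h
    exact sStarZ_eq_of_isDegradedVersion h
  · intro 𝒳 𝒴 𝒵 _ _ _ _ _ _ _ _ _ P _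
    exact sStarZ_withSideInfo P
  · rintro 𝒳 𝒴 𝒵 _ _ _ _ _ _ _ _ _ P _ ⟨c, hc⟩
    exact sStarZ_eq_of_ae_eq_const P hc
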